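/- Let $G$ be a compact (not necessarily connected) Lie group and $H\subset G$ a closed subgroup such that the homogeneous space $G/H$ is connected and simply connected. Let $\mathfrak g\supset\mathfrak h$ be the Lie algebras, $B$ the Killing form of $\mathfrak g$, and assume that the isotropy representation of $H$ on $\mathfrak g/\mathfrak h=T_{eH}(G/H)$ is multiplicity-free: $\mathfrak g/\mathfrak h=V_1\oplus\dots\oplus V_d$, $d\ge 1$, with pairwise inequivalent irreducible $H$-submodules $V_i$. Let $\mathcal M$ be the cone of $G$-invariant Riemannian metrics on $G/H$ (equivalently, of $H$-invariant Euclidean scalar products on $\mathfrak g/\mathfrak h$) and $\mathcal M_1=\{g\in\mathcal M:\operatorname{vol}_g(G/H)=1\}$. Let $\mathfrak m$ be any $\mathrm{Ad}(H)$-invariant complement to $\mathfrak h$ in $\mathfrak g$, identified with $\mathfrak g/\mathfrak h$, and let $\mathfrak m_i\subset\mathfrak m$ be the submodule corresponding to $V_i$. For $g\in\mathcal M$ let $\mathrm{Ric}_g$ be the Ricci operator of $(G/H,g)$ at $eH$, and let $B_g=g^{-1}B|_{\mathfrak m}$ be the endomorphism of $\mathfrak m$ with $g(B_gX,Y)=B(X,Y)$.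 For a real number $\theta$ with $|\theta|<1$ put $$\ell_\theta(g)=\operatorname{tr}\bigl(-(1+\theta)\mathrm{Ric}_g-B_g\bigr),\qquad \mu_\theta(g)=\frac1{\ell_\theta(g)}\bigl(-(1+\theta)\mathrm{Ric}_g-B_g\bigr).$$ The moment map $\mu_\theta$, which up to sign is the logarithmic gradient of $\ell_\theta$ on $\mathcal M$, takes values in the $(d-1)$-dimensional affine space of the diagonal matrices $A=\sum_i a_i\,\mathrm{Id}_{V_i}$ of trace $1$. Let $\varepsilon_i=\frac{1}{\dim V_i}\,\mathrm{Id}_{V_i}$ (extended by $0$ to the other $V_j$); this is the weight $A\mapsto a_i$, written as a matrix by means of the trace form. Let $g_1\in\mathcal M$ be a fixed metric and let $\Delta$ be the compact convex polytope which is the convex hull of all $\varepsilon_i+\varepsilon_j-\varepsilon_k$ with $g_1([\mathfrak m_i,\mathfrak m_j]+\mathfrak h,\ \mathfrak m_k+\mathfrak h)\ne\{0\}$ and all $\varepsilon_r$ with $B(\mathfrak m_r,\mathfrak m_r)\ne\{0\}$. Then $\dim\Delta=d-1$, and $\mu_\theta$ restricts to a diffeomorphism of $\mathcal M_1$ onto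 the (relative) interior of $\Delta$. -/

import Mathlib

open Set MeasureTheory
open scoped Manifold ContDiff

set_option maxSynthPendingDepth 3

noncomputable section

namespace HomogeneousSpace

/-- Smooth Lie groups satisfy the regularity that Mathlib asks for in the Lie bracket on `𝔤`. -/
instance lieGroup_minSmoothness {E : Type*} [NormedAddCommGroup E] [NormedSpace ℝ E] {G : Type*}
    [TopologicalSpace G] [Group G] [ChartedSpace E G] [LieGroup 𝓘(ℝ, E) ∞ G] :
    LieGroup 𝓘(ℝ, E) (minSmoothness ℝ 3) G := by
  rw [minSmoothness_of_isRCLikeNormedField]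
  infer_instance

/-- (Continuous) bilinear forms on `F`. -/
abbrev Form (F : Type*) [NormedAddCommGroup F] [NormedSpace ℝ F] : Type _ := F →L[ℝ] F →L[ℝ] ℝ

/-! ### Riemannian geometry in a chart

A Riemannian metric in a chart is a map `g : F → Form F`. -/

section Chart

variable {F : Type*} [NormedAddCommGroup F]

section

variable [NormedSpace ℝ F]

/-- The Koszul form `(u, v, w) ↦ (D_u g (v, w) + D_v g (u, w) - D_w g (u, v)) / 2` at `y`. -/
def koszul (g : F → Form F) (y : F) : F →L[ℝ] F →L[ℝ] F →L[ℝ] ℝ :=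
  let D : F →L[ℝ] F →L[ℝ] F →L[ℝ] ℝ := fderiv ℝ g y
  let D' : F →L[ℝ] F →L[ℝ] F →L[ℝ] ℝ :=
    (ContinuousLinearMap.flipₗᵢ ℝ F F ℝ).toContinuousLinearEquiv.toContinuousLinearMap ∘L D.flip
  (2⁻¹ : ℝ) • (D + D.flip - D')

theorem koszul_apply (g : F → Form F) (y u v w : F) :
    koszul g y u v w =
      (2⁻¹ : ℝ) * (fderiv ℝ g y u v w + fderiv ℝ g y v u w - fderiv ℝ g y w u v) := by
  simp [koszul]

/-- The Christoffel symbol of the Levi-Civita connection at `y`: `Γ(u, v)` is the vector with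
`g_y (Γ(u, v), w) = koszul (u, v, w)` for all `w`. -/
def christoffel (g : F → Form F) (y : F) : F →L[ℝ] F →L[ℝ] F :=
  (ContinuousLinearMap.compL ℝ F (F →L[ℝ] ℝ) F (g y).inverse) ∘L koszul g y

theorem christoffel_apply (g : F → Form F) (y u v : F) :
    christoffel g y u v = (g y).inverse (koszul g y u v) := rfl

/-- The curvature at `y`: the endomorphism `u ↦ R(u, v) w = ∇_u ∇_v w - ∇_v ∇_u w`, where
`u, v, w` are constant vector fields. -/
def curvature (g : F → Form F) (y v w : F) : F →L[ℝ] F :=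
  ((fderiv ℝ (christoffel g) y).flip v).flip w - (fderiv ℝ (christoffel g) y v).flip w
    + (christoffel g y).flip (christoffel g y v w)
    - christoffel g y v ∘L (christoffel g y).flip w

theorem curvature_apply (g : F → Form F) (y u v w : F) :
    curvature g y v w u =
      fderiv ℝ (christoffel g) y u v w - fderiv ℝ (christoffel g) y v u w
        + christoffel g y u (christoffel g y v w) - christoffel g y v (christoffel g y u w) := by
  simp [curvature]

/-- The Ricci tensor at `y`: `ric(v, w)` is the trace of `u ↦ R(u, v) w`. -/
def ricciForm (g : F → Form F) (y : F) : F →ₗ[ℝ] F →ₗ[ℝ] ℝ :=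
  LinearMap.mk₂ ℝ (fun v w => LinearMap.trace ℝ F (curvature g y v w).toLinearMap)
    (by intro v v' w
        rw [← map_add]
        congr 1
        ext u
        simp [curvature_apply]; abel)
    (by intro c v w
        rw [← map_smul]
        congr 1
        ext u
        simp [curvature_apply, smul_sub, smul_add])
    (by intro v w w'
        rw [← map_add]
        congr 1
        ext u
        simp [curvature_apply]; abel)
    (by intro c v w
        rw [← map_smul]
        congr 1
        ext u
        simp [curvature_apply, smul_sub, smul_add])

/-- The operator `g⁻¹ b`, i.e. the endomorphism `A` with `g(A v, w) = b(v, w)`. -/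
def formOperator [FiniteDimensional ℝ F] (g : Form F) (b : F →ₗ[ℝ] F →ₗ[ℝ] ℝ) : F →L[ℝ] F :=
  g.inverse ∘L b.toContinuousBilinearMap

end

/-- The Riemannian volume density `√det (g(e_i, e_j))` at `y`, where `e` is an orthonormal basis
of the Euclidean model space `F`. -/
def density [InnerProductSpace ℝ F] [FiniteDimensional ℝ F] (g : F → Form F) (y : F) : ℝ :=
  Real.sqrt (Matrix.det (Matrix.of fun i j : Fin (Module.finrank ℝ F) =>
    g y (stdOrthonormalBasis ℝ F i) (stdOrthonormalBasis ℝ F j)))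

end Chart

/-! ### The homogeneous space `G/H`

`G` is a manifold modelled on `E`, and `G/H` is one modelled on `F`. In Mathlib every tangent space
of a manifold modelled on `F` is a copy of `F` (through the preferred chart at the base point), so
that below `F` also stands for the tangent space `T_{eH}(G/H)`. -/

section Homogeneous

variable {E : Type*} [NormedAddCommGroup E] [NormedSpace ℝ E]
  {F : Type*} [NormedAddCommGroup F] [InnerProductSpace ℝ F]
  {G : Type*} [TopologicalSpace G] [Group G] [ChartedSpace E G]
  (H : Subgroup G) [ChartedSpace F (G ⧸ H)]

/-- The base point `eH`. -/
abbrev base : G ⧸ H := ((1 : G) : G ⧸ H)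

variable (E F) in
/-- The differential at `e` of the projection `G → G/H`, a map from `𝔤` to `T_{eH}(G/H)`. If the
projection is a submersion, it is onto with kernel `𝔥`, the Lie algebra of `H`, and so it
identifies `𝔤/𝔥` with `T_{eH}(G/H)`. -/
def projDeriv : GroupLieAlgebra 𝓘(ℝ, E) G →L[ℝ] F :=
  mfderiv 𝓘(ℝ, E) 𝓘(ℝ, F) (fun a : G => (a : G ⧸ H)) 1

variable (E F) in
/-- The Lie algebra `𝔥 = T_e H` of `H`, the kernel of `𝔤 → T_{eH}(G/H)`. -/
def isotropyAlgebra : Submodule ℝ (GroupLieAlgebra 𝓘(ℝ, E) G) :=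
  LinearMap.ker (projDeriv E F H).toLinearMap

variable (E) in
/-- The adjoint action of `G` on `𝔤`. -/
def Ad (a : G) : GroupLieAlgebra 𝓘(ℝ, E) G →L[ℝ] GroupLieAlgebra 𝓘(ℝ, E) G :=
  mfderiv 𝓘(ℝ, E) 𝓘(ℝ, E) (fun x : G => a * x * a⁻¹) 1

variable (F) in
/-- The isotropy representation `ρ` of `H` on `T_{eH}(G/H) = 𝔤/𝔥`. -/
def isotropyRep (h : H) : F →L[ℝ] F :=
  mfderiv 𝓘(ℝ, F) 𝓘(ℝ, F) (fun p : G ⧸ H => (h : G) • p) (base H)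

variable (F) in
/-- `𝔪` is an `H`-invariant complement to `𝔥` in `𝔤`. -/
structure IsReductiveComplement (𝔪 : Submodule ℝ (GroupLieAlgebra 𝓘(ℝ, E) G)) : Prop where
  isCompl : IsCompl (isotropyAlgebra E F H) 𝔪
  invariant : ∀ h ∈ H, ∀ X ∈ 𝔪, Ad E h X ∈ 𝔪

/-- `ρ(H)`-invariant subspaces of `T_{eH}(G/H)`. -/
def IsInvariant (W : Submodule ℝ F) : Prop :=
  ∀ h : H, ∀ v ∈ W, isotropyRep F H h v ∈ W

/-- `W` is an irreducible `H`-submodule of `T_{eH}(G/H)`. -/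
structure IsIrreducibleSubmodule (W : Submodule ℝ F) : Prop where
  invariant : IsInvariant H W
  ne_bot : W ≠ ⊥
  eq_bot_or_eq : ∀ W' : Submodule ℝ F, IsInvariant H W' → W' ≤ W → W' = ⊥ ∨ W' = W

/-- The invariant subspaces `W` and `W'` of `T_{eH}(G/H)` are equivalent `H`-modules. -/
def AreEquivalent (W W' : Submodule ℝ F) : Prop :=
  ∃ f : W ≃ₗ[ℝ] W', ∀ h : H, ∀ v v' : W, (v' : F) = isotropyRep F H h v →
    (f v' : F) = isotropyRep F H h (f v)

/-- `𝔤/𝔥` is multiplicity-free: it is the direct sum of the pairwise inequivalent irreducible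
`H`-submodules `V 1, …, V d`. -/
structure IsMultiplicityFreeDecomposition {d : ℕ} (V : Fin d → Submodule ℝ F) : Prop where
  internal : DirectSum.IsInternal V
  irreducible : ∀ i, IsIrreducibleSubmodule H (V i)
  inequivalent : ∀ i j, i ≠ j → ¬ AreEquivalent H (V i) (V j)

variable (F) in
/-- The cone `𝓜(G, H)` of invariant Riemannian metrics on `G/H`, as the `ρ(H)`-invariant Euclidean
scalar products on `T_{eH}(G/H) = 𝔤/𝔥`. -/
def invariantMetrics : Set (Form F) :=
  {g | (∀ u v, g u v = g v u) ∧ (∀ v, v ≠ 0 → 0 < g v v) ∧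
    ∀ h : H, ∀ u v, g (isotropyRep F H h u) (isotropyRep F H h v) = g u v}

/-- The invariant Riemannian metric on `G/H` with value `g` at `eH`, at the point `p = aH`:
`(u, v) ↦ g(a⁻¹ u, a⁻¹ v)`. For `g ∈ 𝓜(G, H)` the choice of `a` is irrelevant. -/
def metricAt (g : Form F) (p : G ⧸ H) : Form F :=
  let D : F →L[ℝ] F :=
    mfderiv 𝓘(ℝ, F) 𝓘(ℝ, F) (fun q : G ⧸ H => (Quotient.out p : G)⁻¹ • q) p
  g.bilinearComp D D

/-- The invariant Riemannian metric with value `g` at `eH`, in the preferred chart at `c`. -/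
def chartMetric (g : Form F) (c : G ⧸ H) (y : F) : Form F :=
  let D : F →L[ℝ] F := mfderiv 𝓘(ℝ, F) 𝓘(ℝ, F) (extChartAt 𝓘(ℝ, F) c).symm y
  (metricAt H g ((extChartAt 𝓘(ℝ, F) c).symm y)).bilinearComp D D

variable [FiniteDimensional ℝ F]

section Volume

variable [MeasurableSpace F] [BorelSpace F] [MeasurableSpace (G ⧸ H)]

/-- `ν` is the Riemannian volume measure on `G/H` of the invariant metric `g`: in every chart it
has density `√det g` with respect to Lebesgue measure. -/
def IsRiemannianVolume (g : Form F) (ν : Measure (G ⧸ H)) : Prop :=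
  ∀ (c : G ⧸ H) (A : Set (G ⧸ H)), MeasurableSet A → A ⊆ (extChartAt 𝓘(ℝ, F) c).source →
    ν A = ∫⁻ y in extChartAt 𝓘(ℝ, F) c '' A, ENNReal.ofReal (density (chartMetric H g c) y)

variable (F) in
/-- `𝓜₁(G, H)`: the invariant Riemannian metrics with `vol_g(G/H) = 1`. -/
def unitVolumeMetrics : Set (Form F) :=
  {g ∈ invariantMetrics F H | ∃ ν : Measure (G ⧸ H), IsRiemannianVolume H g ν ∧ ν univ = 1}

end Volume

/-- The Ricci operator `Ric_{G/H,g}` at the point `eH`, computed in the preferred chart at `eH`. -/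
def ricciOperator (g : Form F) : F →L[ℝ] F :=
  formOperator g
    (ricciForm (chartMetric H g (base H)) (extChartAt 𝓘(ℝ, F) (base H) (base H)))

/-- The inverse `T_{eH}(G/H) → 𝔪 ⊆ 𝔤` of the isomorphism `𝔪 ≅ 𝔤/𝔥 = T_{eH}(G/H)`. -/
def lift (𝔪 : Submodule ℝ (GroupLieAlgebra 𝓘(ℝ, E) G)) : F →L[ℝ] GroupLieAlgebra 𝓘(ℝ, E) G :=
  𝔪.subtypeL ∘L ((projDeriv E F H) ∘L 𝔪.subtypeL).inverse

/-- The submodule `𝔪_i ⊆ 𝔪` that corresponds to `V i` under `𝔪 ≅ 𝔤/𝔥 = T_{eH}(G/H)`. -/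
def block {d : ℕ} (V : Fin d → Submodule ℝ F)
    (𝔪 : Submodule ℝ (GroupLieAlgebra 𝓘(ℝ, E) G)) (i : Fin d) :
    Submodule ℝ (GroupLieAlgebra 𝓘(ℝ, E) G) :=
  𝔪 ⊓ (V i).comap (projDeriv E F H).toLinearMap

/-- The projection of `V 1 ⊕ ⋯ ⊕ V d` onto the summand `V i`. -/
def summandProj {d : ℕ} (V : Fin d → Submodule ℝ F) (hV : DirectSum.IsInternal V) (i : Fin d) :
    F →ₗ[ℝ] F :=
  (V i).subtype ∘ₗ DirectSum.component ℝ (Fin d) (fun j => V j) i ∘ₗ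
    (LinearEquiv.ofBijective (DirectSum.coeLinearMap V) hV).symm.toLinearMap

/-- The weight `ε_i`, `⟨ε_i, A⟩ = a_i`, of the Lie algebra `ℝ^d` of `H`-invariant diagonal matrices
`A = ∑ a_i Id_{V i}`. It is written as a diagonal matrix of trace `1` through the pairing
`⟨A', A⟩ = tr (A' A)`: it is `1 / dim V i` on `V i`, and `0` on the other summands `V j`. -/
def weight {d : ℕ} (V : Fin d → Submodule ℝ F) (hV : DirectSum.IsInternal V) (i : Fin d) :
    F →L[ℝ] F :=
  ((Module.finrank ℝ (V i) : ℝ)⁻¹) • LinearMap.toContinuousLinearMap (summandProj V hV i)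

variable [CompleteSpace E] [LieGroup 𝓘(ℝ, E) ∞ G]

/-- The operator `B_{G/H,g} = g⁻¹ B|_𝔪`, with `B` the Killing form of `𝔤` and
`𝔪` identified with `T_{eH}(G/H)`. -/
def killingOperator (𝔪 : Submodule ℝ (GroupLieAlgebra 𝓘(ℝ, E) G)) (g : Form F) : F →L[ℝ] F :=
  formOperator g ((killingForm ℝ (GroupLieAlgebra 𝓘(ℝ, E) G)).compl₁₂
    (lift H 𝔪).toLinearMap (lift H 𝔪).toLinearMap)

/-- The operator `-(1 + θ) Ric_{G/H,g} - B_{G/H,g}`. -/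
def modifiedRicci (θ : ℝ) (𝔪 : Submodule ℝ (GroupLieAlgebra 𝓘(ℝ, E) G)) (g : Form F) :
    F →L[ℝ] F :=
  -((1 + θ) • ricciOperator H g) - killingOperator H 𝔪 g

/-- The modified scalar curvature `ℓ_θ(G/H, g) = tr (-(1 + θ) Ric_{G/H,g} - B_{G/H,g})`. -/
def modifiedScalarCurvature (θ : ℝ) (𝔪 : Submodule ℝ (GroupLieAlgebra 𝓘(ℝ, E) G))
    (g : Form F) : ℝ :=
  LinearMap.trace ℝ F (modifiedRicci H θ 𝔪 g).toLinearMap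

/-- The moment map `μ_θ` compatible with `𝔪`,
`μ_θ(g) = ℓ_θ(G/H, g)⁻¹ (-(1 + θ) Ric_{G/H,g} - B_{G/H,g})`. -/
def momentMap (θ : ℝ) (𝔪 : Submodule ℝ (GroupLieAlgebra 𝓘(ℝ, E) G)) (g : Form F) : F →L[ℝ] F :=
  (modifiedScalarCurvature H θ 𝔪 g)⁻¹ • modifiedRicci H θ 𝔪 g

/-- The polyhedron `Δ`: the convex hull of the weights `ε_i + ε_j - ε_k` with
`g₁([𝔪_i, 𝔪_j] + 𝔥, 𝔪_k + 𝔥) ≠ {0}` and `ε_r` with `B(𝔪_r, 𝔪_r) ≠ {0}`. -/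
def momentPolytope {d : ℕ} (V : Fin d → Submodule ℝ F) (hV : DirectSum.IsInternal V)
    (𝔪 : Submodule ℝ (GroupLieAlgebra 𝓘(ℝ, E) G)) (g₁ : Form F) : Set (F →L[ℝ] F) :=
  convexHull ℝ
    ({A | ∃ i j k, (∃ X ∈ block H V 𝔪 i, ∃ Y ∈ block H V 𝔪 j, ∃ Z ∈ block H V 𝔪 k,
        g₁ (projDeriv E F H ⁅X, Y⁆) (projDeriv E F H Z) ≠ 0) ∧
        A = weight V hV i + weight V hV j - weight V hV k} ∪
     {A | ∃ r, (∃ X ∈ block H V 𝔪 r, ∃ Y ∈ block H V 𝔪 r,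
        killingForm ℝ (GroupLieAlgebra 𝓘(ℝ, E) G) X Y ≠ 0) ∧ A = weight V hV r})

end Homogeneous

/-- `f` restricts to a diffeomorphism of `s` onto `t`, where `s` and `t` are smooth submanifolds of
normed spaces. -/
structure IsDiffeomorphismOnto {F F' : Type*} [NormedAddCommGroup F] [NormedSpace ℝ F]
    [NormedAddCommGroup F'] [NormedSpace ℝ F'] (f : F → F') (s : Set F) (t : Set F') : Prop where
  bijOn : BijOn f s t
  smooth : ContDiffOn ℝ ∞ f s
  smooth_inverse : ContDiffOn ℝ ∞ (Function.invFunOn f s) t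

end HomogeneousSpace

end

/-! By Schur's lemma every invariant metric is `∑ x_i g₁|V_i` with `x_i > 0`, so that `x_i = exp
t_i` turns `𝓜` into `ℝ^d`. In these coordinates `-(1 + θ) Ric - B` is a toric moment map `t ↦ ∑_w
c_w exp(-⟨α_w, t⟩) α_w` with weights `ε_i + ε_j - ε_k` and `ε_r`, and its trace is the Laurent
polynomial `∑_w c_w exp(-⟨α_w, t⟩)`. The coefficients are `(1 + θ) / 4` times squares of structure
constants and `-(1 - θ) / 2` times diagonal values of `B`. They are nonnegative because `|θ| < 1`
and the Killing form of a compact group is negative semidefinite, and the weights with nonzero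
coefficient are exactly those that span `Δ` (`modifiedRicci_diagonalMetric`, `basisCoeff_nonneg`,
`momentPolytope_eq`).

Up to sign, the toric moment map is the gradient of a convex function. If the weights span `ℝ^d`,
this function is strictly convex, which gives injectivity and an invertible derivative, and a
coercivity argument shows that every positive combination of the weights is attained
(`exists_toricMoment_eq`). All weights have coordinate sum `1`, so adding a constant to `t` rescales
the moment map; it rescales the volume as well. The slices "trace `1`" and "volume `1`" each meet
every line in this direction once, and the normalized map carries the volume slice onto the interior
of the polytope (`isDiffeomorphismOnto_of_toricMoment`).

The spanning property is where topology enters (`eq_zero_of_pairing_eq_zero`). If `t` annihilates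
all weights and `t_i ≠ 0`, then `B` vanishes on `𝔪_i`, so `𝔪_i` is central and no bracket has a
component in `V_i`. Pairing with a vector of `V_i` is then a functional on `𝔤` that kills `𝔥` and
`[𝔤, 𝔤]`, that is, a closed one-form on `G/H`. It is exact by simple connectedness, and a primitive
has a maximum on the compact space, so the functional vanishes (`functional_eq_zero`): a
contradiction.

The Ricci operator is defined by Christoffel symbols in a chart. The link to algebra is that the
fundamental fields `X*` of the action are Killing fields: the operators `A_X = ∇X*` at `eH` are
skew, satisfy a torsion identity and give the curvature as `[A_X, A_Y] - A_[X,Y]`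
(`curvature_killing`, `curvature_nomizu`). Taking the trace yields the Ricci formula in structure
constants (`IsNomizuMap.ricci`). -/

set_option linter.unusedSectionVars false

noncomputable section

namespace HomogeneousSpace

open Filter Topology VectorField

open Filter Topology

/-! ### Local sections of submersions and smoothness of the action on `G/H` -/

section Action
variable {E : Type*} [NormedAddCommGroup E] [NormedSpace ℝ E]
  {F : Type*} [NormedAddCommGroup F] [NormedSpace ℝ F]

/-- A submersion has smooth local sections. -/
theorem exists_local_section {M N : Type*} [TopologicalSpace M] [ChartedSpace E M]
    [IsManifold 𝓘(ℝ, E) ∞ M]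
    [TopologicalSpace N] [ChartedSpace F N] [IsManifold 𝓘(ℝ, F) ∞ N] {f : M → N} {a : M}
    (h : Manifold.IsSubmersionAt 𝓘(ℝ, E) 𝓘(ℝ, F) ∞ f a) :
    ∃ σ : N → M, σ (f a) = a ∧ ContMDiffAt 𝓘(ℝ, F) 𝓘(ℝ, E) ∞ σ (f a) ∧
      ∀ᶠ q in 𝓝 (f a), f (σ q) = q := by
  set dc := h.domChart.extend 𝓘(ℝ, E) with hdc
  set cc := h.codChart.extend 𝓘(ℝ, F) with hcc
  have ha : a ∈ h.domChart.source := h.mem_domChart_source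
  have hfa : f a ∈ h.codChart.source := h.mem_codChart_source
  have hadc : dc a ∈ dc.target := dc.map_source (by simpa [hdc] using ha)
  have hw := h.writtenInCharts
  have hcca : cc (f a) = (h.equiv (dc a)).1 := by
    have : cc (f (dc.symm (dc a))) = (h.equiv (dc a)).1 := hw hadc
    rwa [dc.left_inv (show a ∈ dc.source by simpa [hdc] using ha)] at this
  -- In the normal form of a submersion `f` is the first projection. The section keeps the second
  -- component frozen at its value at `a`.
  let τ : N → E := fun q => h.equiv.symm (cc q, (h.equiv (dc a)).2)
  have hτa : τ (f a) = dc a := by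
    simp only [τ, hcca]
    exact h.equiv.symm_apply_apply _
  have hccsm : ContMDiffAt 𝓘(ℝ, F) 𝓘(ℝ, F) ∞ cc (f a) :=
    h.codChart.contMDiffAt_extend (I := 𝓘(ℝ, F)) h.codChart_mem_maximalAtlas hfa
  have hτsm : ContMDiffAt 𝓘(ℝ, F) 𝓘(ℝ, E) ∞ τ (f a) := by
    have : ContDiff ℝ ∞ (fun y : F => h.equiv.symm (y, (h.equiv (dc a)).2)) := by fun_prop
    exact this.contMDiff.contMDiffAt.comp (f a) hccsm
  have hdopen : IsOpen dc.target := by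
    rw [hdc]; exact h.domChart.isOpen_extend_target (I := 𝓘(ℝ, E))
  have hdsm : ContMDiffAt 𝓘(ℝ, E) 𝓘(ℝ, E) ∞ dc.symm (dc a) := by
    have := contMDiffOn_extend_symm (I := 𝓘(ℝ, E)) h.domChart_mem_maximalAtlas
    refine (this.mono ?_).contMDiffAt (hdopen.mem_nhds hadc)
    simp [hdc]
  refine ⟨fun q => dc.symm (τ q), ?_, ?_, ?_⟩
  · simp only [hτa]
    exact dc.left_inv (by simpa [hdc] using ha)
  · exact ContMDiffAt.comp (I' := 𝓘(ℝ, E)) (f a) (by rwa [hτa]) hτsm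
  · have h1 : ∀ᶠ q in 𝓝 (f a), τ q ∈ dc.target :=
      hτsm.continuousAt.eventually_mem (by rw [hτa]; exact hdopen.mem_nhds hadc)
    filter_upwards [h1, h.codChart.open_source.mem_nhds hfa] with q hq hq'
    have e1 : cc (f (dc.symm (τ q))) = cc q := by
      have := hw hq
      simp only [Function.comp] at this
      rw [this]
      simp [τ]
    have e2 : f (dc.symm (τ q)) ∈ cc.source := by
      have := dc.map_target hq
      have : f (dc.symm (τ q)) ∈ h.codChart.source :=
        h.source_subset_preimage_source (by rwa [hdc, OpenPartialHomeomorph.extend_source] at this)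
      simpa [hcc] using this
    exact cc.injOn e2 (by simpa [hcc] using hq') e1

variable {G : Type*} [TopologicalSpace G] [Group G] [ChartedSpace E G] [LieGroup 𝓘(ℝ, E) ∞ G]

/-- The action of `G` on `G/H` is smooth. -/
theorem contMDiffSMul_quotient (H : Subgroup G) [ChartedSpace F (G ⧸ H)]
    [IsManifold 𝓘(ℝ, F) ∞ (G ⧸ H)]
    (hπ : Manifold.IsSubmersion 𝓘(ℝ, E) 𝓘(ℝ, F) ∞ (fun a : G => (a : G ⧸ H))) :
    ContMDiffSMul 𝓘(ℝ, E) 𝓘(ℝ, F) ∞ G (G ⧸ H) := by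
  refine ⟨?_⟩
  rintro ⟨a, p⟩
  obtain ⟨b, rfl⟩ := QuotientGroup.mk_surjective p
  -- Near `(a, bH)` the action is `(x, p) ↦ x σ(p) H`, a composite of smooth maps.
  obtain ⟨σ, hσ, hσs, hσe⟩ := exists_local_section (hπ.isSubmersionAt b)
  have h1 : ContMDiffAt (𝓘(ℝ, E).prod 𝓘(ℝ, F)) 𝓘(ℝ, E) ∞ (fun x : G × (G ⧸ H) => x.1 * σ x.2)
      (a, (b : G ⧸ H)) := by
    refine ContMDiffAt.mul contMDiffAt_fst ?_
    exact ContMDiffAt.comp (a, (b : G ⧸ H)) (by exact hσs) contMDiffAt_snd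
  have h2 := (hπ.contMDiff.contMDiffAt (x := a * σ b)).comp (a, (b : G ⧸ H)) h1
  refine h2.congr_of_eventuallyEq ?_
  have h3 : ∀ᶠ x : G × (G ⧸ H) in 𝓝 (a, (b : G ⧸ H)), ((σ x.2 : G) : G ⧸ H) = x.2 :=
    (continuous_snd.tendsto (a, (b : G ⧸ H))).eventually hσe
  filter_upwards [h3] with x hx
  simp only [Function.comp]
  conv_lhs => rw [← hx]
  rfl

end Action

open Filter Topology

/-! ### Fundamental vector fields in charts -/

section Calculus
variable {E : Type*} [NormedAddCommGroup E] [NormedSpace ℝ E]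
  {F : Type*} [NormedAddCommGroup F] [NormedSpace ℝ F]

/-- The second-order consequence of the associativity law `Φ (m (s, t), y) = Φ (s, Φ (t, y))`. -/
theorem fderiv_fundamental_field {m : E × E → E} {Φ : E × F → F} {s₀ : E} {y : F}
    (hm : ContDiffAt ℝ 2 m (s₀, s₀)) (hm₁ : ∀ᶠ s in 𝓝 s₀, m (s₀, s) = s)
    (hm₂ : ∀ᶠ s in 𝓝 s₀, m (s, s₀) = s)
    (hΦ : ContDiffAt ℝ 2 Φ (s₀, y)) (hΦ₀ : Φ (s₀, y) = y)
    (h : ∀ᶠ z in 𝓝 (s₀, s₀), Φ (m z, y) = Φ (z.1, Φ (z.2, y))) (X Y : E) :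
    fderiv ℝ (fun y' => fderiv ℝ Φ (s₀, y') (X, 0)) y (fderiv ℝ Φ (s₀, y) (Y, 0)) =
      fderiv ℝ (fderiv ℝ Φ) (s₀, y) (Y, 0) (X, 0) +
        fderiv ℝ Φ (s₀, y) (fderiv ℝ (fderiv ℝ m) (s₀, s₀) (0, Y) (X, 0), 0) := by
  have hΦ1 : ∀ᶠ z in 𝓝 (s₀, y), DifferentiableAt ℝ Φ z :=
    (hΦ.eventually (by simp)).mono fun z hz => hz.differentiableAt (by simp)
  have hm1 : ∀ᶠ z in 𝓝 (s₀, s₀), DifferentiableAt ℝ m z :=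
    (hm.eventually (by simp)).mono fun z hz => hz.differentiableAt (by simp)
  have hΦ2 : DifferentiableAt ℝ (fderiv ℝ Φ) (s₀, y) :=
    (hΦ.fderiv_right (m := 1) (by norm_num)).differentiableAt (by simp)
  have hm2 : DifferentiableAt ℝ (fderiv ℝ m) (s₀, s₀) :=
    (hm.fderiv_right (m := 1) (by norm_num)).differentiableAt (by simp)
  have hΦc : ContinuousAt (fun t => Φ (t, y)) s₀ :=
    ContinuousAt.comp (f := fun t => (t, y)) (x := s₀) hΦ.continuousAt (by fun_prop)
  have hmX : fderiv ℝ m (s₀, s₀) (X, 0) = X := by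
    have e1 : HasFDerivAt (fun s => m (s, s₀)) (fderiv ℝ m (s₀, s₀) ∘L
        ContinuousLinearMap.inl ℝ E E) s₀ :=
      HasFDerivAt.comp (f := fun s => (s, s₀)) s₀ hm1.self_of_nhds.hasFDerivAt
        (hasFDerivAt_prodMk_left s₀ s₀)
    have e2 : HasFDerivAt (fun s => m (s, s₀)) (ContinuousLinearMap.id ℝ E) s₀ :=
      (hasFDerivAt_id s₀).congr_of_eventuallyEq hm₂
    simpa using congrArg (fun L => L X) (e1.unique e2)
  -- The associativity law differentiated in `s` at the unit, for all `t` near the unit. A second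
  -- differentiation, in `t`, gives the claim.
  have key : ∀ᶠ t in 𝓝 s₀, fderiv ℝ Φ (t, y) (fderiv ℝ m (s₀, t) (X, 0), 0) =
      fderiv ℝ Φ (s₀, Φ (t, y)) (X, 0) := by
    have hc : ∀ᶠ t in 𝓝 s₀, ∀ᶠ s in 𝓝 s₀, Φ (m (s, t), y) = Φ (s, Φ (t, y)) := by
      rw [nhds_prod_eq] at h
      exact (Filter.eventually_swap_iff.1 h).curry
    have h1 : ∀ᶠ t in 𝓝 s₀, DifferentiableAt ℝ Φ (t, y) :=
      (show ContinuousAt (fun t : E => (t, y)) s₀ by fun_prop).eventually hΦ1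
    have h2 : ∀ᶠ t in 𝓝 s₀, DifferentiableAt ℝ m (s₀, t) :=
      (show ContinuousAt (fun t : E => (s₀, t)) s₀ by fun_prop).eventually hm1
    have h3 : ∀ᶠ t in 𝓝 s₀, DifferentiableAt ℝ Φ (s₀, Φ (t, y)) := by
      have : ContinuousAt (fun t : E => (s₀, Φ (t, y))) s₀ := by fun_prop
      refine this.eventually ?_
      simpa [hΦ₀] using hΦ1
    filter_upwards [hc, h1, h2, h3, hm₁] with t hc h1 h2 h3 h4
    have e1 : HasFDerivAt (fun s => Φ (m (s, t), y)) (fderiv ℝ Φ (t, y) ∘L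
        ContinuousLinearMap.inl ℝ E F ∘L (fderiv ℝ m (s₀, t) ∘L
        ContinuousLinearMap.inl ℝ E E)) s₀ := by
      have a1 : HasFDerivAt (fun s => m (s, t)) (fderiv ℝ m (s₀, t) ∘L
        ContinuousLinearMap.inl ℝ E E) s₀ :=
        HasFDerivAt.comp (f := fun s => (s, t)) s₀ h2.hasFDerivAt (hasFDerivAt_prodMk_left s₀ t)
      have a2 : HasFDerivAt (fun s' => Φ (s', y)) (fderiv ℝ Φ (t, y) ∘L
        ContinuousLinearMap.inl ℝ E F) (m (s₀, t)) := by
        rw [h4]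
        exact HasFDerivAt.comp (f := fun s => (s, y)) t h1.hasFDerivAt
          (hasFDerivAt_prodMk_left t y)
      exact HasFDerivAt.comp (f := fun s => m (s, t)) (g := fun s' => Φ (s', y)) s₀ a2 a1
    have e2 : HasFDerivAt (fun s => Φ (s, Φ (t, y))) (fderiv ℝ Φ (s₀, Φ (t, y)) ∘L
        ContinuousLinearMap.inl ℝ E F) s₀ :=
      HasFDerivAt.comp (f := fun s => (s, Φ (t, y))) s₀ h3.hasFDerivAt
        (hasFDerivAt_prodMk_left s₀ _)
    have e3 := (e2.congr_of_eventuallyEq hc).unique e1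
    simpa using (congrArg (fun L => L X) e3).symm
  have d1 : HasFDerivAt (fun t => fderiv ℝ Φ (t, y))
      (fderiv ℝ (fderiv ℝ Φ) (s₀, y) ∘L ContinuousLinearMap.inl ℝ E F) s₀ :=
    HasFDerivAt.comp (f := fun s => (s, y)) s₀ hΦ2.hasFDerivAt (hasFDerivAt_prodMk_left s₀ y)
  have d2 : HasFDerivAt (fun t => fderiv ℝ m (s₀, t))
      (fderiv ℝ (fderiv ℝ m) (s₀, s₀) ∘L ContinuousLinearMap.inr ℝ E E) s₀ :=
    HasFDerivAt.comp (f := fun s => (s₀, s)) s₀ hm2.hasFDerivAt (hasFDerivAt_prodMk_right s₀ s₀)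
  have d3 : HasFDerivAt (fun t => ((fderiv ℝ m (s₀, t) (X, 0), 0) : E × F))
      (((fderiv ℝ (fderiv ℝ m) (s₀, s₀) ∘L ContinuousLinearMap.inr ℝ E E).flip (X, 0)).prod 0)
      s₀ := by
    have := (d2.clm_apply (hasFDerivAt_const ((X, 0) : E × E) s₀)).prodMk
      (hasFDerivAt_const (0 : F) s₀)
    simpa using this
  have d4 := d1.clm_apply d3
  have d5 : HasFDerivAt (fun t => Φ (t, y)) (fderiv ℝ Φ (s₀, y) ∘L
        ContinuousLinearMap.inl ℝ E F) s₀ :=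
    HasFDerivAt.comp (f := fun s => (s, y)) s₀ hΦ1.self_of_nhds.hasFDerivAt
      (hasFDerivAt_prodMk_left s₀ y)
  have d6 : DifferentiableAt ℝ (fun y' => fderiv ℝ Φ (s₀, y') (X, 0)) (Φ (s₀, y)) := by
    rw [hΦ₀]
    have : DifferentiableAt ℝ (fun y' => fderiv ℝ Φ (s₀, y')) y :=
      hΦ2.comp y (by fun_prop)
    exact this.clm_apply (differentiableAt_const _)
  have d7 := d6.hasFDerivAt.comp s₀ d5
  have d8 := d7.unique (d4.congr_of_eventuallyEq (key.mono fun t ht => ht.symm))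
  have d9 := congrArg (fun L => L Y) d8
  simp [hΦ₀, hmX] at d9
  rw [d9, add_comm]

end Calculus

section Action
variable {E : Type*} [NormedAddCommGroup E] [NormedSpace ℝ E]
  {F : Type*} [NormedAddCommGroup F] [NormedSpace ℝ F]
  {G : Type*} [TopologicalSpace G] [Group G] [ChartedSpace E G] [LieGroup 𝓘(ℝ, E) ∞ G]
  {M : Type*} [TopologicalSpace M] [ChartedSpace F M] [IsManifold 𝓘(ℝ, F) ∞ M]
  [MulAction G M] [ContMDiffSMul 𝓘(ℝ, E) 𝓘(ℝ, F) ∞ G M]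

/-- The action `G × M → M` in the charts at `b`, `c` and `c'`. -/
def actChart (b : G) (c c' : M) (z : E × F) : F :=
  extChartAt 𝓘(ℝ, F) c' ((extChartAt 𝓘(ℝ, E) b).symm z.1 • (extChartAt 𝓘(ℝ, F) c).symm z.2)

theorem contDiffAt_actChart {b : G} {c c' : M} {s : E} {y : F}
    (hs : s ∈ (extChartAt 𝓘(ℝ, E) b).target) (hy : y ∈ (extChartAt 𝓘(ℝ, F) c).target)
    (h : (extChartAt 𝓘(ℝ, E) b).symm s • (extChartAt 𝓘(ℝ, F) c).symm y ∈
      (extChartAt 𝓘(ℝ, F) c').source) :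
    ContDiffAt ℝ ∞ (actChart b c c') (s, y) := by
  rw [← contMDiffAt_iff_contDiffAt]
  have h1 : ContMDiffAt 𝓘(ℝ, E) 𝓘(ℝ, E) ∞ (extChartAt 𝓘(ℝ, E) b).symm s :=
    (contMDiffOn_extChartAt_symm b).contMDiffAt ((isOpen_extChartAt_target b).mem_nhds hs)
  have h2 : ContMDiffAt 𝓘(ℝ, F) 𝓘(ℝ, F) ∞ (extChartAt 𝓘(ℝ, F) c).symm y :=
    (contMDiffOn_extChartAt_symm c).contMDiffAt ((isOpen_extChartAt_target c).mem_nhds hy)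
  have h3 : ContMDiffAt 𝓘(ℝ, F) 𝓘(ℝ, F) ∞ (extChartAt 𝓘(ℝ, F) c')
      ((extChartAt 𝓘(ℝ, E) b).symm s • (extChartAt 𝓘(ℝ, F) c).symm y) :=
    contMDiffAt_extChartAt' (by simpa using h)
  have h4 : ContMDiffAt 𝓘(ℝ, E × F) 𝓘(ℝ, E) ∞
      (fun z : E × F => (extChartAt 𝓘(ℝ, E) b).symm z.1) (s, y) :=
    ContMDiffAt.comp (s, y) (by exact h1) contDiff_fst.contMDiff.contMDiffAt
  have h5 : ContMDiffAt 𝓘(ℝ, E × F) 𝓘(ℝ, F) ∞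
      (fun z : E × F => (extChartAt 𝓘(ℝ, F) c).symm z.2) (s, y) :=
    ContMDiffAt.comp (s, y) (by exact h2) contDiff_snd.contMDiff.contMDiffAt
  have h6 : ContMDiffAt 𝓘(ℝ, E × F) 𝓘(ℝ, F) ∞
      (fun z : E × F => (extChartAt 𝓘(ℝ, E) b).symm z.1 • (extChartAt 𝓘(ℝ, F) c).symm z.2)
      (s, y) :=
    ContMDiffAt.comp (s, y) (ContMDiffSMul.contMDiff_smul (I := 𝓘(ℝ, E))
      (I' := 𝓘(ℝ, F)) (n := ∞) (G := G) (M := M)).contMDiffAt (h4.prodMk h5)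
  exact ContMDiffAt.comp (s, y) h3 h6

variable (E G) in
/-- The coordinates of the unit of `G` in the chart at the unit. -/
abbrev unitCoord : E := extChartAt 𝓘(ℝ, E) (1 : G) 1

variable (E G) in
theorem unitCoord_mem : unitCoord E G ∈ (extChartAt 𝓘(ℝ, E) (1 : G)).target :=
  mem_extChartAt_target 1

variable (E G) in
theorem symm_unitCoord : (extChartAt 𝓘(ℝ, E) (1 : G)).symm (unitCoord E G) = 1 :=
  extChartAt_to_inv 1

theorem actChart_unit (c : M) {y : F} (hy : y ∈ (extChartAt 𝓘(ℝ, F) c).target) :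
    actChart (1 : G) c c (unitCoord E G, y) = y := by
  simp only [actChart, symm_unitCoord, one_smul, (extChartAt 𝓘(ℝ, F) c).right_inv hy]

theorem contDiffAt_actChart_unit (c : M) {y : F} (hy : y ∈ (extChartAt 𝓘(ℝ, F) c).target) :
    ContDiffAt ℝ ∞ (actChart (1 : G) c c) (unitCoord E G, y) := by
  refine contDiffAt_actChart (unitCoord_mem E G) hy ?_
  simpa only [symm_unitCoord, one_smul] using (extChartAt 𝓘(ℝ, F) c).map_target hy

theorem actChart_mul (c : M) {y : F} (hy : y ∈ (extChartAt 𝓘(ℝ, F) c).target) :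
    ∀ᶠ z in 𝓝 (unitCoord E G, unitCoord E G),
      actChart (1 : G) c c (actChart (1 : G) (1 : G) (1 : G) z, y) =
        actChart (1 : G) c c (z.1, actChart (1 : G) c c (z.2, y)) := by
  have : ContinuousMul G := continuousMul_of_contMDiffMul 𝓘(ℝ, E) ∞
  have : ContinuousSMul G M := ContMDiffSMul.continuousSMul (I := 𝓘(ℝ, E)) (I' := 𝓘(ℝ, F)) ∞
  have hc : ContinuousAt (extChartAt 𝓘(ℝ, E) (1 : G)).symm (unitCoord E G) :=
    continuousAt_extChartAt_symm 1
  have h1 : ∀ᶠ z : E × E in 𝓝 (unitCoord E G, unitCoord E G),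
      (extChartAt 𝓘(ℝ, E) (1 : G)).symm z.1 * (extChartAt 𝓘(ℝ, E) (1 : G)).symm z.2 ∈
        (extChartAt 𝓘(ℝ, E) (1 : G)).source := by
    have : ContinuousAt (fun z : E × E => (extChartAt 𝓘(ℝ, E) (1 : G)).symm z.1 *
      (extChartAt 𝓘(ℝ, E) (1 : G)).symm z.2) (unitCoord E G, unitCoord E G) :=
      (ContinuousAt.comp (by exact hc) continuousAt_fst).mul
        (ContinuousAt.comp (by exact hc) continuousAt_snd)
    exact this.eventually_mem ((isOpen_extChartAt_source _).mem_nhds (by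
      simp only [symm_unitCoord, mul_one, mem_extChartAt_source]))
  have h2 : ∀ᶠ z : E × E in 𝓝 (unitCoord E G, unitCoord E G),
      (extChartAt 𝓘(ℝ, E) (1 : G)).symm z.2 • (extChartAt 𝓘(ℝ, F) c).symm y ∈
        (extChartAt 𝓘(ℝ, F) c).source := by
    have : ContinuousAt (fun z : E × E => (extChartAt 𝓘(ℝ, E) (1 : G)).symm z.2 •
      (extChartAt 𝓘(ℝ, F) c).symm y) (unitCoord E G, unitCoord E G) :=
      (ContinuousAt.comp (by exact hc) continuousAt_snd).smul continuousAt_const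
    refine this.eventually_mem ((isOpen_extChartAt_source _).mem_nhds ?_)
    simpa only [symm_unitCoord, one_smul] using (extChartAt 𝓘(ℝ, F) c).map_target hy
  filter_upwards [h1, h2] with z h1 h2
  simp only [actChart, smul_eq_mul]
  rw [(extChartAt 𝓘(ℝ, E) (1 : G)).left_inv h1, (extChartAt 𝓘(ℝ, F) c).left_inv h2, mul_smul]

/-- The value at `y` of the fundamental vector fields of the action, in the chart at `c`. -/
def fundamentalField (G : Type*) [TopologicalSpace G] [Group G] [ChartedSpace E G]
    [MulAction G M] (c : M) (X : E) (y : F) : F :=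
  fderiv ℝ (actChart (1 : G) c c) (unitCoord E G, y) (X, 0)

/-- The bracket of `𝔤` in the chart at the unit. -/
def chartBracket (G : Type*) [TopologicalSpace G] [Group G] [ChartedSpace E G] (X Y : E) : E :=
  fderiv ℝ (fderiv ℝ (actChart (1 : G) (1 : G) (1 : G))) (unitCoord E G, unitCoord E G)
    (X, 0) (0, Y) -
  fderiv ℝ (fderiv ℝ (actChart (1 : G) (1 : G) (1 : G))) (unitCoord E G, unitCoord E G)
    (Y, 0) (0, X)

theorem actChart_self_unit_left :
    ∀ᶠ s in 𝓝 (unitCoord E G), actChart (1 : G) (1 : G) (1 : G) (unitCoord E G, s) = s := by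
  filter_upwards [(isOpen_extChartAt_target (1 : G)).mem_nhds (unitCoord_mem E G)] with s hs
  exact actChart_unit 1 hs

theorem actChart_self_unit_right :
    ∀ᶠ s in 𝓝 (unitCoord E G), actChart (1 : G) (1 : G) (1 : G) (s, unitCoord E G) = s := by
  filter_upwards [(isOpen_extChartAt_target (1 : G)).mem_nhds (unitCoord_mem E G)] with s hs
  simp only [actChart, symm_unitCoord, smul_eq_mul, mul_one,
    (extChartAt 𝓘(ℝ, E) (1 : G)).right_inv hs]

/-- Fundamental vector fields form an anti-homomorphic image of the Lie algebra. -/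
theorem fundamentalField_bracket (c : M) {y : F} (hy : y ∈ (extChartAt 𝓘(ℝ, F) c).target)
    (X Y : E) :
    fundamentalField G c (chartBracket G X Y) y =
      fderiv ℝ (fundamentalField G c X) y (fundamentalField G c Y y) -
      fderiv ℝ (fundamentalField G c Y) y (fundamentalField G c X y) := by
  have hm : ContDiffAt ℝ 2 (actChart (1 : G) (1 : G) (1 : G)) (unitCoord E G, unitCoord E G) :=
    (contDiffAt_actChart_unit (1 : G) (unitCoord_mem E G)).of_le ENat.LEInfty.out
  have hΦ : ContDiffAt ℝ 2 (actChart (1 : G) c c) (unitCoord E G, y) :=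
    (contDiffAt_actChart_unit c hy).of_le ENat.LEInfty.out
  have key := fun X Y => fderiv_fundamental_field hm actChart_self_unit_left
    actChart_self_unit_right hΦ (actChart_unit c hy) (actChart_mul c hy) X Y
  have e1 := key X Y
  have e2 := key Y X
  -- Antisymmetrization in `X, Y` removes the second derivative of the action, which is symmetric,
  -- and turns that of the multiplication into the bracket.
  have sΦ := (hΦ.isSymmSndFDerivAt (by simp)).eq
  have sm := (hm.isSymmSndFDerivAt (by simp)).eq
  change fderiv ℝ (fundamentalField G c X) y (fundamentalField G c Y y) = _ at e1
  change fderiv ℝ (fundamentalField G c Y) y (fundamentalField G c X y) = _ at e2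
  rw [e1, e2, sΦ (Y, 0) (X, 0), sm (0, Y), sm (0, X)]
  simp only [fundamentalField, chartBracket, add_sub_add_left_eq_sub]
  rw [← map_sub]
  simp

end Action

/-! ### Manifold derivatives and the bracket of `𝔤` in charts -/

section Charts
variable {E : Type*} [NormedAddCommGroup E] [NormedSpace ℝ E]
  {F : Type*} [NormedAddCommGroup F] [NormedSpace ℝ F]
  {M : Type*} [TopologicalSpace M] [ChartedSpace E M]
  {N : Type*} [TopologicalSpace N] [ChartedSpace F N]

theorem mfderiv_eq_fderiv {f : M → N} {x : M} (hf : MDifferentiableAt 𝓘(ℝ, E) 𝓘(ℝ, F) f x) :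
    (mfderiv 𝓘(ℝ, E) 𝓘(ℝ, F) f x : E →L[ℝ] F) =
      fderiv ℝ (extChartAt 𝓘(ℝ, F) (f x) ∘ f ∘ (extChartAt 𝓘(ℝ, E) x).symm)
        (extChartAt 𝓘(ℝ, E) x x) := by
  refine Eq.trans (if_pos hf) ?_
  simp only [writtenInExtChartAt, modelWithCornersSelf_coe, range_id, fderivWithin_univ]
  rfl

/-- The derivative of a map in arbitrary extended charts of the target through the value. -/
theorem mfderiv_eq_fderiv_of_eq {f : M → N} {x : M} {p : N} (hp : f x = p)
    (hf : MDifferentiableAt 𝓘(ℝ, E) 𝓘(ℝ, F) f x) :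
    (mfderiv 𝓘(ℝ, E) 𝓘(ℝ, F) f x : E →L[ℝ] F) =
      fderiv ℝ (extChartAt 𝓘(ℝ, F) p ∘ f ∘ (extChartAt 𝓘(ℝ, E) x).symm)
        (extChartAt 𝓘(ℝ, E) x x) := by
  subst hp
  exact mfderiv_eq_fderiv hf

theorem mfderiv_extChartAt_eq_id [IsManifold 𝓘(ℝ, E) 1 M] (x : M) :
    (mfderiv 𝓘(ℝ, E) 𝓘(ℝ, E) (extChartAt 𝓘(ℝ, E) x) x : E →L[ℝ] E) =
      ContinuousLinearMap.id ℝ E := by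
  rw [mfderiv_eq_fderiv (mdifferentiableAt_extChartAt (mem_chart_source E x))]
  have h : (extChartAt 𝓘(ℝ, E) (extChartAt 𝓘(ℝ, E) x x) ∘ extChartAt 𝓘(ℝ, E) x ∘
      (extChartAt 𝓘(ℝ, E) x).symm) =ᶠ[𝓝 (extChartAt 𝓘(ℝ, E) x x)] id := by
    filter_upwards [(isOpen_extChartAt_target x).mem_nhds (mem_extChartAt_target x)] with y hy
    simp only [Function.comp, (extChartAt 𝓘(ℝ, E) x).right_inv hy,
      extChartAt_model_space_eq_id, PartialEquiv.refl_coe, id]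
  rw [h.fderiv_eq, fderiv_id]

end Charts

section Group
variable {E : Type*} [NormedAddCommGroup E] [NormedSpace ℝ E] [CompleteSpace E]
  {G : Type*} [TopologicalSpace G] [Group G] [ChartedSpace E G] [LieGroup 𝓘(ℝ, E) ∞ G]

theorem contDiffAt_mulChart :
    ContDiffAt ℝ ∞ (actChart (1 : G) (1 : G) (1 : G)) (unitCoord E G, unitCoord E G) :=
  contDiffAt_actChart_unit (1 : G) (unitCoord_mem E G)

theorem eventually_contDiffAt_mulChart :
    ∀ᶠ z in 𝓝 (unitCoord E G, unitCoord E G),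
      DifferentiableAt ℝ (actChart (1 : G) (1 : G) (1 : G)) z := by
  have h : ContDiffAt ℝ 1 (actChart (1 : G) (1 : G) (1 : G)) (unitCoord E G, unitCoord E G) :=
    contDiffAt_mulChart.of_le ENat.LEInfty.out
  exact (h.eventually (by simp)).mono fun z hz => hz.differentiableAt (by simp)

/-- The pullback applies the derivative of the chart to the derivative of `x ↦ g x` at the unit. By
the chain rule this is the partial derivative of the multiplication in its second argument, which
makes the bracket of `𝔤` a second derivative of the multiplication. -/
theorem mpullback_mulInvariantVectorField_chart (X : GroupLieAlgebra 𝓘(ℝ, E) G) :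
    ∀ᶠ s in 𝓝 (unitCoord E G),
      (mpullbackWithin 𝓘(ℝ, E) 𝓘(ℝ, E) (extChartAt 𝓘(ℝ, E) (1 : G)).symm
        (mulInvariantVectorField X) (range 𝓘(ℝ, E)) s : E) =
      fderiv ℝ (actChart (1 : G) (1 : G) (1 : G)) (s, unitCoord E G) ((0, X) : E × E) := by
  have hd : ∀ᶠ s in 𝓝 (unitCoord E G),
      DifferentiableAt ℝ (actChart (1 : G) (1 : G) (1 : G)) (s, unitCoord E G) :=
    (show ContinuousAt (fun s : E => (s, unitCoord E G)) (unitCoord E G) by fun_prop).eventually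
      eventually_contDiffAt_mulChart
  filter_upwards [(isOpen_extChartAt_target (1 : G)).mem_nhds (unitCoord_mem E G), hd] with s hs hd
  have hg := (extChartAt 𝓘(ℝ, E) (1 : G)).map_target hs
  set g := (extChartAt 𝓘(ℝ, E) (1 : G)).symm s with hgdef
  have hsg : extChartAt 𝓘(ℝ, E) (1 : G) g = s := (extChartAt 𝓘(ℝ, E) (1 : G)).right_inv hs
  have hg' : g ∈ (chartAt E (1 : G)).source := by simpa using hg
  have A := mfderiv_extChartAt_comp_mfderivWithin_extChartAt_symm (I := 𝓘(ℝ, E)) hs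
  have B := mfderivWithin_extChartAt_symm_comp_mfderiv_extChartAt (I := 𝓘(ℝ, E)) hs
  rw [mpullbackWithin_apply]
  have e1 : (mfderivWithin 𝓘(ℝ, E) 𝓘(ℝ, E) (extChartAt 𝓘(ℝ, E) (1 : G)).symm
      (range 𝓘(ℝ, E)) s).inverse = mfderiv 𝓘(ℝ, E) 𝓘(ℝ, E) (extChartAt 𝓘(ℝ, E) (1 : G)) g :=
    ContinuousLinearMap.inverse_eq B A
  rw [e1]
  have h1 : MDifferentiableAt 𝓘(ℝ, E) 𝓘(ℝ, E) (extChartAt 𝓘(ℝ, E) (1 : G)) (g * 1) := by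
    rw [mul_one]; exact mdifferentiableAt_extChartAt hg'
  have h2 : MDifferentiableAt 𝓘(ℝ, E) 𝓘(ℝ, E) (fun x : G => g * x) 1 :=
    (contMDiff_mul_left (I := 𝓘(ℝ, E)) (n := ∞)).contMDiffAt.mdifferentiableAt (by simp)
  have e2 := mfderiv_comp (1 : G) h1 h2
  have e3 := mfderiv_eq_fderiv (h1.comp (1 : G) h2)
  have e4 : fderiv ℝ (fun t => actChart (1 : G) (1 : G) (1 : G) (s, t)) (unitCoord E G) =
      fderiv ℝ (actChart (1 : G) (1 : G) (1 : G)) (s, unitCoord E G) ∘L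
        ContinuousLinearMap.inr ℝ E E :=
    (HasFDerivAt.comp (f := fun t => (s, t)) (unitCoord E G) hd.hasFDerivAt
      (hasFDerivAt_prodMk_right s (unitCoord E G))).fderiv
  have e5 := congrArg (fun L : E →L[ℝ] E => L X) (e3.symm.trans e2)
  have e6 : (extChartAt 𝓘(ℝ, E) (((extChartAt 𝓘(ℝ, E) (1 : G)) ∘ fun x => g * x) 1) ∘
      ((extChartAt 𝓘(ℝ, E) (1 : G)) ∘ fun x => g * x) ∘ (extChartAt 𝓘(ℝ, E) (1 : G)).symm) =
      fun t => actChart (1 : G) (1 : G) (1 : G) (s, t) := by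
    ext t
    simp only [actChart, hgdef, Function.comp, extChartAt_model_space_eq_id,
      PartialEquiv.refl_coe, id, smul_eq_mul]
  rw [e6, e4] at e5
  have e7 : (mfderiv 𝓘(ℝ, E) 𝓘(ℝ, E) (extChartAt 𝓘(ℝ, E) (1 : G)) (g * 1) : E →L[ℝ] E) =
      mfderiv 𝓘(ℝ, E) 𝓘(ℝ, E) (extChartAt 𝓘(ℝ, E) (1 : G)) g := by
    rw [mul_one]
  refine Eq.trans ?_ (e5.symm.trans ?_)
  · change (mfderiv 𝓘(ℝ, E) 𝓘(ℝ, E) (extChartAt 𝓘(ℝ, E) (1 : G)) g : E →L[ℝ] E) _ = _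
    rw [← e7]
    rfl
  · rfl

/-- The Lie bracket of `𝔤` in the preferred chart at the unit. -/
theorem bracket_eq_chartBracket (X Y : GroupLieAlgebra 𝓘(ℝ, E) G) :
    ⁅X, Y⁆ = chartBracket (E := E) G X Y := by
  have h0 : (mfderiv 𝓘(ℝ, E) 𝓘(ℝ, E) (extChartAt 𝓘(ℝ, E) (1 : G)) 1 : E →L[ℝ] E) =
      ContinuousLinearMap.id ℝ E := mfderiv_extChartAt_eq_id 1
  have hr : range 𝓘(ℝ, E) = univ := by simp
  have hbr : ⁅X, Y⁆ = lieBracket ℝ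
      (fun s => (mpullbackWithin 𝓘(ℝ, E) 𝓘(ℝ, E) (extChartAt 𝓘(ℝ, E) (1 : G)).symm
        (mulInvariantVectorField X) (range 𝓘(ℝ, E)) s : E))
      (fun s => (mpullbackWithin 𝓘(ℝ, E) 𝓘(ℝ, E) (extChartAt 𝓘(ℝ, E) (1 : G)).symm
        (mulInvariantVectorField Y) (range 𝓘(ℝ, E)) s : E)) (unitCoord E G) := by
    rw [GroupLieAlgebra.bracket_def]
    refine (congrArg (fun L : E →L[ℝ] E => L.inverse _) h0).trans ?_
    simp only [ContinuousLinearMap.inverse_id, ContinuousLinearMap.id_apply]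
    have hu : ∀ V W : E → E, lieBracketWithin ℝ V W
        ((extChartAt 𝓘(ℝ, E) (1 : G)).symm ⁻¹' univ ∩ range 𝓘(ℝ, E)) (unitCoord E G) =
        lieBracket ℝ V W (unitCoord E G) := by
      intro V W
      rw [hr, preimage_univ, univ_inter, lieBracketWithin_univ]
    exact hu _ _
  refine hbr.trans ?_
  have hX := mpullback_mulInvariantVectorField_chart X
  have hY := mpullback_mulInvariantVectorField_chart Y
  have hd : DifferentiableAt ℝ (fderiv ℝ (actChart (1 : G) (1 : G) (1 : G)))
      (unitCoord E G, unitCoord E G) :=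
    (((contDiffAt_mulChart (E := E) (G := G)).of_le (ENat.LEInfty.out : 2 ≤ ∞)).fderiv_right
      (m := 1) (by norm_num)).differentiableAt (by simp)
  have h1 : ∀ X : E, HasFDerivAt (fun s => fderiv ℝ (actChart (1 : G) (1 : G) (1 : G))
      (s, unitCoord E G) (0, X)) ((fderiv ℝ (fderiv ℝ (actChart (1 : G) (1 : G) (1 : G)))
      (unitCoord E G, unitCoord E G) ∘L ContinuousLinearMap.inl ℝ E E).flip (0, X))
      (unitCoord E G) := by
    intro X
    have d1 : HasFDerivAt (fun s => fderiv ℝ (actChart (1 : G) (1 : G) (1 : G))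
      (s, unitCoord E G)) (fderiv ℝ (fderiv ℝ (actChart (1 : G) (1 : G) (1 : G)))
      (unitCoord E G, unitCoord E G) ∘L ContinuousLinearMap.inl ℝ E E) (unitCoord E G) :=
      HasFDerivAt.comp (f := fun s => (s, unitCoord E G)) (unitCoord E G) hd.hasFDerivAt
        (hasFDerivAt_prodMk_left _ _)
    have := d1.clm_apply (hasFDerivAt_const ((0, X) : E × E) (unitCoord E G))
    simpa using this
  have h2 : ∀ X : E, fderiv ℝ (actChart (1 : G) (1 : G) (1 : G))
      (unitCoord E G, unitCoord E G) (0, X) = X := by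
    intro X
    have e1 := (HasFDerivAt.comp (f := fun s => (unitCoord E G, s)) (unitCoord E G)
      (eventually_contDiffAt_mulChart (E := E) (G := G)).self_of_nhds.hasFDerivAt
      (hasFDerivAt_prodMk_right _ _))
    have e2 := (hasFDerivAt_id (𝕜 := ℝ) (unitCoord E G)).congr_of_eventuallyEq
      (actChart_self_unit_left (E := E) (G := G))
    simpa using congrArg (fun L => L X) (e1.unique e2)
  have c1 := hX.self_of_nhds.trans (h2 X)
  have c2 := hY.self_of_nhds.trans (h2 Y)
  have f1 := ((h1 X).congr_of_eventuallyEq hX).fderiv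
  have f2 := ((h1 Y).congr_of_eventuallyEq hY).fderiv
  refine (congrArg₂ (fun a b : E => a - b) (congrArg₂ (fun (L : E →L[ℝ] E) v => L v) f2 c1)
    (congrArg₂ (fun (L : E →L[ℝ] E) v => L v) f1 c2)).trans ?_
  rfl

end Group

/-! ### The adjoint representation and its differential -/

section Adjoint
variable {E : Type*} [NormedAddCommGroup E] [NormedSpace ℝ E]
  {G : Type*} [TopologicalSpace G] [Group G] [ChartedSpace E G] [LieGroup 𝓘(ℝ, E) ∞ G]

/-- Conjugation by `a` in the preferred chart at the unit. -/
def conjChart (E : Type*) [NormedAddCommGroup E] [NormedSpace ℝ E]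
    {G : Type*} [TopologicalSpace G] [Group G] [ChartedSpace E G] (a : G) (s : E) : E :=
  extChartAt 𝓘(ℝ, E) (1 : G) (a * (extChartAt 𝓘(ℝ, E) (1 : G)).symm s * a⁻¹)

theorem conjChart_unit (a : G) : conjChart E a (unitCoord E G) = unitCoord E G := by
  simp only [conjChart, symm_unitCoord, mul_one, mul_inv_cancel]

theorem contMDiff_conj (a : G) : ContMDiff 𝓘(ℝ, E) 𝓘(ℝ, E) ∞ (fun x : G => a * x * a⁻¹) :=
  (contMDiff_const.mul contMDiff_id).mul contMDiff_const

theorem contDiffAt_conjChart (a : G) : ContDiffAt ℝ ∞ (conjChart E a) (unitCoord E G) := by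
  rw [← contMDiffAt_iff_contDiffAt]
  have h1 : ContMDiffAt 𝓘(ℝ, E) 𝓘(ℝ, E) ∞ (extChartAt 𝓘(ℝ, E) (1 : G)).symm (unitCoord E G) :=
    (contMDiffOn_extChartAt_symm 1).contMDiffAt
      ((isOpen_extChartAt_target (1 : G)).mem_nhds (unitCoord_mem E G))
  have h2 : ContMDiffAt 𝓘(ℝ, E) 𝓘(ℝ, E) ∞ (extChartAt 𝓘(ℝ, E) (1 : G))
      (a * (extChartAt 𝓘(ℝ, E) (1 : G)).symm (unitCoord E G) * a⁻¹) := by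
    refine contMDiffAt_extChartAt' ?_
    simp only [symm_unitCoord, mul_one, mul_inv_cancel]
    exact mem_chart_source E 1
  exact ContMDiffAt.comp (unitCoord E G) h2
    ((contMDiff_conj a).contMDiffAt.comp (unitCoord E G) h1)

/-- The adjoint action `Ad a`, as an endomorphism of the model space `E` of `𝔤`. -/
def adj (E : Type*) [NormedAddCommGroup E] [NormedSpace ℝ E]
    {G : Type*} [TopologicalSpace G] [Group G] [ChartedSpace E G] (a : G) : E →L[ℝ] E := Ad E a

theorem adj_eq_fderiv (a : G) :
    adj E a = fderiv ℝ (conjChart E a) (unitCoord E G) :=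
  mfderiv_eq_fderiv_of_eq (f := fun x : G => a * x * a⁻¹) (by simp)
    ((contMDiff_conj a).contMDiffAt.mdifferentiableAt (by simp))

theorem hasFDerivAt_conjChart (a : G) :
    HasFDerivAt (conjChart E a) (adj E a) (unitCoord E G) := by
  rw [adj_eq_fderiv]
  exact ((contDiffAt_conjChart a).differentiableAt (by simp)).hasFDerivAt

theorem conjChart_symm (a : G) : ∀ᶠ s in 𝓝 (unitCoord E G),
    (extChartAt 𝓘(ℝ, E) (1 : G)).symm (conjChart E a s) =
      a * (extChartAt 𝓘(ℝ, E) (1 : G)).symm s * a⁻¹ := by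
  have : ContinuousMul G := continuousMul_of_contMDiffMul 𝓘(ℝ, E) ∞
  have hc : ContinuousAt (fun s => a * (extChartAt 𝓘(ℝ, E) (1 : G)).symm s * a⁻¹)
      (unitCoord E G) :=
    (continuousAt_const.mul (continuousAt_extChartAt_symm 1)).mul continuousAt_const
  have h1 : ∀ᶠ s in 𝓝 (unitCoord E G), a * (extChartAt 𝓘(ℝ, E) (1 : G)).symm s * a⁻¹ ∈
      (extChartAt 𝓘(ℝ, E) (1 : G)).source := by
    refine hc.eventually_mem ((isOpen_extChartAt_source _).mem_nhds ?_)
    simp only [symm_unitCoord, mul_one, mul_inv_cancel, mem_extChartAt_source]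
  filter_upwards [h1] with s hs
  exact (extChartAt 𝓘(ℝ, E) (1 : G)).left_inv hs

theorem adj_mul (a b : G) :
    adj E (a * b) = adj E a ∘L adj E b := by
  have h1 : HasFDerivAt (conjChart E a) (adj E a)
      (conjChart E b (unitCoord E G)) := by
    rw [conjChart_unit]; exact hasFDerivAt_conjChart a
  have h2 := h1.comp _ (hasFDerivAt_conjChart (E := E) b)
  refine (hasFDerivAt_conjChart (E := E) (a * b)).unique (h2.congr_of_eventuallyEq ?_)
  filter_upwards [conjChart_symm (E := E) b] with s hs
  simp only [Function.comp, conjChart] at hs ⊢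
  rw [hs]
  simp only [mul_inv_rev, mul_assoc]

theorem adj_one : adj E (1 : G) = ContinuousLinearMap.id ℝ E := by
  refine (hasFDerivAt_conjChart (E := E) (1 : G)).unique
    ((hasFDerivAt_id _).congr_of_eventuallyEq ?_)
  filter_upwards [(isOpen_extChartAt_target (1 : G)).mem_nhds (unitCoord_mem E G)] with s hs
  simp only [conjChart, one_mul, inv_one, mul_one, id, (extChartAt 𝓘(ℝ, E) (1 : G)).right_inv hs]

theorem adj_inv_apply_adj (a : G) (X : E) :
    adj E a⁻¹ (adj E a X) = X := by
  have := congrArg (fun L : E →L[ℝ] E => L X) (adj_mul (E := E) a⁻¹ a)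
  rw [inv_mul_cancel, adj_one] at this
  exact this.symm

theorem adj_apply_adj_inv (a : G) (X : E) :
    adj E a (adj E a⁻¹ X) = X := by
  simpa using adj_inv_apply_adj a⁻¹ X

/-- The left-invariant fields in terms of the right-invariant ones. -/
theorem fderiv_mulChart_adj [CompleteSpace E] :
    ∀ᶠ s in 𝓝 (unitCoord E G), ∀ Y : E,
      fderiv ℝ (actChart (1 : G) (1 : G) (1 : G)) (unitCoord E G, s)
        (adj E ((extChartAt 𝓘(ℝ, E) (1 : G)).symm s) Y, 0) =
      fderiv ℝ (actChart (1 : G) (1 : G) (1 : G)) (s, unitCoord E G) (0, Y) := by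
  have hd1 : ∀ᶠ s in 𝓝 (unitCoord E G),
      DifferentiableAt ℝ (actChart (1 : G) (1 : G) (1 : G)) (s, unitCoord E G) :=
    (show ContinuousAt (fun s : E => (s, unitCoord E G)) (unitCoord E G) by fun_prop).eventually
      eventually_contDiffAt_mulChart
  have hd2 : ∀ᶠ s in 𝓝 (unitCoord E G),
      DifferentiableAt ℝ (actChart (1 : G) (1 : G) (1 : G)) (unitCoord E G, s) :=
    (show ContinuousAt (fun s : E => (unitCoord E G, s)) (unitCoord E G) by fun_prop).eventually
      eventually_contDiffAt_mulChart
  filter_upwards [(isOpen_extChartAt_target (1 : G)).mem_nhds (unitCoord_mem E G), hd1, hd2] with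
    s hs hd1 hd2 Y
  set a := (extChartAt 𝓘(ℝ, E) (1 : G)).symm s with ha
  have e1 : HasFDerivAt (fun t => actChart (1 : G) (1 : G) (1 : G) (s, t)) _ (unitCoord E G) :=
    HasFDerivAt.comp (f := fun t => (s, t)) (unitCoord E G) hd1.hasFDerivAt
      (hasFDerivAt_prodMk_right s (unitCoord E G))
  have h2 : HasFDerivAt (fun u => actChart (1 : G) (1 : G) (1 : G) (u, s))
      (fderiv ℝ (actChart (1 : G) (1 : G) (1 : G)) (unitCoord E G, s) ∘L
        ContinuousLinearMap.inl ℝ E E) (conjChart E a (unitCoord E G)) := by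
    rw [conjChart_unit]
    exact HasFDerivAt.comp (f := fun t => (t, s)) (unitCoord E G) hd2.hasFDerivAt
      (hasFDerivAt_prodMk_left (unitCoord E G) s)
  have e2 := HasFDerivAt.comp (g := fun u => actChart (1 : G) (1 : G) (1 : G) (u, s))
    (unitCoord E G) h2 (hasFDerivAt_conjChart (E := E) a)
  -- Both are derivatives in `t` of the same map, since `a t = (a t a⁻¹) a`.
  have e3 := e2.unique (e1.congr_of_eventuallyEq (by
    filter_upwards [conjChart_symm (E := E) a] with t ht
    simp only [Function.comp, actChart, smul_eq_mul, ht, ← ha]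
    congr 1
    group))
  simpa using congrArg (fun L => L Y) e3

/-- The differential of the adjoint representation is the bracket. -/
theorem hasFDerivAt_adj [CompleteSpace E] (Y : E) :
    ∃ L : E →L[ℝ] E, (∀ X : E, L X = chartBracket G X Y) ∧
      HasFDerivAt (fun s => adj E ((extChartAt 𝓘(ℝ, E) (1 : G)).symm s) Y) L
        (unitCoord E G) := by
  have hm2 : ContDiffAt ℝ 2 (actChart (1 : G) (1 : G) (1 : G)) (unitCoord E G, unitCoord E G) :=
    contDiffAt_mulChart.of_le ENat.LEInfty.out
  have hd : DifferentiableAt ℝ (fderiv ℝ (actChart (1 : G) (1 : G) (1 : G)))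
      (unitCoord E G, unitCoord E G) :=
    (hm2.fderiv_right (m := 1) (by norm_num)).differentiableAt (by simp)
  have dl : HasFDerivAt (fun s => fderiv ℝ (actChart (1 : G) (1 : G) (1 : G))
      (s, unitCoord E G)) (fderiv ℝ (fderiv ℝ (actChart (1 : G) (1 : G) (1 : G)))
      (unitCoord E G, unitCoord E G) ∘L ContinuousLinearMap.inl ℝ E E) (unitCoord E G) :=
    HasFDerivAt.comp (f := fun s => (s, unitCoord E G)) (unitCoord E G) hd.hasFDerivAt
      (hasFDerivAt_prodMk_left _ _)
  have dr : HasFDerivAt (fun s => fderiv ℝ (actChart (1 : G) (1 : G) (1 : G))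
      (unitCoord E G, s)) (fderiv ℝ (fderiv ℝ (actChart (1 : G) (1 : G) (1 : G)))
      (unitCoord E G, unitCoord E G) ∘L ContinuousLinearMap.inr ℝ E E) (unitCoord E G) :=
    HasFDerivAt.comp (f := fun s => (unitCoord E G, s)) (unitCoord E G) hd.hasFDerivAt
      (hasFDerivAt_prodMk_right _ _)
  -- `R s` evaluates right-invariant fields at `s`. It is the identity at the unit, hence invertible
  -- nearby, so `fderiv_mulChart_adj` can be solved for `Ad(s) Y`; this is what shows
  -- differentiability.
  let R : E → E →L[ℝ] E := fun s => fderiv ℝ (actChart (1 : G) (1 : G) (1 : G))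
    (unitCoord E G, s) ∘L ContinuousLinearMap.inl ℝ E E
  have dR : DifferentiableAt ℝ R (unitCoord E G) :=
    dr.differentiableAt.clm_comp (differentiableAt_const _)
  have R0 : R (unitCoord E G) = ContinuousLinearMap.id ℝ E := by
    have e1 : HasFDerivAt (fun s => actChart (1 : G) (1 : G) (1 : G) (s, unitCoord E G))
        (R (unitCoord E G)) (unitCoord E G) :=
      (HasFDerivAt.comp (f := fun s => (s, unitCoord E G)) (unitCoord E G)
      (eventually_contDiffAt_mulChart (E := E) (G := G)).self_of_nhds.hasFDerivAt
      (hasFDerivAt_prodMk_left _ _))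
    have e2 := (hasFDerivAt_id (𝕜 := ℝ) (unitCoord E G)).congr_of_eventuallyEq
      (actChart_self_unit_right (E := E) (G := G))
    exact e1.unique e2
  have hinv : ∀ᶠ s in 𝓝 (unitCoord E G), (R s).IsInvertible := by
    have h1 : ∀ᶠ A in 𝓝 (R (unitCoord E G)), A ∈ range
        ((↑) : (E ≃L[ℝ] E) → E →L[ℝ] E) :=
      ContinuousLinearEquiv.isOpen.mem_nhds ⟨ContinuousLinearEquiv.refl ℝ E, by rw [R0]; rfl⟩
    exact dR.continuousAt.eventually h1
  have hRA : ∀ᶠ s in 𝓝 (unitCoord E G),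
      adj E ((extChartAt 𝓘(ℝ, E) (1 : G)).symm s) Y =
        (R s).inverse (fderiv ℝ (actChart (1 : G) (1 : G) (1 : G)) (s, unitCoord E G) (0, Y)) := by
    filter_upwards [hinv, fderiv_mulChart_adj (E := E) (G := G)] with s hs h2
    rw [← h2 Y]
    exact (hs.inverse_apply_eq.2 rfl).symm
  have dinv : DifferentiableAt ℝ (fun s => (R s).inverse) (unitCoord E G) := by
    have : DifferentiableAt ℝ ContinuousLinearMap.inverse (R (unitCoord E G)) := by
      have := contDiffAt_map_inverse (𝕜 := ℝ) (n := 1) (ContinuousLinearEquiv.refl ℝ E)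
      rw [R0]
      exact this.differentiableAt (by simp)
    exact DifferentiableAt.comp (g := ContinuousLinearMap.inverse) (unitCoord E G) this dR
  have dA : DifferentiableAt ℝ
      (fun s => adj E ((extChartAt 𝓘(ℝ, E) (1 : G)).symm s) Y) (unitCoord E G) :=
    (dinv.clm_apply (dl.differentiableAt.clm_apply
      (differentiableAt_const _))).congr_of_eventuallyEq hRA
  refine ⟨_, fun X => ?_, dA.hasFDerivAt⟩
  -- Differentiating `fderiv_mulChart_adj` at the unit expresses the derivative of `Ad(s) Y` as a
  -- difference of two mixed second derivatives of the multiplication, which is the bracket.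
  have e1 := (dl.clm_apply (hasFDerivAt_const ((0, Y) : E × E) (unitCoord E G)))
  have e2 := dr.clm_apply (dA.hasFDerivAt.prodMk (hasFDerivAt_const (0 : E) (unitCoord E G)))
  have e3 := congrArg (fun L => L X) ((e2.congr_of_eventuallyEq
    ((fderiv_mulChart_adj (E := E) (G := G)).mono fun s hs => (hs Y).symm)).unique e1)
  have R0' : ∀ Z : E, fderiv ℝ (actChart (1 : G) (1 : G) (1 : G))
      (unitCoord E G, unitCoord E G) (Z, 0) = Z := fun Z => congrArg (fun L => L Z) R0
  have A1 : adj E ((extChartAt 𝓘(ℝ, E) (1 : G)).symm (unitCoord E G)) Y = Y := by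
    rw [symm_unitCoord, adj_one]; rfl
  simp only [add_apply, ContinuousLinearMap.comp_apply,
    ContinuousLinearMap.prod_apply, zero_apply, R0',
    ContinuousLinearMap.flip_apply, ContinuousLinearMap.inl_apply, map_zero, zero_add,
    ContinuousLinearMap.inr_apply] at e3
  have sm := (hm2.isSymmSndFDerivAt (by simp)).eq
  rw [A1] at e3
  rw [chartBracket, sm (Y, 0), ← e3]
  simp

end Adjoint

section Adjoint
variable {E : Type*} [NormedAddCommGroup E] [NormedSpace ℝ E] [CompleteSpace E]
  {G : Type*} [TopologicalSpace G] [Group G] [ChartedSpace E G] [LieGroup 𝓘(ℝ, E) ∞ G]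

/-- The adjoint action preserves the bracket. -/
theorem adj_chartBracket (a : G) (X Y : E) :
    adj E a (chartBracket G X Y) = chartBracket G (adj E a X) (adj E a Y) := by
  obtain ⟨L, hL, hd⟩ := hasFDerivAt_adj (G := G) Y
  obtain ⟨L', hL', hd'⟩ := hasFDerivAt_adj (G := G) (adj E a Y)
  rw [← conjChart_unit (E := E) a] at hd'
  have e1 := (adj E a).hasFDerivAt.comp (unitCoord E G) hd
  have e2 := hd'.comp (unitCoord E G) (hasFDerivAt_conjChart (E := E) a)
  -- The identity `Ad(a) Ad(s) Y = Ad(a s a⁻¹) Ad(a) Y`, differentiated in `s` at the unit.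
  have e3 := e1.unique (e2.congr_of_eventuallyEq (by
    filter_upwards [conjChart_symm (E := E) a] with s hs
    simp only [Function.comp, hs]
    rw [mul_assoc, adj_mul, adj_mul]
    simp only [ContinuousLinearMap.comp_apply, adj_inv_apply_adj]))
  have e4 := congrArg (fun L => L X) e3
  simp only [ContinuousLinearMap.comp_apply] at e4
  rw [← hL, ← hL', ← e4]

theorem continuousAt_adj_one (X : E) : ContinuousAt (fun a : G => adj E a X) 1 := by
  obtain ⟨L, hL, hd⟩ := hasFDerivAt_adj (G := G) X
  have h1 : ContinuousAt (extChartAt 𝓘(ℝ, E) (1 : G)) (1 : G) := continuousAt_extChartAt (1 : G)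
  have h2 : ContinuousAt ((fun s => adj E ((extChartAt 𝓘(ℝ, E) (1 : G)).symm s) X) ∘
      extChartAt 𝓘(ℝ, E) (1 : G)) (1 : G) := ContinuousAt.comp hd.continuousAt h1
  refine h2.congr ?_
  filter_upwards [(isOpen_extChartAt_source (I := 𝓘(ℝ, E)) (1 : G)).mem_nhds
    (mem_extChartAt_source 1)] with a ha
  simp only [Function.comp, (extChartAt 𝓘(ℝ, E) (1 : G)).left_inv ha]

theorem continuous_adj (X : E) : Continuous (fun a : G => adj E a X) := by
  have : ContinuousMul G := continuousMul_of_contMDiffMul 𝓘(ℝ, E) ∞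
  rw [continuous_iff_continuousAt]
  intro a
  have h1 : ContinuousAt (fun b : G => a⁻¹ * b) a := by fun_prop
  have h2 : ContinuousAt (fun b : G => adj E b X) (a⁻¹ * a) := by
    rw [inv_mul_cancel]; exact continuousAt_adj_one X
  have h3 := (adj E a).continuous.continuousAt.comp (h2.comp h1)
  refine h3.congr (Eventually.of_forall fun b => ?_)
  simp only [Function.comp, adj_mul, ContinuousLinearMap.comp_apply, adj_apply_adj_inv]

/-- Invariance of a bilinear form under the adjoint action, infinitesimally. -/
theorem invariant_form_chartBracket (Q : E →L[ℝ] E →L[ℝ] ℝ)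
    (hQ : ∀ (a : G) X Y, Q (adj E a X) (adj E a Y) = Q X Y) (X Y Z : E) :
    Q (chartBracket G X Y) Z + Q Y (chartBracket G X Z) = 0 := by
  obtain ⟨L, hL, hd⟩ := hasFDerivAt_adj (G := G) Y
  obtain ⟨L', hL', hd'⟩ := hasFDerivAt_adj (G := G) Z
  have h0 : HasFDerivAt (fun s => Q (adj E ((extChartAt 𝓘(ℝ, E) (1 : G)).symm s) Y)) (Q ∘L L)
      (unitCoord E G) := Q.hasFDerivAt.comp (unitCoord E G) hd
  have h1 : HasFDerivAt (fun s => Q (adj E ((extChartAt 𝓘(ℝ, E) (1 : G)).symm s) Y)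
      (adj E ((extChartAt 𝓘(ℝ, E) (1 : G)).symm s) Z)) _ (unitCoord E G) :=
    h0.clm_apply hd'
  have h2 := (hasFDerivAt_const (𝕜 := ℝ) (Q Y Z) (unitCoord E G)).congr_of_eventuallyEq
    (Eventually.of_forall fun s => hQ ((extChartAt 𝓘(ℝ, E) (1 : G)).symm s) Y Z)
  have h3 := congrArg (fun L => L X) (h1.unique h2)
  have A0 : adj E (1 : G) = ContinuousLinearMap.id ℝ E := adj_one
  simp [hL, hL'] at h3
  have e1 : (chartAt E (1 : G)).symm (unitCoord E G) = 1 := symm_unitCoord E G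
  rw [e1, A0] at h3
  simpa [add_comm] using h3

end Adjoint

/-! ### Translations in charts -/

section Action
variable {E : Type*} [NormedAddCommGroup E] [NormedSpace ℝ E]
  {F : Type*} [NormedAddCommGroup F] [NormedSpace ℝ F]
  {G : Type*} [TopologicalSpace G] [Group G] [ChartedSpace E G] [LieGroup 𝓘(ℝ, E) ∞ G]
  {M : Type*} [TopologicalSpace M] [ChartedSpace F M] [IsManifold 𝓘(ℝ, F) ∞ M]
  [MulAction G M] [ContMDiffSMul 𝓘(ℝ, E) 𝓘(ℝ, F) ∞ G M]

/-- The translation by `a` in the charts at `c` and `c'`. -/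
def smulChart (F : Type*) [NormedAddCommGroup F] [NormedSpace ℝ F] {G : Type*} [Group G]
    {M : Type*} [TopologicalSpace M] [ChartedSpace F M] [MulAction G M]
    (a : G) (c c' : M) (y : F) : F :=
  extChartAt 𝓘(ℝ, F) c' (a • (extChartAt 𝓘(ℝ, F) c).symm y)

/-- Every element of `G` acts on `M` by a diffeomorphism. -/
class SmoothTranslations (F : Type*) [NormedAddCommGroup F] [NormedSpace ℝ F] (G : Type*) [Group G]
    (M : Type*) [TopologicalSpace M] [ChartedSpace F M] [MulAction G M] : Prop where
  contMDiff_const_smul : ∀ a : G, ContMDiff 𝓘(ℝ, F) 𝓘(ℝ, F) ∞ (fun p : M => a • p)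

theorem smoothTranslations_of_contMDiffSMul (h : ContMDiffSMul 𝓘(ℝ, E) 𝓘(ℝ, F) ∞ G M) :
    SmoothTranslations F G M where
  contMDiff_const_smul _ := h.contMDiff_smul.comp (contMDiff_const.prodMk contMDiff_id)

variable [SmoothTranslations F G M]

theorem contDiffAt_smulChart {a : G} {c c' : M} {y : F}
    (hy : y ∈ (extChartAt 𝓘(ℝ, F) c).target)
    (h : a • (extChartAt 𝓘(ℝ, F) c).symm y ∈ (extChartAt 𝓘(ℝ, F) c').source) :
    ContDiffAt ℝ ∞ (smulChart F a c c') y := by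
  rw [← contMDiffAt_iff_contDiffAt]
  have h2 : ContMDiffAt 𝓘(ℝ, F) 𝓘(ℝ, F) ∞ (extChartAt 𝓘(ℝ, F) c).symm y :=
    (contMDiffOn_extChartAt_symm c).contMDiffAt ((isOpen_extChartAt_target c).mem_nhds hy)
  have h3 : ContMDiffAt 𝓘(ℝ, F) 𝓘(ℝ, F) ∞ (extChartAt 𝓘(ℝ, F) c')
      (a • (extChartAt 𝓘(ℝ, F) c).symm y) := contMDiffAt_extChartAt' (by simpa using h)
  exact ContMDiffAt.comp y h3 ((SmoothTranslations.contMDiff_const_smul a).contMDiffAt.comp y h2)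

theorem hasFDerivAt_smulChart {a : G} {c c' : M} {y : F}
    (hy : y ∈ (extChartAt 𝓘(ℝ, F) c).target)
    (h : a • (extChartAt 𝓘(ℝ, F) c).symm y ∈ (extChartAt 𝓘(ℝ, F) c').source) :
    HasFDerivAt (smulChart F a c c') (fderiv ℝ (smulChart F a c c') y) y :=
  ((contDiffAt_smulChart hy h).differentiableAt (by simp)).hasFDerivAt

/-- The chain rule for `p ↦ a • (b • p)`, with `c'` a chart for the intermediate point. This cocycle
rule underlies the isotropy representation, the independence of the metric from the representative
of a coset, and the change of charts (`a` or `b` equal to `1`). -/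
theorem fderiv_smulChart_mul {a b : G} {c c' c'' : M} {y : F}
    (hy : y ∈ (extChartAt 𝓘(ℝ, F) c).target)
    (h : b • (extChartAt 𝓘(ℝ, F) c).symm y ∈ (extChartAt 𝓘(ℝ, F) c').source)
    (h' : a • b • (extChartAt 𝓘(ℝ, F) c).symm y ∈ (extChartAt 𝓘(ℝ, F) c'').source) :
    fderiv ℝ (smulChart F (a * b) c c'') y =
      fderiv ℝ (smulChart F a c' c'') (smulChart F b c c' y) ∘L fderiv ℝ (smulChart F b c c') y := by
  have hb : (extChartAt 𝓘(ℝ, F) c').symm (smulChart F b c c' y) =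
      b • (extChartAt 𝓘(ℝ, F) c).symm y := (extChartAt 𝓘(ℝ, F) c').left_inv h
  have h1 := hasFDerivAt_smulChart (a := a) (c := c') (c' := c'') (y := smulChart F b c c' y)
    ((extChartAt 𝓘(ℝ, F) c').map_source h) (by rwa [hb])
  have h2 := hasFDerivAt_smulChart hy h
  refine HasFDerivAt.fderiv ((h1.comp y h2).congr_of_eventuallyEq ?_)
  have hc : ContinuousAt (fun y => b • (extChartAt 𝓘(ℝ, F) c).symm y) y :=
    (SmoothTranslations.contMDiff_const_smul (F := F) b).continuous.continuousAt.comp (continuousAt_extChartAt_symm'' hy)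
  filter_upwards [hc.eventually_mem ((isOpen_extChartAt_source c').mem_nhds h)] with z hz
  simp only [Function.comp, smulChart, (extChartAt 𝓘(ℝ, F) c').left_inv hz, mul_smul]

theorem fderiv_smulChart_one (c : M) {y : F} (hy : y ∈ (extChartAt 𝓘(ℝ, F) c).target) :
    fderiv ℝ (smulChart F (1 : G) c c) y = ContinuousLinearMap.id ℝ F := by
  refine HasFDerivAt.fderiv ((hasFDerivAt_id y).congr_of_eventuallyEq ?_)
  filter_upwards [(isOpen_extChartAt_target c).mem_nhds hy] with z hz
  simp only [smulChart, one_smul, id, (extChartAt 𝓘(ℝ, F) c).right_inv hz]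

theorem fderiv_smulChart_eq_actChart {b : G} {c c' : M} {s : E} {y : F}
    (hs : s ∈ (extChartAt 𝓘(ℝ, E) b).target) (hy : y ∈ (extChartAt 𝓘(ℝ, F) c).target)
    (h : (extChartAt 𝓘(ℝ, E) b).symm s • (extChartAt 𝓘(ℝ, F) c).symm y ∈
      (extChartAt 𝓘(ℝ, F) c').source) :
    fderiv ℝ (smulChart F ((extChartAt 𝓘(ℝ, E) b).symm s) c c') y =
      fderiv ℝ (actChart b c c') (s, y) ∘L ContinuousLinearMap.inr ℝ E F :=
  (HasFDerivAt.comp (f := fun z => (s, z)) y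
    ((contDiffAt_actChart hs hy h).differentiableAt (by simp)).hasFDerivAt
    (hasFDerivAt_prodMk_right s y)).fderiv

end Action

/-! ### The isotropy representation -/

section Quotient
variable {E : Type*} [NormedAddCommGroup E] [NormedSpace ℝ E]
  {F : Type*} [NormedAddCommGroup F] [InnerProductSpace ℝ F]
  {G : Type*} [TopologicalSpace G] [Group G] [ChartedSpace E G] [LieGroup 𝓘(ℝ, E) ∞ G]
  (H : Subgroup G) [ChartedSpace F (G ⧸ H)] [IsManifold 𝓘(ℝ, F) ∞ (G ⧸ H)]

variable (F) in
/-- The coordinates of the base point. -/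
abbrev baseCoord : F := extChartAt 𝓘(ℝ, F) (base H) (base H)

variable (F) in
theorem baseCoord_mem : baseCoord F H ∈ (extChartAt 𝓘(ℝ, F) (base H)).target :=
  mem_extChartAt_target _

variable (F) in
theorem symm_baseCoord : (extChartAt 𝓘(ℝ, F) (base H)).symm (baseCoord F H) = base H :=
  extChartAt_to_inv _

theorem smul_base (a : G) : a • base H = (a : G ⧸ H) := by
  change ((a * 1 : G) : G ⧸ H) = _
  rw [mul_one]

theorem smul_base_of_mem (h : H) : (h : G) • base H = base H := by
  rw [smul_base, base, QuotientGroup.eq]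
  simp

variable (E F) in
/-- `projDeriv` as a map of the model spaces. -/
def proj : E →L[ℝ] F := projDeriv E F H

theorem hasFDerivAt_projChart
    (hπ : Manifold.IsSubmersion 𝓘(ℝ, E) 𝓘(ℝ, F) ∞ (fun a : G => (a : G ⧸ H))) :
    HasFDerivAt (fun s => extChartAt 𝓘(ℝ, F) (base H)
      ((extChartAt 𝓘(ℝ, E) (1 : G)).symm s : G ⧸ H)) (proj E F H) (unitCoord E G) := by
  have h0 : MDifferentiableAt 𝓘(ℝ, E) 𝓘(ℝ, F) (fun a : G => (a : G ⧸ H)) 1 :=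
    hπ.contMDiff.contMDiffAt.mdifferentiableAt (by simp)
  have h1 : proj E F H = _ := mfderiv_eq_fderiv h0
  rw [h1]
  refine DifferentiableAt.hasFDerivAt ?_
  have h2 : ContMDiffAt 𝓘(ℝ, E) 𝓘(ℝ, E) ∞ (extChartAt 𝓘(ℝ, E) (1 : G)).symm (unitCoord E G) :=
    (contMDiffOn_extChartAt_symm 1).contMDiffAt
      ((isOpen_extChartAt_target (1 : G)).mem_nhds (unitCoord_mem E G))
  have h3 : ContMDiffAt 𝓘(ℝ, F) 𝓘(ℝ, F) ∞ (extChartAt 𝓘(ℝ, F) (base H))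
      (((extChartAt 𝓘(ℝ, E) (1 : G)).symm (unitCoord E G) : G) : G ⧸ H) := by
    rw [symm_unitCoord]; exact contMDiffAt_extChartAt
  have h4 := ContMDiffAt.comp (unitCoord E G) h3 (hπ.contMDiff.contMDiffAt.comp _ h2)
  rw [contMDiffAt_iff_contDiffAt] at h4
  exact h4.differentiableAt (by simp)

variable [ContMDiffSMul 𝓘(ℝ, E) 𝓘(ℝ, F) ∞ G (G ⧸ H)] [SmoothTranslations F G (G ⧸ H)]

theorem fundamentalField_base
    (hπ : Manifold.IsSubmersion 𝓘(ℝ, E) 𝓘(ℝ, F) ∞ (fun a : G => (a : G ⧸ H))) (X : E) :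
    fundamentalField G (base H) X (baseCoord F H) = proj E F H X := by
  have h1 : HasFDerivAt (fun s => actChart (1 : G) (base H) (base H) (s, baseCoord F H)) _
      (unitCoord E G) := HasFDerivAt.comp (f := fun s => (s, baseCoord F H)) (unitCoord E G)
    ((contDiffAt_actChart_unit (base H) (baseCoord_mem F H)).differentiableAt
      (by simp)).hasFDerivAt (hasFDerivAt_prodMk_left _ _)
  have h2 := h1.unique ((hasFDerivAt_projChart H hπ).congr_of_eventuallyEq
    (Eventually.of_forall fun s => by
      simp only [actChart, symm_baseCoord, smul_base]))
  exact congrArg (fun L => L X) h2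

theorem isotropyRep_eq_fderiv (h : H) :
    isotropyRep F H h = fderiv ℝ (smulChart F (h : G) (base H) (base H)) (baseCoord F H) :=
  mfderiv_eq_fderiv_of_eq (f := fun p : G ⧸ H => (h : G) • p) (smul_base_of_mem H h)
    ((SmoothTranslations.contMDiff_const_smul (h : G)).contMDiffAt.mdifferentiableAt (by simp))

theorem smulChart_base_of_mem (h : H) :
    smulChart F (h : G) (base H) (base H) (baseCoord F H) = baseCoord F H := by
  rw [smulChart, symm_baseCoord, smul_base_of_mem]

theorem isotropyRep_mul (h k : H) :
    isotropyRep F H (h * k) = isotropyRep F H h ∘L isotropyRep F H k := by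
  rw [isotropyRep_eq_fderiv , isotropyRep_eq_fderiv,
    isotropyRep_eq_fderiv]
  have := fderiv_smulChart_mul (a := (h : G)) (b := (k : G)) (c := base H) (c' := base H)
    (c'' := base H) (baseCoord_mem F H)
    (by rw [symm_baseCoord, smul_base_of_mem]; exact mem_extChartAt_source _)
    (by rw [symm_baseCoord, smul_base_of_mem, smul_base_of_mem]; exact mem_extChartAt_source _)
  rw [smulChart_base_of_mem] at this
  exact this

theorem isotropyRep_one : isotropyRep F H 1 = ContinuousLinearMap.id ℝ F := by
  rw [isotropyRep_eq_fderiv]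
  exact fderiv_smulChart_one (G := G) (base H) (baseCoord_mem F H)

theorem isotropyRep_apply_inv (h : H) (v : F) :
    isotropyRep F H h (isotropyRep F H h⁻¹ v) = v := by
  have := congrArg (fun L => L v) (isotropyRep_mul (F := F) H h h⁻¹)
  rw [mul_inv_cancel, isotropyRep_one] at this
  exact this.symm

/-- The projection intertwines the adjoint action of `H` and the isotropy representation. -/
theorem proj_adj
    (hπ : Manifold.IsSubmersion 𝓘(ℝ, E) 𝓘(ℝ, F) ∞ (fun a : G => (a : G ⧸ H))) (h : H) (X : E) :
    proj E F H (adj E (h : G) X) = isotropyRep F H h (proj E F H X) := by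
  have h0 := hasFDerivAt_projChart H hπ
  have h1 := h0
  rw [← conjChart_unit (E := E) (h : G)] at h1
  have e1 := h1.comp (unitCoord E G) (hasFDerivAt_conjChart (E := E) (h : G))
  have hb : extChartAt 𝓘(ℝ, F) (base H)
      ((extChartAt 𝓘(ℝ, E) (1 : G)).symm (unitCoord E G) : G ⧸ H) = baseCoord F H := by
    rw [symm_unitCoord]
  have h2 := hasFDerivAt_smulChart (F := F) (a := (h : G)) (c := base H) (c' := base H)
    (y := baseCoord F H) (baseCoord_mem F H)
    (by rw [symm_baseCoord, smul_base_of_mem]; exact mem_extChartAt_source _)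
  rw [← isotropyRep_eq_fderiv, ← hb] at h2
  have e2 := h2.comp (unitCoord E G) h0
  have hcont : ContinuousAt (fun s => ((extChartAt 𝓘(ℝ, E) (1 : G)).symm s : G ⧸ H))
      (unitCoord E G) :=
    hπ.contMDiff.continuous.continuousAt.comp (continuousAt_extChartAt_symm 1)
  have hsrc : ∀ᶠ s in 𝓝 (unitCoord E G), ((extChartAt 𝓘(ℝ, E) (1 : G)).symm s : G ⧸ H) ∈
      (extChartAt 𝓘(ℝ, F) (base H)).source := by
    refine hcont.eventually_mem ((isOpen_extChartAt_source _).mem_nhds ?_)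
    rw [symm_unitCoord]; exact mem_extChartAt_source _
  -- The two maps agree because `h x h⁻¹ H = h x H`.
  have e3 := e2.unique (e1.congr_of_eventuallyEq (by
    filter_upwards [conjChart_symm (E := E) (h : G), hsrc] with s hs hs'
    simp only [Function.comp, hs, smulChart, (extChartAt 𝓘(ℝ, F) (base H)).left_inv hs']
    congr 1
    change (((h : G) * (extChartAt 𝓘(ℝ, E) (1 : G)).symm s : G) : G ⧸ H) = _
    rw [QuotientGroup.eq]
    have hx : ∀ x : G, ((h : G) * x)⁻¹ * ((h : G) * x * (h : G)⁻¹) = (h : G)⁻¹ := by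
      intro x; group
    rw [hx]
    exact H.inv_mem h.2))
  exact (congrArg (fun L => L X) e3).symm

end Quotient

/-! ### Invariant metrics in charts and the Killing equation -/

section Metric
variable {F : Type*} [NormedAddCommGroup F] [InnerProductSpace ℝ F]
  {G : Type*} [TopologicalSpace G] [Group G]
  (H : Subgroup G) [ChartedSpace F (G ⧸ H)] [IsManifold 𝓘(ℝ, F) ∞ (G ⧸ H)]
  [SmoothTranslations F G (G ⧸ H)]

theorem exists_smul_base (p : G ⧸ H) : ∃ a : G, a • base H = p := by
  obtain ⟨a, rfl⟩ := QuotientGroup.mk_surjective p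
  exact ⟨a, smul_base H a⟩

/-- Only the chain rule, for the representative chosen in `metricAt`. The linear map on the right
does not depend on `g`, which is what later allows two volume densities to be compared. -/
theorem chartMetric_apply_out (g : Form F) (c : G ⧸ H) {y : F}
    (hy : y ∈ (extChartAt 𝓘(ℝ, F) c).target) (v w : F) :
    chartMetric H g c y v w =
      g (fderiv ℝ (smulChart F (Quotient.out ((extChartAt 𝓘(ℝ, F) c).symm y) : G)⁻¹ c (base H)) y v)
        (fderiv ℝ (smulChart F (Quotient.out ((extChartAt 𝓘(ℝ, F) c).symm y) : G)⁻¹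
          c (base H)) y w) := by
  set a : G := Quotient.out ((extChartAt 𝓘(ℝ, F) c).symm y) with ha
  have hap : a⁻¹ • (extChartAt 𝓘(ℝ, F) c).symm y = base H := by
    have h1 : (a : G ⧸ H) = (extChartAt 𝓘(ℝ, F) c).symm y := Quotient.out_eq' _
    rw [← h1, ← smul_base, inv_smul_smul]
  have h1 : MDifferentiableAt 𝓘(ℝ, F) 𝓘(ℝ, F) (extChartAt 𝓘(ℝ, F) c).symm y :=
    ((contMDiffOn_extChartAt_symm (n := ∞) c).contMDiffAt
      ((isOpen_extChartAt_target c).mem_nhds hy)).mdifferentiableAt (by simp)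
  have h2 : MDifferentiableAt 𝓘(ℝ, F) 𝓘(ℝ, F) (fun q : G ⧸ H => a⁻¹ • q)
      ((extChartAt 𝓘(ℝ, F) c).symm y) :=
    (SmoothTranslations.contMDiff_const_smul (F := F) a⁻¹).contMDiffAt.mdifferentiableAt (by simp)
  have h3 := mfderiv_comp y h2 h1
  have h4 := mfderiv_eq_fderiv_of_eq (f := (fun q : G ⧸ H => a⁻¹ • q) ∘
    (extChartAt 𝓘(ℝ, F) c).symm) (x := y) (p := base H) hap (h2.comp y h1)
  simp only [extChartAt_model_space_eq_id, PartialEquiv.refl_symm, PartialEquiv.refl_coe, id] at h4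
  have h5 : fderiv ℝ (smulChart F a⁻¹ c (base H)) y = _ := h4.symm.trans h3
  rw [h5]
  rfl

theorem mem_of_smul_base_eq {a b : G} (h : a • base H = b • base H) : b⁻¹ * a ∈ H := by
  rw [smul_base, smul_base] at h
  rw [← QuotientGroup.eq]
  exact h.symm

/-- The invariant metric in the chart at `c`, through any translation to the base point. -/
theorem chartMetric_apply {g : Form F} (hg : g ∈ invariantMetrics F H) (c : G ⧸ H) {y : F}
    (hy : y ∈ (extChartAt 𝓘(ℝ, F) c).target) {a : G}
    (ha : a • base H = (extChartAt 𝓘(ℝ, F) c).symm y) (v w : F) :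
    chartMetric H g c y v w =
      g (fderiv ℝ (smulChart F a⁻¹ c (base H)) y v)
        (fderiv ℝ (smulChart F a⁻¹ c (base H)) y w) := by
  rw [chartMetric_apply_out H g c hy]
  set b : G := Quotient.out ((extChartAt 𝓘(ℝ, F) c).symm y) with hb
  have hbp : b • base H = (extChartAt 𝓘(ℝ, F) c).symm y := by
    rw [smul_base]; exact Quotient.out_eq' _
  have hh : b⁻¹ * a ∈ H := mem_of_smul_base_eq H (ha.trans hbp.symm)
  have hap : a⁻¹ • (extChartAt 𝓘(ℝ, F) c).symm y = base H := by
    rw [← ha, inv_smul_smul]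
  have hbp' : b⁻¹ • (extChartAt 𝓘(ℝ, F) c).symm y = base H := by
    rw [← hbp, inv_smul_smul]
  -- The two representatives differ by `b⁻¹ a ∈ H`, whose differential at the base point is an
  -- isotropy operator and hence preserves `g`.
  have e1 : b⁻¹ = (b⁻¹ * a) * a⁻¹ := by group
  have key := fderiv_smulChart_mul (a := b⁻¹ * a) (b := a⁻¹) (c := c) (c' := base H)
    (c'' := base H) hy (by rw [hap]; exact mem_extChartAt_source _)
    (by rw [hap]
        have := smul_base_of_mem H ⟨_, hh⟩
        simp only at this
        rw [this]; exact mem_extChartAt_source _)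
  have e2 : smulChart F a⁻¹ c (base H) y = baseCoord F H := by
    rw [smulChart, hap]
  rw [e2, ← e1] at key
  have e3 := isotropyRep_eq_fderiv (F := F) H ⟨_, hh⟩
  simp only at e3
  rw [← e3] at key
  rw [key]
  exact hg.2.2 ⟨_, hh⟩ _ _

theorem chartMetric_baseCoord {g : Form F} (hg : g ∈ invariantMetrics F H) :
    chartMetric H g (base H) (baseCoord F H) = g := by
  ext v w
  rw [chartMetric_apply H hg (base H) (baseCoord_mem F H) (a := 1)
    (by rw [symm_baseCoord, one_smul]), inv_one, fderiv_smulChart_one _ (baseCoord_mem F H)]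
  rfl

theorem fderiv_smulChart_injective (c : G ⧸ H) {y : F}
    (hy : y ∈ (extChartAt 𝓘(ℝ, F) c).target) {a : G}
    (ha : a • base H = (extChartAt 𝓘(ℝ, F) c).symm y) :
    Function.Injective (fderiv ℝ (smulChart F a⁻¹ c (base H)) y) := by
  have hap : a⁻¹ • (extChartAt 𝓘(ℝ, F) c).symm y = base H := by rw [← ha, inv_smul_smul]
  have key := fderiv_smulChart_mul (a := a) (b := a⁻¹) (c := c) (c' := base H)
    (c'' := c) hy (by rw [hap]; exact mem_extChartAt_source _)
    (by rw [hap, ha]; exact (extChartAt 𝓘(ℝ, F) c).map_target hy)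
  rw [mul_inv_cancel, fderiv_smulChart_one c hy] at key
  intro v w hvw
  have e1 := congrArg (fun L => L v) key
  have e2 := congrArg (fun L => L w) key
  simp only [ContinuousLinearMap.comp_apply, ContinuousLinearMap.id_apply] at e1 e2
  rw [e1, e2, hvw]

theorem chartMetric_symm {g : Form F} (hg : g ∈ invariantMetrics F H) (c : G ⧸ H) {y : F}
    (hy : y ∈ (extChartAt 𝓘(ℝ, F) c).target) (v w : F) :
    chartMetric H g c y v w = chartMetric H g c y w v := by
  obtain ⟨a, ha⟩ := exists_smul_base H ((extChartAt 𝓘(ℝ, F) c).symm y)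
  rw [chartMetric_apply H hg c hy ha, chartMetric_apply H hg c hy ha, hg.1]

theorem chartMetric_pos {g : Form F} (hg : g ∈ invariantMetrics F H) (c : G ⧸ H) {y : F}
    (hy : y ∈ (extChartAt 𝓘(ℝ, F) c).target) {v : F} (hv : v ≠ 0) :
    0 < chartMetric H g c y v v := by
  obtain ⟨a, ha⟩ := exists_smul_base H ((extChartAt 𝓘(ℝ, F) c).symm y)
  rw [chartMetric_apply H hg c hy ha]
  refine hg.2.1 _ fun h => hv (fderiv_smulChart_injective H c hy ha ?_)
  rw [h, map_zero]

variable {E : Type*} [NormedAddCommGroup E] [NormedSpace ℝ E]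
  [ChartedSpace E G] [LieGroup 𝓘(ℝ, E) ∞ G]

theorem contDiff_bilinearComp (g : Form F) :
    ContDiff ℝ ∞ (fun L : F →L[ℝ] F => g.bilinearComp L L) := by
  have h1 : ContDiff ℝ ∞ (fun L : F →L[ℝ] F => g ∘L L) := contDiff_const.clm_comp contDiff_id
  have h2 : ContDiff ℝ ∞ (fun L : F →L[ℝ] F =>
      ContinuousLinearMap.flipₗᵢ ℝ F F ℝ (g ∘L L)) :=
    (ContinuousLinearMap.flipₗᵢ ℝ F F ℝ).toContinuousLinearEquiv.contDiff.comp h1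
  have h3 : ContDiff ℝ ∞ (fun L : F →L[ℝ] F =>
      ContinuousLinearMap.flipₗᵢ ℝ F F ℝ ((ContinuousLinearMap.flipₗᵢ ℝ F F ℝ (g ∘L L)) ∘L L)) :=
    (ContinuousLinearMap.flipₗᵢ ℝ F F ℝ).toContinuousLinearEquiv.contDiff.comp
      (h2.clm_comp contDiff_id)
  exact h3

-- The representative `Quotient.out` need not depend continuously on the point. By
-- `chartMetric_apply` it may be replaced by a smooth local section `σ`, and then the differential
-- of the translation by `σ(p)⁻¹` varies smoothly.
variable (E) in
theorem contDiffAt_chartMetric [ContMDiffSMul 𝓘(ℝ, E) 𝓘(ℝ, F) ∞ G (G ⧸ H)]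
    (hπ : Manifold.IsSubmersion 𝓘(ℝ, E) 𝓘(ℝ, F) ∞ (fun a : G => (a : G ⧸ H)))
    {g : Form F} (hg : g ∈ invariantMetrics F H) (c : G ⧸ H) {y : F}
    (hy : y ∈ (extChartAt 𝓘(ℝ, F) c).target) :
    ContDiffAt ℝ ∞ (chartMetric H g c) y := by
  obtain ⟨a, ha⟩ := QuotientGroup.mk_surjective ((extChartAt 𝓘(ℝ, F) c).symm y)
  obtain ⟨σ, hσa, hσ, hσe⟩ := exists_local_section (hπ.isSubmersionAt a)
  rw [ha] at hσa hσ hσe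
  have hs : ContMDiffAt 𝓘(ℝ, F) 𝓘(ℝ, F) ∞ (extChartAt 𝓘(ℝ, F) c).symm y :=
    (contMDiffOn_extChartAt_symm c).contMDiffAt ((isOpen_extChartAt_target c).mem_nhds hy)
  have hτ : ContMDiffAt 𝓘(ℝ, F) 𝓘(ℝ, E) ∞
      (fun y' => (σ ((extChartAt 𝓘(ℝ, F) c).symm y'))⁻¹) y := (hσ.comp y hs).inv
  have hval : (σ ((extChartAt 𝓘(ℝ, F) c).symm y))⁻¹ = a⁻¹ := by rw [hσa]
  let τ : F → E := fun y' => extChartAt 𝓘(ℝ, E) a⁻¹ (σ ((extChartAt 𝓘(ℝ, F) c).symm y'))⁻¹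
  have hτs : ContDiffAt ℝ ∞ τ y := by
    rw [← contMDiffAt_iff_contDiffAt]
    refine ContMDiffAt.comp y ?_ hτ
    rw [hval]
    exact contMDiffAt_extChartAt
  have hτy : τ y = extChartAt 𝓘(ℝ, E) a⁻¹ a⁻¹ := by simp only [τ, hval]
  have hsrc : ∀ᶠ y' in 𝓝 y, (σ ((extChartAt 𝓘(ℝ, F) c).symm y'))⁻¹ ∈
      (extChartAt 𝓘(ℝ, E) a⁻¹).source := by
    refine hτ.continuousAt.eventually_mem ((isOpen_extChartAt_source _).mem_nhds ?_)
    rw [hval]; exact mem_extChartAt_source _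
  have hsec : ∀ᶠ y' in 𝓝 y, (σ ((extChartAt 𝓘(ℝ, F) c).symm y') : G ⧸ H) =
      (extChartAt 𝓘(ℝ, F) c).symm y' := hs.continuousAt.eventually hσe
  have hsm : ContDiffAt ℝ ∞ (actChart a⁻¹ c (base H)) (τ y, y) := by
    rw [hτy]
    refine contDiffAt_actChart (mem_extChartAt_target _) hy ?_
    rw [extChartAt_to_inv, ← ha, ← smul_base, inv_smul_smul]
    exact mem_extChartAt_source _
  have hL : ContDiffAt ℝ ∞ (fun y' => fderiv ℝ (actChart a⁻¹ c (base H)) (τ y', y') ∘L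
      ContinuousLinearMap.inr ℝ E F) y := by
    have h1 : ContDiffAt ℝ ∞ (fderiv ℝ (actChart a⁻¹ c (base H))) (τ y, y) :=
      hsm.fderiv_right (m := ∞) (by simp)
    have h2 : ContDiffAt ℝ ∞ (fun y' => (τ y', y')) y := hτs.prodMk contDiffAt_id
    exact (ContDiffAt.comp (f := fun y' => (τ y', y')) y h1 h2).clm_comp contDiffAt_const
  refine ((contDiff_bilinearComp g).contDiffAt.comp y hL).congr_of_eventuallyEq ?_
  filter_upwards [hsrc, hsec, (isOpen_extChartAt_target c).mem_nhds hy] with y' h1 h2 hy'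
  have h3 : (extChartAt 𝓘(ℝ, E) a⁻¹).symm (τ y') = (σ ((extChartAt 𝓘(ℝ, F) c).symm y'))⁻¹ :=
    (extChartAt 𝓘(ℝ, E) a⁻¹).left_inv h1
  have h4 := fderiv_smulChart_eq_actChart (b := a⁻¹) (c := c) (c' := base H)
    ((extChartAt 𝓘(ℝ, E) a⁻¹).map_source h1) hy' (by
      have h5 : (σ ((extChartAt 𝓘(ℝ, F) c).symm y'))⁻¹ • (extChartAt 𝓘(ℝ, F) c).symm y' =
          base H := by rw [inv_smul_eq_iff, smul_base, h2]
      rw [h3, h5]; exact mem_extChartAt_source _)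
  rw [h3] at h4
  ext v w
  rw [chartMetric_apply H hg c hy' (a := σ ((extChartAt 𝓘(ℝ, F) c).symm y'))
    (by rw [smul_base, h2]), h4]
  rfl

/-- Invariance of the metric under `G`, infinitesimally: the Killing equation. -/
theorem chartMetric_killing [ContMDiffSMul 𝓘(ℝ, E) 𝓘(ℝ, F) ∞ G (G ⧸ H)]
    (hπ : Manifold.IsSubmersion 𝓘(ℝ, E) 𝓘(ℝ, F) ∞ (fun a : G => (a : G ⧸ H)))
    {g : Form F} (hg : g ∈ invariantMetrics F H) (c : G ⧸ H) {y : F}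
    (hy : y ∈ (extChartAt 𝓘(ℝ, F) c).target) (X : E) (v w : F) :
    fderiv ℝ (chartMetric H g c) y (fundamentalField G c X y) v w +
      chartMetric H g c y (fderiv ℝ (fundamentalField G c X) y v) w +
      chartMetric H g c y v (fderiv ℝ (fundamentalField G c X) y w) = 0 := by
  have hΦ : ContDiffAt ℝ 2 (actChart (1 : G) c c) (unitCoord E G, y) :=
    (contDiffAt_actChart_unit c hy).of_le ENat.LEInfty.out
  have hΦ1 : DifferentiableAt ℝ (actChart (1 : G) c c) (unitCoord E G, y) :=
    hΦ.differentiableAt (by simp)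
  have hΦ2 : DifferentiableAt ℝ (fderiv ℝ (actChart (1 : G) c c)) (unitCoord E G, y) :=
    (hΦ.fderiv_right (m := 1) (by norm_num)).differentiableAt (by simp)
  have sΦ := (hΦ.isSymmSndFDerivAt (by simp)).eq
  have hunit := actChart_unit (E := E) (G := G) c hy
  have hcont : ContinuousAt (fun s => (extChartAt 𝓘(ℝ, E) (1 : G)).symm s •
      (extChartAt 𝓘(ℝ, F) c).symm y) (unitCoord E G) := by
    have : ContinuousSMul G (G ⧸ H) := ContMDiffSMul.continuousSMul (I := 𝓘(ℝ, E))
      (I' := 𝓘(ℝ, F)) ∞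
    exact (continuousAt_extChartAt_symm (1 : G)).smul continuousAt_const
  have hsrc : ∀ᶠ s in 𝓝 (unitCoord E G), (extChartAt 𝓘(ℝ, E) (1 : G)).symm s •
      (extChartAt 𝓘(ℝ, F) c).symm y ∈ (extChartAt 𝓘(ℝ, F) c).source := by
    refine hcont.eventually_mem ((isOpen_extChartAt_source c).mem_nhds ?_)
    rw [symm_unitCoord, one_smul]
    exact (extChartAt 𝓘(ℝ, F) c).map_target hy
  obtain ⟨a, ha⟩ := exists_smul_base H ((extChartAt 𝓘(ℝ, F) c).symm y)
  -- Translations near the unit are isometries. The derivative of this identity at the unit in the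
  -- direction `X` is the Killing equation.
  have hinv : ∀ᶠ s in 𝓝 (unitCoord E G),
      chartMetric H g c (actChart (1 : G) c c (s, y))
        (fderiv ℝ (actChart (1 : G) c c) (s, y) (0, v))
        (fderiv ℝ (actChart (1 : G) c c) (s, y) (0, w)) = chartMetric H g c y v w := by
    filter_upwards [hsrc, (isOpen_extChartAt_target (1 : G)).mem_nhds (unitCoord_mem E G)] with
      s hs hs'
    set b := (extChartAt 𝓘(ℝ, E) (1 : G)).symm s with hb
    have h1 := fderiv_smulChart_eq_actChart hs' hy hs
    have h2 : ∀ v, fderiv ℝ (actChart (1 : G) c c) (s, y) (0, v) =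
      fderiv ℝ (smulChart F b c c) y v := by
      intro v
      rw [h1]; simp
    have h3 : actChart (1 : G) c c (s, y) = smulChart F b c c y := rfl
    have h4 : (extChartAt 𝓘(ℝ, F) c).symm (smulChart F b c c y) =
      b • (extChartAt 𝓘(ℝ, F) c).symm y := (extChartAt 𝓘(ℝ, F) c).left_inv hs
    rw [h2, h2, h3, chartMetric_apply H hg c hy ha,
      chartMetric_apply H hg c (show smulChart F b c c y ∈ _ from
        (extChartAt 𝓘(ℝ, F) c).map_source hs) (a := b * a)
        (by rw [mul_smul, ha, h4])]
    have h5 := fderiv_smulChart_mul (a := (b * a)⁻¹) (b := b) (c := c) (c' := c)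
      (c'' := base H) hy hs (by
        rw [← ha, ← mul_smul b a, inv_smul_smul]
        exact mem_extChartAt_source _)
    rw [mul_inv_rev, inv_mul_cancel_right] at h5
    rw [h5, mul_inv_rev]
    rfl
  have hgd : DifferentiableAt ℝ (chartMetric H g c) y :=
    (contDiffAt_chartMetric H E hπ hg c hy).differentiableAt (by simp)
  have hgd' : HasFDerivAt (chartMetric H g c) (fderiv ℝ (chartMetric H g c) y)
      (actChart (1 : G) c c (unitCoord E G, y)) := by rw [hunit]; exact hgd.hasFDerivAt
  have d0 : HasFDerivAt (fun s => actChart (1 : G) c c (s, y)) _ (unitCoord E G) :=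
    HasFDerivAt.comp (f := fun s => (s, y)) (unitCoord E G) hΦ1.hasFDerivAt
      (hasFDerivAt_prodMk_left (unitCoord E G) y)
  have d1 : HasFDerivAt (fun s => chartMetric H g c (actChart (1 : G) c c (s, y))) _
      (unitCoord E G) := HasFDerivAt.comp (f := fun s => actChart (1 : G) c c (s, y))
    (unitCoord E G) hgd' d0
  have d2 : ∀ v : F, HasFDerivAt (fun s => fderiv ℝ (actChart (1 : G) c c) (s, y) (0, v))
      ((fderiv ℝ (fderiv ℝ (actChart (1 : G) c c)) (unitCoord E G, y) ∘L
        ContinuousLinearMap.inl ℝ E F).flip (0, v)) (unitCoord E G) := by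
    intro v
    have := HasFDerivAt.clm_apply (HasFDerivAt.comp (f := fun s => (s, y)) (unitCoord E G)
      hΦ2.hasFDerivAt (hasFDerivAt_prodMk_left (unitCoord E G) y))
      (hasFDerivAt_const ((0, v) : E × F) (unitCoord E G))
    simpa using this
  have d3 := (d1.clm_apply (d2 v)).clm_apply (d2 w)
  have d4 := (d3.unique ((hasFDerivAt_const (chartMetric H g c y v w)
    (unitCoord E G)).congr_of_eventuallyEq hinv))
  have d5 := congrArg (fun L => L X) d4
  -- By symmetry of second derivatives, differentiating the fundamental field in `y` is the same as
  -- differentiating the differential of the translation in `s`.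
  have hK : ∀ v, fderiv ℝ (fundamentalField G c X) y v =
      fderiv ℝ (fderiv ℝ (actChart (1 : G) c c)) (unitCoord E G, y) (X, 0) (0, v) := by
    intro v
    have := HasFDerivAt.clm_apply (HasFDerivAt.comp (f := fun z => (unitCoord E G, z)) y
      hΦ2.hasFDerivAt (hasFDerivAt_prodMk_right (unitCoord E G) y))
      (hasFDerivAt_const ((X, 0) : E × F) y)
    have h2 : HasFDerivAt (fundamentalField G c X) _ y := this
    rw [h2.fderiv, sΦ]
    simp
  have hv0 : ∀ v, fderiv ℝ (actChart (1 : G) c c) (unitCoord E G, y) (0, v) = v := by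
    intro v
    have h1 := HasFDerivAt.comp (f := fun z => (unitCoord E G, z)) y
      hΦ1.hasFDerivAt (hasFDerivAt_prodMk_right (unitCoord E G) y)
    have h2 := h1.unique ((hasFDerivAt_id y).congr_of_eventuallyEq (by
      filter_upwards [(isOpen_extChartAt_target c).mem_nhds hy] with z hz
      exact actChart_unit c hz))
    simpa using congrArg (fun L => L v) h2
  simp only [add_apply, ContinuousLinearMap.comp_apply, ContinuousLinearMap.flip_apply,
    ContinuousLinearMap.inl_apply, zero_apply, hunit, hv0] at d5
  rw [hK, hK, fundamentalField]
  linarith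

end Metric

/-! ### Killing fields and curvature -/

section Curvature
variable {F : Type*} [NormedAddCommGroup F] [NormedSpace ℝ F] [FiniteDimensional ℝ F]

theorem isInvertible_of_pos {g : Form F} (hg : ∀ v, v ≠ 0 → 0 < g v v) : g.IsInvertible := by
  have hinj : Function.Injective (g : F →ₗ[ℝ] (F →L[ℝ] ℝ)) := by
    rw [← LinearMap.ker_eq_bot, LinearMap.ker_eq_bot']
    intro v hv
    by_contra hne
    have h1 := hg v hne
    have h2 : g v = 0 := hv
    rw [h2] at h1
    simp at h1
  have hdim : Module.finrank ℝ F = Module.finrank ℝ (F →L[ℝ] ℝ) := by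
    rw [← (LinearMap.toContinuousLinearMap : (F →ₗ[ℝ] ℝ) ≃ₗ[ℝ] (F →L[ℝ] ℝ)).finrank_eq]
    exact Subspace.dual_finrank_eq.symm
  refine ⟨(LinearMap.linearEquivOfInjective _ hinj hdim).toContinuousLinearEquiv, ?_⟩
  ext v w
  rfl

theorem apply_inverse_of_pos {g : Form F} (hg : ∀ v, v ≠ 0 → 0 < g v v) (l : F →L[ℝ] ℝ) :
    g (g.inverse l) = l := by
  obtain ⟨e, he⟩ := isInvertible_of_pos hg
  rw [← he, ContinuousLinearMap.inverse_equiv]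
  simp

theorem eq_of_pos {g : Form F} (hg : ∀ v, v ≠ 0 → 0 < g v v) {u v : F}
    (h : ∀ w, g u w = g v w) : u = v := by
  by_contra hne
  have h1 := hg (u - v) (sub_ne_zero.2 hne)
  have h2 : g (u - v) = 0 := by ext w; simp [h w]
  rw [h2, zero_apply] at h1
  exact lt_irrefl _ h1

/-- A metric near `y`. -/
structure IsMetricNear (g : F → Form F) (y : F) : Prop where
  contDiffAt : ContDiffAt ℝ 2 g y
  symm : ∀ᶠ z in 𝓝 y, ∀ u v, g z u v = g z v u
  pos : ∀ᶠ z in 𝓝 y, ∀ v, v ≠ 0 → 0 < g z v v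

/-- A Killing field near `y`. -/
structure IsKillingNear (g : F → Form F) (K : F → F) (y : F) : Prop where
  contDiffAt : ContDiffAt ℝ 2 K y
  killing : ∀ᶠ z in 𝓝 y, ∀ v w,
    fderiv ℝ g z (K z) v w + g z (fderiv ℝ K z v) w + g z v (fderiv ℝ K z w) = 0

/-- The covariant derivative `v ↦ ∇_v K`. -/
def covDeriv (g : F → Form F) (K : F → F) (y : F) : F →L[ℝ] F :=
  fderiv ℝ K y + (christoffel g y).flip (K y)

theorem covDeriv_apply (g : F → Form F) (K : F → F) (y v : F) :
    covDeriv g K y v = fderiv ℝ K y v + christoffel g y v (K y) := rfl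

variable {g : F → Form F} {y : F}

theorem IsMetricNear.differentiableAt (hg : IsMetricNear g y) : DifferentiableAt ℝ g y :=
  hg.contDiffAt.differentiableAt (by simp)

theorem IsMetricNear.differentiableAt_fderiv (hg : IsMetricNear g y) :
    DifferentiableAt ℝ (fderiv ℝ g) y :=
  (hg.contDiffAt.fderiv_right (m := 1) (by norm_num)).differentiableAt (by simp)

theorem IsMetricNear.christoffel_spec (hg : IsMetricNear g y) :
    ∀ᶠ z in 𝓝 y, ∀ u v w, g z (christoffel g z u v) w =
      (2⁻¹ : ℝ) * (fderiv ℝ g z u v w + fderiv ℝ g z v u w - fderiv ℝ g z w u v) := by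
  filter_upwards [hg.pos] with z hz u v w
  rw [christoffel_apply, apply_inverse_of_pos hz, koszul_apply]

theorem IsMetricNear.differentiableAt_christoffel (hg : IsMetricNear g y) :
    DifferentiableAt ℝ (christoffel g) y := by
  have h1 : DifferentiableAt ℝ (fun z => (g z).inverse) y := by
    obtain ⟨e, he⟩ := isInvertible_of_pos hg.pos.self_of_nhds
    have h2 : DifferentiableAt ℝ ContinuousLinearMap.inverse (g y) := by
      have := contDiffAt_map_inverse (𝕜 := ℝ) (n := 1) e
      rw [← he]
      exact this.differentiableAt (by simp)
    exact DifferentiableAt.comp (g := ContinuousLinearMap.inverse) y h2 hg.differentiableAt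
  have h3 := hg.differentiableAt_fderiv
  have h4 : DifferentiableAt ℝ (fun z => (fderiv ℝ g z).flip) y :=
    DifferentiableAt.comp (g := ContinuousLinearMap.flipₗᵢ ℝ F F (F →L[ℝ] ℝ)) y
      (ContinuousLinearMap.flipₗᵢ ℝ F F (F →L[ℝ] ℝ)).toContinuousLinearEquiv.differentiableAt h3
  have h5 : DifferentiableAt ℝ (koszul g) y := by
    have : koszul g = fun z => (2⁻¹ : ℝ) • ((fderiv ℝ g z) + (fderiv ℝ g z).flip -
      (ContinuousLinearMap.flipₗᵢ ℝ F F ℝ).toContinuousLinearEquiv.toContinuousLinearMap ∘L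
        (fderiv ℝ g z).flip) := rfl
    rw [this]
    exact ((h3.add h4).sub ((differentiableAt_const _).clm_comp h4)).const_smul (2⁻¹ : ℝ)
  have h6 : DifferentiableAt ℝ (fun z => ContinuousLinearMap.compL ℝ F (F →L[ℝ] ℝ) F
      (g z).inverse) y :=
    (ContinuousLinearMap.compL ℝ F (F →L[ℝ] ℝ) F).differentiableAt.comp y h1
  exact h6.clm_comp h5

theorem IsMetricNear.fderiv_symm (hg : IsMetricNear g y) (u v w : F) :
    fderiv ℝ g y u v w = fderiv ℝ g y u w v := by
  have h : ∀ v w, HasFDerivAt (fun z => g z v w) (((fderiv ℝ g y).flip v).flip w) y := by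
    intro v w
    have := ((hg.differentiableAt.hasFDerivAt.clm_apply (hasFDerivAt_const v y)).clm_apply
      (hasFDerivAt_const w y))
    refine this.congr_fderiv ?_
    ext; simp
  have h2 := (h v w).unique ((h w v).congr_of_eventuallyEq (hg.symm.mono fun z hz => hz v w))
  exact congrArg (fun L => L u) h2

theorem IsMetricNear.christoffel_symm (hg : IsMetricNear g y) (u v : F) :
    christoffel g y u v = christoffel g y v u := by
  refine eq_of_pos hg.pos.self_of_nhds fun w => ?_
  rw [hg.christoffel_spec.self_of_nhds, hg.christoffel_spec.self_of_nhds, hg.fderiv_symm w u v]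
  ring

/-- The derivative in the direction `x` of the Koszul identity `christoffel_spec`. -/
theorem IsMetricNear.fderiv_christoffel (hg : IsMetricNear g y) (x u v w : F) :
    fderiv ℝ g y x (christoffel g y u v) w + g y (fderiv ℝ (christoffel g) y x u v) w =
      (2⁻¹ : ℝ) * (fderiv ℝ (fderiv ℝ g) y x u v w + fderiv ℝ (fderiv ℝ g) y x v u w -
        fderiv ℝ (fderiv ℝ g) y x w u v) := by
  have h1 : ∀ u v w, HasFDerivAt (fun z => fderiv ℝ g z u v w)
      ((((fderiv ℝ (fderiv ℝ g) y).flip u).flip v).flip w) y := by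
    intro u v w
    have := ((hg.differentiableAt_fderiv.hasFDerivAt.clm_apply
      (hasFDerivAt_const u y)).clm_apply (hasFDerivAt_const v y)).clm_apply (hasFDerivAt_const w y)
    refine this.congr_fderiv ?_
    ext; simp
  have h2 := ((((h1 u v w).add (h1 v u w)).sub (h1 w u v)).const_mul (2⁻¹ : ℝ))
  have h3 : HasFDerivAt (fun z => christoffel g z u v)
      (((fderiv ℝ (christoffel g) y).flip u).flip v) y := by
    have := (hg.differentiableAt_christoffel.hasFDerivAt.clm_apply
      (hasFDerivAt_const u y)).clm_apply (hasFDerivAt_const v y)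
    refine this.congr_fderiv ?_
    ext; simp
  have h4 := (hg.differentiableAt.hasFDerivAt.clm_apply h3).clm_apply (hasFDerivAt_const w y)
  have h5 := h4.unique (h2.congr_of_eventuallyEq
    (hg.christoffel_spec.mono fun z hz => hz u v w))
  have h6 := congrArg (fun L => L x) h5
  simp at h6
  rw [add_comm]
  simpa using h6

variable {K : F → F}

theorem IsKillingNear.differentiableAt (hK : IsKillingNear g K y) : DifferentiableAt ℝ K y :=
  hK.contDiffAt.differentiableAt (by simp)

theorem IsKillingNear.differentiableAt_fderiv (hK : IsKillingNear g K y) :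
    DifferentiableAt ℝ (fderiv ℝ K) y :=
  (hK.contDiffAt.fderiv_right (m := 1) (by norm_num)).differentiableAt (by simp)

/-- The derivative in the direction `u` of the Killing equation. -/
theorem IsKillingNear.fderiv_killing (hg : IsMetricNear g y) (hK : IsKillingNear g K y)
    (u v w : F) :
    fderiv ℝ (fderiv ℝ g) y u (K y) v w + fderiv ℝ g y (fderiv ℝ K y u) v w
      + fderiv ℝ g y u (fderiv ℝ K y v) w + g y (fderiv ℝ (fderiv ℝ K) y u v) w
      + fderiv ℝ g y u v (fderiv ℝ K y w) + g y v (fderiv ℝ (fderiv ℝ K) y u w) = 0 := by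
  have hg1 := hg.differentiableAt.hasFDerivAt
  have hK2 := hK.differentiableAt_fderiv.hasFDerivAt
  have h1 := ((hg.differentiableAt_fderiv.hasFDerivAt.clm_apply
    hK.differentiableAt.hasFDerivAt).clm_apply (hasFDerivAt_const v y)).clm_apply
    (hasFDerivAt_const w y)
  have h2 := (hg1.clm_apply (hK2.clm_apply (hasFDerivAt_const v y))).clm_apply
    (hasFDerivAt_const w y)
  have h3 := (hg1.clm_apply (hasFDerivAt_const v y)).clm_apply
    (hK2.clm_apply (hasFDerivAt_const w y))
  have h4 := (h1.add h2).add h3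
  have h5 := h4.unique ((hasFDerivAt_const (0 : ℝ) y).congr_of_eventuallyEq
    (hK.killing.mono fun z hz => hz v w))
  have h6 := congrArg (fun L => L u) h5
  simp at h6
  linarith

/-- A Killing field preserves the Levi-Civita connection. -/
theorem IsKillingNear.fderiv_christoffel (hg : IsMetricNear g y) (hK : IsKillingNear g K y)
    (u v : F) :
    fderiv ℝ (christoffel g) y (K y) u v = fderiv ℝ K y (christoffel g y u v)
      - christoffel g y (fderiv ℝ K y u) v - christoffel g y u (fderiv ℝ K y v)
      - fderiv ℝ (fderiv ℝ K) y u v := by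
  refine eq_of_pos hg.pos.self_of_nhds fun w => ?_
  have gs := hg.symm.self_of_nhds
  have cs := hg.christoffel_spec.self_of_nhds
  have kil := hK.killing.self_of_nhds
  have sg := (hg.contDiffAt.isSymmSndFDerivAt (by simp)).eq
  have sK := (hK.contDiffAt.isSymmSndFDerivAt (by simp)).eq
  -- After pairing with `w`, the derivative of the Koszul identity along `K` is compared with the
  -- differentiated Killing equations in the Koszul combination `E1 + E2 - E3`. The second
  -- derivatives of `g` cancel, and of those of `K` only `D²K(u, v)` survives.
  have N := hg.fderiv_christoffel (K y) u v w
  have E1 := hK.fderiv_killing hg u v w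
  have E2 := hK.fderiv_killing hg v u w
  have E3 := hK.fderiv_killing hg w u v
  rw [sg u (K y)] at E1
  rw [sg v (K y), sK v u] at E2
  rw [sg w (K y), sK w u, sK w v] at E3
  have k1 := kil (christoffel g y u v) w
  have c1 := cs (fderiv ℝ K y u) v w
  have c2 := cs u (fderiv ℝ K y v) w
  have c3 := cs u v (fderiv ℝ K y w)
  have g1 := gs v (fderiv ℝ (fderiv ℝ K) y u w)
  simp only [map_sub, sub_apply]
  linarith

/-- By the Koszul identity `g(Γ(v, K), w) + g(v, Γ(w, K)) = D_K g(v, w)`, so the assertion is the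
Killing equation. -/
theorem IsKillingNear.covDeriv_skew (hg : IsMetricNear g y) (hK : IsKillingNear g K y)
    (v w : F) : g y (covDeriv g K y v) w + g y v (covDeriv g K y w) = 0 := by
  have gs := hg.symm.self_of_nhds
  have cs := hg.christoffel_spec.self_of_nhds
  have kil := hK.killing.self_of_nhds v w
  rw [covDeriv_apply, covDeriv_apply, map_add, map_add, add_apply,
    gs v (christoffel g y w (K y)), cs, cs]
  have s1 := hg.fderiv_symm v (K y) w
  have s2 := hg.fderiv_symm w (K y) v
  have s3 := hg.fderiv_symm (K y) v w
  linarith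

/-- The curvature in terms of Killing fields. -/
theorem curvature_killing (hg : IsMetricNear g y) {L M : F → F} (hK : IsKillingNear g K y)
    (hL : IsKillingNear g L y)
    (hM : ∀ᶠ z in 𝓝 y, M z = fderiv ℝ L z (K z) - fderiv ℝ K z (L z)) (w : F) :
    curvature g y (L y) w (K y) = covDeriv g M y w
      + covDeriv g K y (covDeriv g L y w) - covDeriv g L y (covDeriv g K y w) := by
  have sK := (hK.contDiffAt.isSymmSndFDerivAt (by simp)).eq
  have sL := (hL.contDiffAt.isSymmSndFDerivAt (by simp)).eq
  have hK1 := hK.differentiableAt.hasFDerivAt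
  have hL1 := hL.differentiableAt.hasFDerivAt
  have h1 := ((hL.differentiableAt_fderiv.hasFDerivAt.clm_apply hK1).sub
    (hK.differentiableAt_fderiv.hasFDerivAt.clm_apply hL1)).congr_of_eventuallyEq hM
  have h2 : fderiv ℝ M y w = fderiv ℝ L y (fderiv ℝ K y w) + fderiv ℝ (fderiv ℝ L) y w (K y) -
      (fderiv ℝ K y (fderiv ℝ L y w) + fderiv ℝ (fderiv ℝ K) y w (L y)) := by
    rw [h1.fderiv]; simp
  -- The derivatives of the Christoffel symbol along `K` and `L` are replaced using the invariance
  -- of the connection. The remaining second derivatives of `K` and `L` are those in the derivative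
  -- of `M`.
  rw [curvature_apply, hK.fderiv_christoffel hg, hL.fderiv_christoffel hg]
  simp only [covDeriv_apply, map_add, h2, hM.self_of_nhds, map_sub]
  rw [sK (L y) w, sL (K y) w, hg.christoffel_symm (K y) w, hg.christoffel_symm (L y) w,
    hg.christoffel_symm (christoffel g y w (L y)) (K y),
    hg.christoffel_symm (christoffel g y w (K y)) (L y),
    hg.christoffel_symm (fderiv ℝ L y w) (K y),
    hg.christoffel_symm (fderiv ℝ K y w) (L y),
    hg.christoffel_symm (fderiv ℝ K y (L y)) w, hg.christoffel_symm (fderiv ℝ L y (K y)) w]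
  abel

end Curvature

/-! ### The Ricci curvature in structure constants -/

section RicciAlgebra
variable {F : Type*} [NormedAddCommGroup F] [NormedSpace ℝ F] [FiniteDimensional ℝ F]

/-- The basis `e` is orthonormal with respect to `g`. -/
def IsOrthonormalBasis {ι : Type*} [DecidableEq ι] (g : Form F) (e : Module.Basis ι ℝ F) : Prop :=
  ∀ i j, g (e i) (e j) = if i = j then 1 else 0

variable {ι : Type*} [Fintype ι] [DecidableEq ι] {g : Form F} {e : Module.Basis ι ℝ F}

theorem IsOrthonormalBasis.sum_apply (he : IsOrthonormalBasis g e) (v : F) :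
    ∑ i, g v (e i) • e i = v := by
  have h : ∀ i, g v (e i) = e.repr v i := by
    intro i
    have he' : ∀ i j, g (e i) (e j) = if i = j then 1 else 0 := he
    conv_lhs => rw [← e.sum_repr v]
    simp [-Module.Basis.sum_repr, he']
  simp_rw [h]
  exact e.sum_repr v

theorem IsOrthonormalBasis.trace (he : IsOrthonormalBasis g e) (f : F →ₗ[ℝ] F) :
    LinearMap.trace ℝ F f = ∑ i, g (f (e i)) (e i) := by
  have h : ∀ v i, g v (e i) = e.repr v i := by
    intro v i
    have he' : ∀ i j, g (e i) (e j) = if i = j then 1 else 0 := he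
    conv_lhs => rw [← e.sum_repr v]
    simp [-Module.Basis.sum_repr, he']
  rw [LinearMap.trace_eq_matrix_trace ℝ e, Matrix.trace]
  simp [LinearMap.toMatrix_apply, h]

theorem IsOrthonormalBasis.apply_eq_sum (he : IsOrthonormalBasis g e)
    (v w : F) : g v w = ∑ i, g v (e i) * g w (e i) := by
  conv_lhs => rw [← he.sum_apply w]
  simp [mul_comm]

/-- `s` identifies `F` with a complement, invariant under `ker p`, of `ker p` in the unimodular Lie
algebra `L`. -/
structure IsReductivePair {L : Type*} [LieRing L] [LieAlgebra ℝ L] (p : L →ₗ[ℝ] F)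
    (s : F →ₗ[ℝ] L) : Prop where
  p_s : ∀ v, p (s v) = v
  s_p_bracket : ∀ X, p X = 0 → ∀ v, s (p ⁅X, s v⁆) = ⁅X, s v⁆
  trace_ad : ∀ X, LinearMap.trace ℝ L (LieAlgebra.ad ℝ L X) = 0

variable {L : Type*} [LieRing L] [LieAlgebra ℝ L] [FiniteDimensional ℝ L] {p : L →ₗ[ℝ] F}
  {s : F →ₗ[ℝ] L}

/-- `⟨[x, y], z⟩` for the bracket of `F` as a complement of `ker p`. -/
def structureForm (g : Form F) (p : L →ₗ[ℝ] F) (s : F →ₗ[ℝ] L) (x y z : F) : ℝ :=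
  g (p ⁅s x, s y⁆) z

theorem structureForm_swap (x y z : F) :
    structureForm g p s x y z = - structureForm g p s y x z := by
  rw [structureForm, structureForm, ← lie_skew, map_neg, map_neg, neg_apply]

/-- The identity of `L` is `s ∘ p + q` with `q` idempotent, and each summand can be moved around
cyclically under the trace. -/
theorem trace_comp_of_range {q : L →ₗ[ℝ] L} (h : IsReductivePair p s)
    (hq : q = LinearMap.id - s ∘ₗ p) (f : L →ₗ[ℝ] L) :
    LinearMap.trace ℝ L f = LinearMap.trace ℝ F (p ∘ₗ f ∘ₗ s) +
      LinearMap.trace ℝ L (q ∘ₗ f ∘ₗ q) := by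
  have hqq : q ∘ₗ q = q := by
    rw [hq]; ext x; simp [h.p_s]
  have h1 : LinearMap.trace ℝ F (p ∘ₗ f ∘ₗ s) = LinearMap.trace ℝ L (f ∘ₗ (s ∘ₗ p)) := by
    rw [LinearMap.trace_comp_comm', LinearMap.comp_assoc]
  have h2 : LinearMap.trace ℝ L (q ∘ₗ f ∘ₗ q) = LinearMap.trace ℝ L (f ∘ₗ q) := by
    rw [LinearMap.trace_comp_comm', LinearMap.comp_assoc, hqq]
  rw [h1, h2, ← map_add, ← LinearMap.comp_add, hq]
  simp

/-- The complement is stable under brackets with `ker p`, so `[s x, q X]` lies in the range of `s`,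
where `q` vanishes. -/
theorem IsReductivePair.q_bracket {q : L →ₗ[ℝ] L} (h : IsReductivePair p s)
    (hq : q = LinearMap.id - s ∘ₗ p) (x : F) (X : L) : q ⁅s x, q X⁆ = 0 := by
  have h1 : p (q X) = 0 := by rw [hq]; simp [h.p_s]
  have h2 := h.s_p_bracket _ h1 x
  rw [← lie_skew, map_neg, neg_eq_zero]
  have h3 : ∀ Y, q Y = Y - s (p Y) := by intro Y; rw [hq]; rfl
  rw [h3 ⁅q X, s x⁆, h2, sub_self]

/-- The operators `A_X = ∇ K_X` of the Levi-Civita connection of an invariant metric. -/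
structure IsNomizuMap (g : Form F) (p : L →ₗ[ℝ] F) (A : L → F →ₗ[ℝ] F) : Prop where
  add : ∀ X Y v, A (X + Y) v = A X v + A Y v
  skew : ∀ X v w, g (A X v) w + g v (A X w) = 0
  torsion : ∀ X Y, A X (p Y) - A Y (p X) = p ⁅X, Y⁆

variable {A : L → F →ₗ[ℝ] F}

theorem IsNomizuMap.trace_eq_zero (hA : IsNomizuMap g p A) (he : IsOrthonormalBasis g e)
    (hs : ∀ u v, g u v = g v u) (X : L) : LinearMap.trace ℝ F (A X) = 0 := by
  rw [he.trace]
  refine Finset.sum_eq_zero fun i _ => ?_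
  have := hA.skew X (e i) (e i)
  rw [hs (e i)] at this
  linarith

theorem IsNomizuMap.apply_ker (h : IsReductivePair p s) (hA : IsNomizuMap g p A) {X : L}
    (hX : p X = 0) (v : F) : A X v = p ⁅X, s v⁆ := by
  have := hA.torsion X (s v)
  rwa [hX, map_zero, sub_zero, h.p_s] at this

/-- The usual uniqueness argument for the Levi-Civita connection: skewness and the torsion identity,
applied to the cyclic permutations of `x, y, z`, determine `A`. -/
theorem IsNomizuMap.koszul (h : IsReductivePair p s) (hA : IsNomizuMap g p A)
    (hs : ∀ u v, g u v = g v u) (x y z : F) :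
    2 * g (A (s x) y) z = structureForm g p s x y z - structureForm g p s y z x
      + structureForm g p s z x y := by
  have t : ∀ x y z, g (A (s x) y) z - g (A (s y) x) z = structureForm g p s x y z := by
    intro x y z
    have := hA.torsion (s x) (s y)
    rw [h.p_s, h.p_s] at this
    rw [structureForm, ← this, map_sub, sub_apply]
  have k : ∀ x y z, g (A (s x) y) z + g (A (s x) z) y = 0 := by
    intro x y z
    rw [← hA.skew (s x) y z, hs y]
  rw [← t, ← t, ← t]
  linarith [k x y z, k y z x, k z x y]

/-- By `q_bracket` the operator `ad (s x)` has zero block on `ker p`, so its trace is that of the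
block on `F`; the former vanishes by unimodularity. -/
theorem IsReductivePair.trace_bracket (h : IsReductivePair p s) (x : F) :
    LinearMap.trace ℝ F (p ∘ₗ LieAlgebra.ad ℝ L (s x) ∘ₗ s) = 0 := by
  have h1 := trace_comp_of_range h rfl (LieAlgebra.ad ℝ L (s x))
  rw [h.trace_ad] at h1
  have h2 : (LinearMap.id - s ∘ₗ p) ∘ₗ LieAlgebra.ad ℝ L (s x) ∘ₗ (LinearMap.id - s ∘ₗ p) = 0 := by
    ext X
    exact h.q_bracket rfl x X
  rw [h2, map_zero, add_zero] at h1
  exact h1.symm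

/-- By torsion and skewness the sum equals the trace of `ad (s z)` on `F`. This removes the
mean-curvature term from the Ricci formula. -/
theorem IsNomizuMap.sum_apply_self (h : IsReductivePair p s) (hA : IsNomizuMap g p A)
    (he : IsOrthonormalBasis g e) (hs : ∀ u v, g u v = g v u) (z : F) :
    ∑ i, g z (A (s (e i)) (e i)) = 0 := by
  rw [← h.trace_bracket z, he.trace]
  refine Finset.sum_congr rfl fun i _ => ?_
  have h1 := hA.torsion (s z) (s (e i))
  rw [h.p_s, h.p_s] at h1
  simp only [LinearMap.comp_apply, LieAlgebra.ad_apply]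
  rw [← h1, map_sub, sub_apply]
  have h2 := hA.skew (s z) (e i) (e i)
  rw [hs (e i)] at h2
  linarith [hA.skew (s (e i)) z (e i)]

/-- Extends `trace_bracket` beyond the range of `s`: the component of `X` in `ker p` acts on `F` by
a skew operator. -/
theorem IsNomizuMap.trace_bracket_bracket (h : IsReductivePair p s) (hA : IsNomizuMap g p A)
    (he : IsOrthonormalBasis g e) (hs : ∀ u v, g u v = g v u) (X : L) :
    LinearMap.trace ℝ F (p ∘ₗ LieAlgebra.ad ℝ L X ∘ₗ s) = 0 := by
  have h0 : p (X - s (p X)) = 0 := by rw [map_sub, h.p_s, sub_self]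
  have h1 : p ∘ₗ LieAlgebra.ad ℝ L X ∘ₗ s =
      p ∘ₗ LieAlgebra.ad ℝ L (s (p X)) ∘ₗ s + A (X - s (p X)) := by
    ext v
    rw [LinearMap.add_apply, hA.apply_ker h h0]
    simp
  rw [h1, map_add, h.trace_bracket, hA.trace_eq_zero he hs, add_zero]

/-- The trace of `ad (s v) ad (s w)` is split along `L = s(F) ⊕ ker p`. A path that starts and ends
in `ker p` has to pass through `s(F)` by `q_bracket`. The two kinds of mixed paths have equal traces
because `ad [s v, s w]` has trace zero on `F`, whence the factor `2`. -/
theorem IsNomizuMap.killing (h : IsReductivePair p s) (hA : IsNomizuMap g p A)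
    (he : IsOrthonormalBasis g e) (hs : ∀ u v, g u v = g v u) {q : L →ₗ[ℝ] L}
    (hq : q = LinearMap.id - s ∘ₗ p) (v w : F) :
    killingForm ℝ L (s v) (s w) =
      LinearMap.trace ℝ F ((p ∘ₗ LieAlgebra.ad ℝ L (s v) ∘ₗ s) ∘ₗ
        (p ∘ₗ LieAlgebra.ad ℝ L (s w) ∘ₗ s)) +
      2 * LinearMap.trace ℝ F (p ∘ₗ LieAlgebra.ad ℝ L (s w) ∘ₗ q ∘ₗ
        LieAlgebra.ad ℝ L (s v) ∘ₗ s) := by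
  set a := LieAlgebra.ad ℝ L (s v) with ha
  set b := LieAlgebra.ad ℝ L (s w) with hb
  have hid : ∀ X, X = s (p X) + q X := by intro X; rw [hq]; simp
  have e1 : ∀ f k : L →ₗ[ℝ] L, p ∘ₗ (f ∘ₗ k) ∘ₗ s =
      (p ∘ₗ f ∘ₗ s) ∘ₗ (p ∘ₗ k ∘ₗ s) + p ∘ₗ f ∘ₗ q ∘ₗ k ∘ₗ s := by
    intro f k
    ext X
    simp only [LinearMap.comp_apply, LinearMap.add_apply]
    rw [← map_add, ← map_add, ← hid]
  have e2 : q ∘ₗ (a ∘ₗ b) ∘ₗ q = q ∘ₗ a ∘ₗ s ∘ₗ p ∘ₗ b ∘ₗ q := by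
    ext X
    simp only [LinearMap.comp_apply]
    conv_lhs => rw [hid (b (q X))]
    rw [show q (b (q X)) = 0 from h.q_bracket hq w X, add_zero]
  have hpq : ∀ X, p (q X) = 0 := by intro X; rw [hq]; simp [h.p_s]
  have hqq : ∀ X, q (q X) = q X := by
    intro X
    have := hid (q X)
    rw [hpq, map_zero, zero_add] at this
    exact this.symm
  have e3 : LinearMap.trace ℝ L (q ∘ₗ a ∘ₗ s ∘ₗ p ∘ₗ b ∘ₗ q) =
      LinearMap.trace ℝ F (p ∘ₗ b ∘ₗ q ∘ₗ a ∘ₗ s) := by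
    rw [show q ∘ₗ a ∘ₗ s ∘ₗ p ∘ₗ b ∘ₗ q = (q ∘ₗ a ∘ₗ s) ∘ₗ (p ∘ₗ b ∘ₗ q) by
      simp only [LinearMap.comp_assoc], LinearMap.trace_comp_comm']
    congr 1
    ext X
    simp [hqq]
  have e4 : LinearMap.trace ℝ F (p ∘ₗ a ∘ₗ q ∘ₗ b ∘ₗ s) =
      LinearMap.trace ℝ F (p ∘ₗ b ∘ₗ q ∘ₗ a ∘ₗ s) := by
    have h1 := hA.trace_bracket_bracket h he hs ⁅s v, s w⁆
    have h2 : LieAlgebra.ad ℝ L ⁅s v, s w⁆ = a ∘ₗ b - b ∘ₗ a := by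
      ext Z; simp [ha, hb]
    rw [h2, LinearMap.sub_comp, LinearMap.comp_sub, map_sub, e1, e1, map_add, map_add,
      LinearMap.trace_comp_comm'] at h1
    linarith
  rw [killingForm_apply_apply, trace_comp_of_range h hq, e1, map_add, e2, e3, e4]
  ring

/-- The Ricci curvature of an invariant metric. -/
theorem IsNomizuMap.ricci (h : IsReductivePair p s) (hA : IsNomizuMap g p A)
    (he : IsOrthonormalBasis g e) (hs : ∀ u v, g u v = g v u) (v w : F) {R : F →ₗ[ℝ] F}
    (hR : ∀ u, R u = A (s u) (A (s v) w) - A (s v) (A (s u) w) - A ⁅s u, s v⁆ w) :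
    LinearMap.trace ℝ F R =
      4⁻¹ * ∑ i, ∑ k, structureForm g p s (e i) (e k) v * structureForm g p s (e i) (e k) w
      - 2⁻¹ * ∑ i, ∑ k, structureForm g p s v (e i) (e k) * structureForm g p s w (e i) (e k)
      - 2⁻¹ * killingForm ℝ L (s v) (s w) := by
  set q : L →ₗ[ℝ] L := LinearMap.id - s ∘ₗ p with hq
  have hpq : ∀ X, p (q X) = 0 := by intro X; simp [hq, h.p_s]
  have hid : ∀ X, X = s (p X) + q X := by intro X; simp [hq]
  set c := structureForm g p s with hc
  -- Skewness moves one factor `A` to the other side, and `[e_i, v]` is split into its components in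
  -- the complement and in `ker p`; on the latter `A` is a bracket.
  have t1 : ∀ i, g (R (e i)) (e i) = - g (A (s v) w) (A (s (e i)) (e i))
      + g (A (s (e i)) w) (A (s v) (e i)) + g w (A (s (p ⁅s (e i), s v⁆)) (e i))
      + g (p ⁅s w, q ⁅s (e i), s v⁆⁆) (e i) := by
    intro i
    rw [hR, map_sub, map_sub, sub_apply, sub_apply]
    conv_lhs => rw [hid ⁅s (e i), s v⁆]
    rw [hA.add, map_add, add_apply, hA.apply_ker h (hpq _), ← lie_skew (s w), map_neg,
      map_neg, neg_apply]
    linarith [hA.skew (s (e i)) (A (s v) w) (e i), hA.skew (s v) (A (s (e i)) w) (e i),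
      hA.skew (s (p ⁅s (e i), s v⁆)) w (e i)]
  have t2 : ∀ i, g w (A (s (p ⁅s (e i), s v⁆)) (e i)) =
      ∑ k, c (e i) v (e k) * g (A (s (e k)) (e i)) w := by
    intro i
    -- Homogeneity of `A` in its first argument is not part of the structure. The torsion identity
    -- moves the vector to be expanded into places where linearity is available.
    have h1 : A (s (p ⁅s (e i), s v⁆)) (e i) = A (s (e i)) (p ⁅s (e i), s v⁆) +
        p ⁅s (p ⁅s (e i), s v⁆), s (e i)⁆ := by
      have := hA.torsion (s (p ⁅s (e i), s v⁆)) (s (e i))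
      rw [h.p_s, h.p_s] at this
      rw [← this]; abel
    have h2 : ∀ k, A (s (e k)) (e i) = A (s (e i)) (e k) + p ⁅s (e k), s (e i)⁆ := by
      intro k
      have := hA.torsion (s (e k)) (s (e i))
      rw [h.p_s, h.p_s] at this
      rw [← this]; abel
    rw [h1]
    simp_rw [h2]
    set u := p ⁅s (e i), s v⁆
    have h3 : g (A (s (e i)) u + p ⁅s u, s (e i)⁆) w =
        ∑ k, g u (e k) * g (A (s (e i)) (e k) + p ⁅s (e k), s (e i)⁆) w := by
      conv_lhs => rw [← he.sum_apply u]
      simp [map_sum, sum_lie, Finset.sum_add_distrib, mul_add]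
    rw [hs w, h3]
    rfl
  have t3 : ∀ i, g (A (s (e i)) w) (A (s v) (e i)) =
      ∑ k, g (A (s (e i)) w) (e k) * g (A (s v) (e i)) (e k) := fun i => he.apply_eq_sum _ _
  have T0 := hA.sum_apply_self h he hs (A (s v) w)
  have T4 := hA.killing h he hs hq v w
  have T5 : ∑ i, g (p ⁅s w, q ⁅s (e i), s v⁆⁆) (e i) =
      - LinearMap.trace ℝ F (p ∘ₗ LieAlgebra.ad ℝ L (s w) ∘ₗ q ∘ₗ
        LieAlgebra.ad ℝ L (s v) ∘ₗ s) := by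
    rw [he.trace, ← Finset.sum_neg_distrib]
    refine Finset.sum_congr rfl fun i _ => ?_
    simp only [LinearMap.comp_apply, LieAlgebra.ad_apply]
    rw [← lie_skew (s (e i)), map_neg, lie_neg, map_neg, map_neg, neg_apply]
  have T6 : LinearMap.trace ℝ F ((p ∘ₗ LieAlgebra.ad ℝ L (s v) ∘ₗ s) ∘ₗ
        (p ∘ₗ LieAlgebra.ad ℝ L (s w) ∘ₗ s)) = ∑ i, ∑ k, c v (e k) (e i) * c w (e i) (e k) := by
    rw [he.trace]
    refine Finset.sum_congr rfl fun i _ => ?_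
    simp only [LinearMap.comp_apply, LieAlgebra.ad_apply]
    have h3 : ∀ u, g (p ⁅s v, s u⁆) (e i) = ∑ k, g u (e k) * g (p ⁅s v, s (e k)⁆) (e i) := by
      intro u
      conv_lhs => rw [← he.sum_apply u]
      simp [map_sum, lie_sum]
    rw [h3]
    exact Finset.sum_congr rfl fun k _ => mul_comm _ _
  rw [he.trace, Finset.sum_congr rfl fun i _ => t1 i, Finset.sum_add_distrib,
    Finset.sum_add_distrib, Finset.sum_add_distrib, Finset.sum_neg_distrib, T0, T5,
    Finset.sum_congr rfl fun i _ => t2 i, Finset.sum_congr rfl fun i _ => t3 i, T4, T6]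
  -- From here on everything is expressed by structure constants; the mixed trace in `T5` has been
  -- traded for the Killing form by `T4`.
  have K := hA.koszul h hs
  have K1 : ∀ i k, g (A (s (e i)) w) (e k) = 2⁻¹ * (- c w (e i) (e k) - c w (e k) (e i)
      - c (e i) (e k) w) := by
    intro i k
    have := K (e i) w (e k)
    rw [structureForm_swap (e i) w, structureForm_swap (e k) (e i)] at this
    linarith
  have K2 : ∀ i k, g (A (s v) (e i)) (e k) = 2⁻¹ * (c v (e i) (e k) - c (e i) (e k) v
      - c v (e k) (e i)) := by
    intro i k
    have := K v (e i) (e k)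
    rw [structureForm_swap (e k) v] at this
    linarith
  have K3 : ∀ i k, c (e i) v (e k) * g (A (s (e k)) (e i)) w = - c v (e i) (e k) * (2⁻¹ *
      (- c (e i) (e k) w + c w (e i) (e k) + c w (e k) (e i))) := by
    intro i k
    have := K (e k) (e i) w
    rw [structureForm_swap (e i) w, structureForm_swap (e k) (e i)] at this
    rw [hc, structureForm_swap (e i) v]
    congr 1
    linarith
  simp_rw [K1, K2, K3]
  -- The two double sums agree only after symmetrization in the summation indices, not term by term.
  have sw : ∀ f : ι → ι → ℝ, ∑ i, ∑ k, f i k = ∑ i, ∑ k, (2⁻¹ * (f i k + f k i)) := by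
    intro f
    have h1 : ∑ i, ∑ k, f k i = ∑ i, ∑ k, f i k := Finset.sum_comm
    simp_rw [← Finset.mul_sum, Finset.sum_add_distrib]
    rw [h1]; ring
  have fin : ∑ i, ∑ k, (2⁻¹ * (-c w (e i) (e k) - c w (e k) (e i) - c (e i) (e k) w) *
        (2⁻¹ * (c v (e i) (e k) - c (e i) (e k) v - c v (e k) (e i)))) +
      ∑ i, ∑ k, (-c v (e i) (e k) * (2⁻¹ *
        (-c (e i) (e k) w + c w (e i) (e k) + c w (e k) (e i)))) =
      4⁻¹ * ∑ i, ∑ k, c (e i) (e k) v * c (e i) (e k) w -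
      2⁻¹ * ∑ i, ∑ k, c v (e i) (e k) * c w (e i) (e k) -
      2⁻¹ * ∑ i, ∑ k, c v (e k) (e i) * c w (e i) (e k) := by
    conv_rhs => simp only [Finset.mul_sum]
    rw [← Finset.sum_add_distrib, ← Finset.sum_sub_distrib, ← Finset.sum_sub_distrib]
    simp_rw [← Finset.sum_add_distrib, ← Finset.sum_sub_distrib]
    rw [sw]
    conv_rhs => rw [sw]
    refine Finset.sum_congr rfl fun i _ => Finset.sum_congr rfl fun k _ => ?_
    rw [hc, structureForm_swap (e k) (e i) v, structureForm_swap (e k) (e i) w]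
    ring
  linarith

end RicciAlgebra

/-! ### The isotropy algebra acts on `H`-invariant subspaces -/

section Isotropy
variable {E : Type*} [NormedAddCommGroup E] [NormedSpace ℝ E] [CompleteSpace E]
  {F : Type*} [NormedAddCommGroup F] [InnerProductSpace ℝ F]
  {G : Type*} [TopologicalSpace G] [Group G] [ChartedSpace E G] [LieGroup 𝓘(ℝ, E) ∞ G]
  (H : Subgroup G) [ChartedSpace F (G ⧸ H)] [IsManifold 𝓘(ℝ, F) ∞ (G ⧸ H)]

theorem exists_smooth_section
    (hπ : Manifold.IsSubmersion 𝓘(ℝ, E) 𝓘(ℝ, F) ∞ (fun a : G => (a : G ⧸ H))) :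
    ∃ σ : G ⧸ H → G, σ (base H) = 1 ∧
      ContDiffAt ℝ ∞ (fun y => extChartAt 𝓘(ℝ, E) (1 : G)
        (σ ((extChartAt 𝓘(ℝ, F) (base H)).symm y))) (baseCoord F H) ∧
      ContDiffAt ℝ ∞ (fun y => extChartAt 𝓘(ℝ, E) (1 : G)
        (σ ((extChartAt 𝓘(ℝ, F) (base H)).symm y))⁻¹) (baseCoord F H) ∧
      (∀ᶠ y in 𝓝 (baseCoord F H), σ ((extChartAt 𝓘(ℝ, F) (base H)).symm y) ∈
        (extChartAt 𝓘(ℝ, E) (1 : G)).source) ∧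
      (∀ᶠ y in 𝓝 (baseCoord F H), (σ ((extChartAt 𝓘(ℝ, F) (base H)).symm y))⁻¹ ∈
        (extChartAt 𝓘(ℝ, E) (1 : G)).source) ∧
      ∀ᶠ y in 𝓝 (baseCoord F H), (σ ((extChartAt 𝓘(ℝ, F) (base H)).symm y) : G ⧸ H) =
        (extChartAt 𝓘(ℝ, F) (base H)).symm y := by
  obtain ⟨σ, h1, h2, h3⟩ := exists_local_section (hπ.isSubmersionAt (1 : G))
  have hs : ContMDiffAt 𝓘(ℝ, F) 𝓘(ℝ, F) ∞ (extChartAt 𝓘(ℝ, F) (base H)).symm (baseCoord F H) :=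
    (contMDiffOn_extChartAt_symm (base H)).contMDiffAt
      ((isOpen_extChartAt_target (base H)).mem_nhds (baseCoord_mem F H))
  have hb := symm_baseCoord F H
  change ContMDiffAt 𝓘(ℝ, F) 𝓘(ℝ, E) ∞ σ (base H) at h2
  change ∀ᶠ q in 𝓝 (base H), _ at h3
  rw [← hb] at h2 h3
  have hσ := h2.comp (baseCoord F H) hs
  have hσi : ContMDiffAt 𝓘(ℝ, F) 𝓘(ℝ, E) ∞
      (fun y => (σ ((extChartAt 𝓘(ℝ, F) (base H)).symm y))⁻¹) (baseCoord F H) := hσ.inv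
  have hv : σ ((extChartAt 𝓘(ℝ, F) (base H)).symm (baseCoord F H)) = 1 := by rw [hb]; exact h1
  refine ⟨σ, h1, ?_, ?_, ?_, ?_, hs.continuousAt.eventually h3⟩
  · rw [← contMDiffAt_iff_contDiffAt]
    refine ContMDiffAt.comp (baseCoord F H) ?_ hσ
    rw [hv]; exact contMDiffAt_extChartAt
  · rw [← contMDiffAt_iff_contDiffAt]
    refine ContMDiffAt.comp (baseCoord F H) ?_ hσi
    rw [hv, inv_one]; exact contMDiffAt_extChartAt
  · refine hσ.continuousAt.eventually_mem ((isOpen_extChartAt_source _).mem_nhds ?_)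
    simp only [Function.comp]
    rw [hv]; exact mem_extChartAt_source _
  · refine hσi.continuousAt.eventually_mem ((isOpen_extChartAt_source _).mem_nhds ?_)
    rw [hv, inv_one]; exact mem_extChartAt_source _

theorem proj_surjective
    (hπ : Manifold.IsSubmersion 𝓘(ℝ, E) 𝓘(ℝ, F) ∞ (fun a : G => (a : G ⧸ H))) :
    Function.Surjective (proj E F H) := by
  obtain ⟨σ, h1, h2, -, h3, -, h4⟩ := exists_smooth_section (E := E) (F := F) H hπ
  have e0 : extChartAt 𝓘(ℝ, E) (1 : G) (σ ((extChartAt 𝓘(ℝ, F) (base H)).symm (baseCoord F H))) =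
      unitCoord E G := by
    rw [symm_baseCoord, h1]
  have hp := hasFDerivAt_projChart H hπ
  rw [← e0] at hp
  have e1 := hp.comp (baseCoord F H) (h2.differentiableAt (by simp)).hasFDerivAt
  have e2 := e1.unique ((hasFDerivAt_id (baseCoord F H)).congr_of_eventuallyEq (by
    filter_upwards [h3, h4, (isOpen_extChartAt_target (base H)).mem_nhds (baseCoord_mem F H)]
      with y a b c
    simp only [Function.comp, (extChartAt 𝓘(ℝ, E) (1 : G)).left_inv a, b,
      (extChartAt 𝓘(ℝ, F) (base H)).right_inv c, id]))
  intro v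
  exact ⟨_, congrArg (fun L => L v) e2⟩

/-- Subspaces invariant under `H` are invariant under the Lie algebra of `H`. -/
theorem chartBracket_mem [FiniteDimensional ℝ E]
    (hπ : Manifold.IsSubmersion 𝓘(ℝ, E) 𝓘(ℝ, F) ∞ (fun a : G => (a : G ⧸ H)))
    (m : Submodule ℝ E) (hm : ∀ h ∈ H, ∀ Y ∈ m, adj E (h : G) Y ∈ m) {X Y : E}
    (hX : proj E F H X = 0) (hY : Y ∈ m) : chartBracket G X Y ∈ m := by
  obtain ⟨σ, h1, -, h2, -, h3, h4⟩ := exists_smooth_section (E := E) (F := F) H hπ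
  -- The map `s ↦ σ(sH)⁻¹ s` takes values in `H`, and its derivative at the unit fixes every `X`
  -- with `proj X = 0`. Along it `Ad` keeps `Y` in `m`, so `[X, Y]` is a limit of difference
  -- quotients in `m`.
  set P : E → F := fun s => extChartAt 𝓘(ℝ, F) (base H)
      ((extChartAt 𝓘(ℝ, E) (1 : G)).symm s : G ⧸ H) with hP
  have hPd : HasFDerivAt P (proj E F H) (unitCoord E G) := hasFDerivAt_projChart H hπ
  have hP0 : P (unitCoord E G) = baseCoord F H := by
    simp only [hP]
    rw [symm_unitCoord]
  set j : F → E := fun y => extChartAt 𝓘(ℝ, E) (1 : G)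
    (σ ((extChartAt 𝓘(ℝ, F) (base H)).symm y))⁻¹ with hj
  have hj0 : j (baseCoord F H) = unitCoord E G := by
    simp only [hj]
    rw [symm_baseCoord, h1, inv_one]
  have hjd : HasFDerivAt j (fderiv ℝ j (baseCoord F H)) (P (unitCoord E G)) := by
    rw [hP0]; exact (h2.differentiableAt (by simp)).hasFDerivAt
  have hjP := hjd.comp (unitCoord E G) hPd
  set μ := actChart (E := E) (F := E) (1 : G) (1 : G) (1 : G) with hμ
  have hμd : DifferentiableAt ℝ μ (unitCoord E G, unitCoord E G) :=
    eventually_contDiffAt_mulChart.self_of_nhds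
  have hμd' : HasFDerivAt μ (fderiv ℝ μ (unitCoord E G, unitCoord E G))
      ((j ∘ P) (unitCoord E G), id (unitCoord E G)) := by
    simp only [Function.comp, hP0, hj0, id]; exact hμd.hasFDerivAt
  have hr := HasFDerivAt.comp (f := fun s => ((j ∘ P) s, id s)) (unitCoord E G) hμd'
    (hjP.prodMk (hasFDerivAt_id (unitCoord E G)))
  have hμX : fderiv ℝ μ (unitCoord E G, unitCoord E G) (0, X) = X := by
    have e1 := HasFDerivAt.comp (f := fun s => (unitCoord E G, s)) (unitCoord E G)
      hμd.hasFDerivAt (hasFDerivAt_prodMk_right (unitCoord E G) (unitCoord E G))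
    have e2 := e1.unique ((hasFDerivAt_id (unitCoord E G)).congr_of_eventuallyEq
      (actChart_self_unit_left (E := E) (G := G)))
    simpa using congrArg (fun L => L X) e2
  obtain ⟨L, hL, hd⟩ := hasFDerivAt_adj (G := G) Y
  have hr0 : μ ((j ∘ P) (unitCoord E G), id (unitCoord E G)) = unitCoord E G := by
    simp only [Function.comp, hP0, hj0, id]
    exact (actChart_self_unit_left (E := E) (G := G)).self_of_nhds
  rw [← hr0] at hd
  have hfin := HasFDerivAt.comp (f := fun s => μ ((j ∘ P) s, id s)) (unitCoord E G) hd hr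
  set ρ : E → E := fun s => adj E ((extChartAt 𝓘(ℝ, E) (1 : G)).symm (μ ((j ∘ P) s, id s))) Y
  have hcont : ContinuousAt (fun s => ((extChartAt 𝓘(ℝ, E) (1 : G)).symm s : G ⧸ H))
      (unitCoord E G) :=
    hπ.contMDiff.continuous.continuousAt.comp (continuousAt_extChartAt_symm 1)
  have hsrc : ∀ᶠ s in 𝓝 (unitCoord E G), ((extChartAt 𝓘(ℝ, E) (1 : G)).symm s : G ⧸ H) ∈
      (extChartAt 𝓘(ℝ, F) (base H)).source := by
    refine hcont.eventually_mem ((isOpen_extChartAt_source _).mem_nhds ?_)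
    rw [symm_unitCoord]; exact mem_extChartAt_source _
  have : ContinuousMul G := continuousMul_of_contMDiffMul 𝓘(ℝ, E) ∞
  have hPc : ContinuousAt P (unitCoord E G) := hPd.continuousAt
  have h3' := hPc.eventually (p := fun y => (σ ((extChartAt 𝓘(ℝ, F) (base H)).symm y))⁻¹ ∈
        (extChartAt 𝓘(ℝ, E) (1 : G)).source) (by rw [hP0]; exact h3)
  have h4' := hPc.eventually (p := fun y => (σ ((extChartAt 𝓘(ℝ, F) (base H)).symm y) : G ⧸ H) =
        (extChartAt 𝓘(ℝ, F) (base H)).symm y) (by rw [hP0]; exact h4)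
  have hcm : ∀ᶠ s in 𝓝 (unitCoord E G), (extChartAt 𝓘(ℝ, E) (1 : G)).symm (j (P s)) *
      (extChartAt 𝓘(ℝ, E) (1 : G)).symm s ∈ (extChartAt 𝓘(ℝ, E) (1 : G)).source := by
    have c1 : ContinuousAt (fun s => (extChartAt 𝓘(ℝ, E) (1 : G)).symm (j (P s)))
        (unitCoord E G) := by
      refine ContinuousAt.comp (g := (extChartAt 𝓘(ℝ, E) (1 : G)).symm) ?_ hjP.continuousAt
      simp only [hP0, hj0]
      exact continuousAt_extChartAt_symm 1
    have c2 := c1.mul (continuousAt_extChartAt_symm (I := 𝓘(ℝ, E)) (1 : G))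
    refine c2.eventually_mem ((isOpen_extChartAt_source _).mem_nhds ?_)
    change (extChartAt 𝓘(ℝ, E) (1 : G)).symm (j (P (unitCoord E G))) *
      (extChartAt 𝓘(ℝ, E) (1 : G)).symm (unitCoord E G) ∈ _
    rw [hP0, hj0, symm_unitCoord, one_mul]
    exact mem_extChartAt_source _
  have hmem : ∀ᶠ s in 𝓝 (unitCoord E G), ρ s ∈ m := by
    filter_upwards [hsrc, h3', h4', hcm] with s a b c e
    refine hm _ ?_ Y hY
    simp only [hμ, actChart, smul_eq_mul, Function.comp, id]
    rw [(extChartAt 𝓘(ℝ, E) (1 : G)).left_inv e]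
    simp only [hj]
    rw [(extChartAt 𝓘(ℝ, E) (1 : G)).left_inv b]
    rw [← QuotientGroup.eq, c]
    exact (extChartAt 𝓘(ℝ, F) (base H)).left_inv a
  have hclosed : IsClosed (m : Set E) := m.closed_of_finiteDimensional
  have hval : (L ∘L (fderiv ℝ μ (unitCoord E G, unitCoord E G) ∘L
      ((fderiv ℝ j (baseCoord F H) ∘L proj E F H).prod (ContinuousLinearMap.id ℝ E)))) X =
      chartBracket G X Y := by
    simp only [ContinuousLinearMap.comp_apply, ContinuousLinearMap.prod_apply, hX, map_zero,
      ContinuousLinearMap.id_apply]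
    rw [hμX, hL]
  rw [← hval]
  -- difference quotients stay in the subspace
  have hline : HasDerivAt (fun t : ℝ => ρ (unitCoord E G + t • X)) _ 0 :=
    HasFDerivAt.hasLineDerivAt hfin X
  have hlim := hline.tendsto_slope_zero
  have hc2 : ContinuousAt (fun t : ℝ => unitCoord E G + t • X) 0 := by fun_prop
  refine hclosed.mem_of_tendsto hlim ?_
  have hev := (hc2.eventually (p := fun s => ρ s ∈ m) (by simpa using hmem))
  filter_upwards [hev.filter_mono nhdsWithin_le_nhds] with t ht
  refine m.smul_mem _ (m.sub_mem ?_ ?_)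
  · simpa using ht
  · simpa using hmem.self_of_nhds

end Isotropy

/-! ### The covariant derivatives of the fundamental fields at the base point -/

section Nomizu
variable {E : Type*} [NormedAddCommGroup E] [NormedSpace ℝ E] [CompleteSpace E]
  {F : Type*} [NormedAddCommGroup F] [InnerProductSpace ℝ F] [FiniteDimensional ℝ F]
  {G : Type*} [TopologicalSpace G] [Group G] [ChartedSpace E G] [LieGroup 𝓘(ℝ, E) ∞ G]
  (H : Subgroup G) [ChartedSpace F (G ⧸ H)] [IsManifold 𝓘(ℝ, F) ∞ (G ⧸ H)]
  [ContMDiffSMul 𝓘(ℝ, E) 𝓘(ℝ, F) ∞ G (G ⧸ H)] [SmoothTranslations F G (G ⧸ H)]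

theorem contDiffAt_fundamentalField (c : G ⧸ H) {y : F}
    (hy : y ∈ (extChartAt 𝓘(ℝ, F) c).target) (X : E) :
    ContDiffAt ℝ ∞ (fundamentalField G c X) y := by
  have h1 : ContDiffAt ℝ ∞ (fderiv ℝ (actChart (1 : G) c c)) (unitCoord E G, y) :=
    (contDiffAt_actChart_unit c hy).fderiv_right (m := ∞) (by simp)
  have h2 : ContDiffAt ℝ ∞ (fun z : F => (unitCoord E G, z)) y := by fun_prop
  have h3 : ContDiffAt ℝ ∞ (fun z => fderiv ℝ (actChart (1 : G) c c) (unitCoord E G, z)) y :=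
    ContDiffAt.comp (f := fun z : F => (unitCoord E G, z)) y h1 h2
  exact h3.clm_apply contDiffAt_const

theorem isMetricNear_chartMetric
    (hπ : Manifold.IsSubmersion 𝓘(ℝ, E) 𝓘(ℝ, F) ∞ (fun a : G => (a : G ⧸ H)))
    {g : Form F} (hg : g ∈ invariantMetrics F H) (c : G ⧸ H) {y : F}
    (hy : y ∈ (extChartAt 𝓘(ℝ, F) c).target) : IsMetricNear (chartMetric H g c) y where
  contDiffAt := (contDiffAt_chartMetric H E hπ hg c hy).of_le ENat.LEInfty.out
  symm := by
    filter_upwards [(isOpen_extChartAt_target c).mem_nhds hy] with z hz u v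
    exact chartMetric_symm H hg c hz u v
  pos := by
    filter_upwards [(isOpen_extChartAt_target c).mem_nhds hy] with z hz v hv
    exact chartMetric_pos H hg c hz hv

theorem isKillingNear_fundamentalField
    (hπ : Manifold.IsSubmersion 𝓘(ℝ, E) 𝓘(ℝ, F) ∞ (fun a : G => (a : G ⧸ H)))
    {g : Form F} (hg : g ∈ invariantMetrics F H) (c : G ⧸ H) {y : F}
    (hy : y ∈ (extChartAt 𝓘(ℝ, F) c).target) (X : E) :
    IsKillingNear (chartMetric H g c) (fundamentalField G c X) y where
  contDiffAt := (contDiffAt_fundamentalField H c hy X).of_le ENat.LEInfty.out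
  killing := by
    filter_upwards [(isOpen_extChartAt_target c).mem_nhds hy] with z hz v w
    exact chartMetric_killing H hπ hg c hz X v w

/-- The covariant derivative at the base point of the Killing field of `X`. -/
def nomizu (g : Form F) (X : E) : F →L[ℝ] F :=
  covDeriv (chartMetric H g (base H)) (fundamentalField G (base H) X) (baseCoord F H)

theorem nomizu_add (g : Form F) (X Y : E) :
    nomizu H g (X + Y) = nomizu H g X + nomizu H g Y := by
  have h : fundamentalField G (base H) (X + Y) =
      fundamentalField G (base H) X + fundamentalField (F := F) G (base H) Y := by
    ext y
    rw [Pi.add_apply]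
    simp only [fundamentalField]
    rw [← map_add, Prod.mk_add_mk, add_zero]
  have d : ∀ X : E, DifferentiableAt ℝ (fundamentalField (F := F) G (base H) X)
    (baseCoord F H) := fun X =>
      (contDiffAt_fundamentalField H (base H) (baseCoord_mem F H) X).differentiableAt (by simp)
  ext v
  simp only [nomizu, covDeriv_apply, h, add_apply]
  rw [fderiv_add (d X) (d Y), Pi.add_apply, map_add, add_apply]
  abel

theorem nomizu_neg (g : Form F) (X : E) : nomizu H g (-X) = - nomizu H g X := by
  have h0 : nomizu H g (0 : E) = 0 := by
    have := nomizu_add H g (0 : E) 0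
    rwa [add_zero, left_eq_add] at this
  have h1 := nomizu_add H g X (-X)
  rw [add_neg_cancel, h0] at h1
  exact (neg_eq_of_add_eq_zero_right h1.symm).symm

theorem nomizu_skew (hπ : Manifold.IsSubmersion 𝓘(ℝ, E) 𝓘(ℝ, F) ∞ (fun a : G => (a : G ⧸ H)))
    {g : Form F} (hg : g ∈ invariantMetrics F H) (X : E) (v w : F) :
    g (nomizu H g X v) w + g v (nomizu H g X w) = 0 := by
  have h := (isKillingNear_fundamentalField H hπ hg (base H) (baseCoord_mem F H) X).covDeriv_skew
    (isMetricNear_chartMetric H hπ hg (base H) (baseCoord_mem F H)) v w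
  rw [chartMetric_baseCoord H hg] at h
  exact h

/-- The Levi-Civita connection has no torsion: the Christoffel terms cancel by symmetry and the
bracket of the fundamental fields remains. -/
theorem nomizu_torsion
    (hπ : Manifold.IsSubmersion 𝓘(ℝ, E) 𝓘(ℝ, F) ∞ (fun a : G => (a : G ⧸ H)))
    {g : Form F} (hg : g ∈ invariantMetrics F H) (X Y : E) :
    nomizu H g X (proj E F H Y) - nomizu H g Y (proj E F H X) =
      proj E F H (chartBracket G X Y) := by
  have hm := isMetricNear_chartMetric H hπ hg (base H) (baseCoord_mem F H)
  rw [← fundamentalField_base H hπ (chartBracket G X Y),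
    fundamentalField_bracket (base H) (baseCoord_mem F H), nomizu, nomizu, covDeriv_apply,
    covDeriv_apply, ← fundamentalField_base H hπ, ← fundamentalField_base H hπ,
    hm.christoffel_symm]
  abel

theorem chartBracket_swap [FiniteDimensional ℝ E] (X Y : E) :
    chartBracket G X Y = - chartBracket G Y X := by
  rw [chartBracket, chartBracket]
  abel

/-- An instance of `curvature_killing`. Since `X ↦ X*` reverses brackets, the field `M` there is the
fundamental field of `[Y, X]`. -/
theorem curvature_nomizu [FiniteDimensional ℝ E]
    (hπ : Manifold.IsSubmersion 𝓘(ℝ, E) 𝓘(ℝ, F) ∞ (fun a : G => (a : G ⧸ H)))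
    {g : Form F} (hg : g ∈ invariantMetrics F H) (X Y : E) (w : F) :
    curvature (chartMetric H g (base H)) (baseCoord F H) (proj E F H Y) w (proj E F H X) =
      nomizu H g X (nomizu H g Y w) - nomizu H g Y (nomizu H g X w)
        - nomizu H g (chartBracket G X Y) w := by
  have hm := isMetricNear_chartMetric H hπ hg (base H) (baseCoord_mem F H)
  have h := curvature_killing hm
    (isKillingNear_fundamentalField H hπ hg (base H) (baseCoord_mem F H) X)
    (isKillingNear_fundamentalField H hπ hg (base H) (baseCoord_mem F H) Y)
    (M := fundamentalField G (base H) (chartBracket G Y X)) (by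
      filter_upwards [(isOpen_extChartAt_target (base H)).mem_nhds (baseCoord_mem F H)] with z hz
      exact fundamentalField_bracket (base H) hz Y X) w
  rw [fundamentalField_base H hπ, fundamentalField_base H hπ] at h
  rw [h, chartBracket_swap X Y, nomizu_neg]
  simp only [nomizu, neg_apply, sub_neg_eq_add]
  abel

end Nomizu

/-! ### Orthonormal bases -/

section OrthonormalBasis

theorem exists_orthonormal_basis {W : Type*} [AddCommGroup W] [Module ℝ W] [FiniteDimensional ℝ W]
    (B : W →ₗ[ℝ] W →ₗ[ℝ] ℝ) (hs : ∀ u v, B u v = B v u) (hp : ∀ v, v ≠ 0 → 0 < B v v) :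
    ∃ e : Module.Basis (Fin (Module.finrank ℝ W)) ℝ W,
      ∀ i j, B (e i) (e j) = if i = j then 1 else 0 := by
  obtain ⟨v, hv⟩ := LinearMap.BilinForm.exists_orthogonal_basis (B := B)
    ⟨fun x y => hs x y⟩
  have hpos : ∀ i, 0 < B (v i) (v i) := fun i => hp _ (v.ne_zero i)
  have hu : ∀ i, IsUnit (Real.sqrt (B (v i) (v i)))⁻¹ := fun i =>
    (inv_ne_zero (Real.sqrt_ne_zero'.2 (hpos i))).isUnit
  refine ⟨v.isUnitSMul hu, fun i j => ?_⟩
  rw [Module.Basis.isUnitSMul_apply, Module.Basis.isUnitSMul_apply]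
  simp only [map_smul, LinearMap.smul_apply, smul_eq_mul]
  split_ifs with h
  · subst h
    have := Real.mul_self_sqrt (hpos i).le
    have h2 := Real.sqrt_ne_zero'.2 (hpos i)
    field_simp
    nlinarith
  · have h2 : B (v i) (v j) = 0 := hv h
    rw [h2]; simp

theorem exists_isOrthonormalBasis {F : Type*} [NormedAddCommGroup F] [NormedSpace ℝ F]
    [FiniteDimensional ℝ F] {g : Form F} (hs : ∀ u v, g u v = g v u)
    (hp : ∀ v, v ≠ 0 → 0 < g v v) :
    ∃ e : Module.Basis (Fin (Module.finrank ℝ F)) ℝ F, IsOrthonormalBasis g e :=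
  exists_orthonormal_basis ((ContinuousLinearMap.coeLM ℝ) ∘ₗ g.toLinearMap) hs hp

end OrthonormalBasis

/-! ### Lie algebras of compact groups: invariant scalar product and Killing form -/

section Compact
variable {E : Type*} [NormedAddCommGroup E] [NormedSpace ℝ E] [FiniteDimensional ℝ E]
  [CompleteSpace E]
  {G : Type*} [TopologicalSpace G] [T2Space G] [CompactSpace G] [Group G] [ChartedSpace E G]
  [LieGroup 𝓘(ℝ, E) ∞ G]

variable (E G) in
/-- The Lie algebra of a compact Lie group has an invariant scalar product. -/
theorem exists_invariant_form : ∃ Q : Form E, (∀ X Y, Q X Y = Q Y X) ∧ (∀ X, X ≠ 0 → 0 < Q X X) ∧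
    ∀ (a : G) X Y, Q (adj E a X) (adj E a Y) = Q X Y := by
  have : IsTopologicalGroup G := topologicalGroup_of_lieGroup 𝓘(ℝ, E) ∞
  let _ : MeasurableSpace G := borel G
  have : BorelSpace G := ⟨rfl⟩
  set μ : Measure G := Measure.haar
  -- Averaging over Haar measure. With the inverse of `a`, replacing `X, Y` by `Ad(b) X, Ad(b) Y`
  -- amounts to a left translation of the integration variable.
  set f : E → E → G → ℝ := fun X Y a =>
    inner ℝ (toEuclidean (adj E a⁻¹ X)) (toEuclidean (adj E a⁻¹ Y)) with hf
  have hc : ∀ X Y, Continuous (f X Y) := by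
    intro X Y
    have h1 : ∀ X : E, Continuous (fun a : G => adj E a⁻¹ X) := fun X =>
      (continuous_adj X).comp continuous_inv
    exact (toEuclidean.continuous.comp (h1 X)).inner (toEuclidean.continuous.comp (h1 Y))
  have hi : ∀ X Y, Integrable (f X Y) μ := fun X Y =>
    (hc X Y).integrable_of_hasCompactSupport (HasCompactSupport.of_compactSpace _)
  let Q : E →ₗ[ℝ] E →ₗ[ℝ] ℝ := LinearMap.mk₂ ℝ (fun X Y => ∫ a, f X Y a ∂μ)
    (fun X X' Y => by
      rw [← integral_add (hi _ _) (hi _ _)]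
      exact integral_congr_ae (Eventually.of_forall fun a => by simp [hf, inner_add_left]))
    (fun c X Y => by
      rw [smul_eq_mul, ← integral_const_mul]
      exact integral_congr_ae (Eventually.of_forall fun a => by simp [hf, inner_smul_left]))
    (fun X Y Y' => by
      rw [← integral_add (hi _ _) (hi _ _)]
      exact integral_congr_ae (Eventually.of_forall fun a => by simp [hf, inner_add_right]))
    (fun c X Y => by
      rw [smul_eq_mul, ← integral_const_mul]
      exact integral_congr_ae (Eventually.of_forall fun a => by simp [hf, inner_smul_right]))
  refine ⟨Q.toContinuousBilinearMap, ?_, ?_, ?_⟩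
  · intro X Y
    change ∫ a, f X Y a ∂μ = ∫ a, f Y X a ∂μ
    simp only [hf, real_inner_comm]
  · intro X hX
    change 0 < ∫ a, f X X a ∂μ
    refine (hc X X).integral_pos_of_hasCompactSupport_nonneg_nonzero
      (HasCompactSupport.of_compactSpace _) (fun a => real_inner_self_nonneg) (x := 1) ?_
    simp only [hf, inv_one, adj_one]
    exact inner_self_ne_zero.2 (by simpa using hX)
  · intro a X Y
    change ∫ b, f (adj E a X) (adj E a Y) b ∂μ = ∫ b, f X Y b ∂μ
    rw [← integral_mul_left_eq_self (f X Y) a⁻¹]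
    refine integral_congr_ae (Eventually.of_forall fun b => ?_)
    simp only [hf, mul_inv_rev, inv_inv, adj_mul, ContinuousLinearMap.comp_apply]

/-- The Lie algebra of `G`, as a finite-dimensional space. -/
theorem finiteDimensional_groupLieAlgebra :
    FiniteDimensional ℝ (GroupLieAlgebra 𝓘(ℝ, E) G) :=
  inferInstanceAs (FiniteDimensional ℝ E)

/-- The operator `ad X` is skew for an invariant scalar product. -/
theorem trace_ad_eq_zero (X : GroupLieAlgebra 𝓘(ℝ, E) G) :
    LinearMap.trace ℝ (GroupLieAlgebra 𝓘(ℝ, E) G) (LieAlgebra.ad ℝ _ X) = 0 := by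
  obtain ⟨Q, hs, hp, hi⟩ := exists_invariant_form E G
  obtain ⟨e, he⟩ := exists_isOrthonormalBasis hs hp
  refine Eq.trans (he.trace (F := E) _) (Finset.sum_eq_zero fun i _ => ?_)
  have h1 := invariant_form_chartBracket (E := E) Q hi X (e i) (e i)
  rw [hs (e i)] at h1
  have h2 : (LieAlgebra.ad ℝ (GroupLieAlgebra 𝓘(ℝ, E) G) X) (e i) = chartBracket (E := E) G X (e i) :=
    bracket_eq_chartBracket X (e i)
  refine Eq.trans (congrArg (fun Y : E => Q Y (e i)) h2) ?_
  linarith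

/-- Since `ad X` is `Q`-skew, the trace of its square is minus its squared Hilbert-Schmidt norm.
Both the sign of the Killing form and its null vectors, which are central, can be read off. -/
theorem killingForm_self_eq (Q : Form E) (hi : ∀ (a : G) X Y, Q (adj E a X) (adj E a Y) = Q X Y)
    {e : Module.Basis (Fin (Module.finrank ℝ E)) ℝ E} (he : IsOrthonormalBasis Q e)
    (X : GroupLieAlgebra 𝓘(ℝ, E) G) :
    killingForm ℝ (GroupLieAlgebra 𝓘(ℝ, E) G) X X =
      - ∑ i, Q (chartBracket (E := E) G X (e i)) (chartBracket (E := E) G X (e i)) := by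
  rw [killingForm_apply_apply]
  refine Eq.trans (he.trace (F := E) _) ?_
  rw [← Finset.sum_neg_distrib]
  refine Finset.sum_congr rfl fun i _ => ?_
  have h1 := invariant_form_chartBracket (E := E) Q hi X (chartBracket (E := E) G X (e i)) (e i)
  have h2 : (LieAlgebra.ad ℝ (GroupLieAlgebra 𝓘(ℝ, E) G) X ∘ₗ
      LieAlgebra.ad ℝ (GroupLieAlgebra 𝓘(ℝ, E) G) X) (e i) =
      chartBracket (E := E) G X (chartBracket (E := E) G X (e i)) :=
    (bracket_eq_chartBracket X _).trans
      (congrArg (fun Z : E => chartBracket (E := E) G X Z) (bracket_eq_chartBracket X (e i)))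
  refine Eq.trans (congrArg (fun Y : E => Q Y (e i)) h2) ?_
  linarith

theorem nonneg_of_pos {Q : Form E} (hp : ∀ X, X ≠ 0 → 0 < Q X X) (X : E) : 0 ≤ Q X X := by
  by_cases h : X = 0
  · simp [h]
  · exact (hp X h).le

theorem killingForm_self_nonpos (X : GroupLieAlgebra 𝓘(ℝ, E) G) :
    killingForm ℝ (GroupLieAlgebra 𝓘(ℝ, E) G) X X ≤ 0 := by
  obtain ⟨Q, hs, hp, hi⟩ := exists_invariant_form E G
  obtain ⟨e, he⟩ := exists_isOrthonormalBasis hs hp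
  rw [killingForm_self_eq Q hi he, neg_nonpos]
  exact Finset.sum_nonneg fun i _ => nonneg_of_pos hp _

theorem lie_eq_zero_of_killingForm_self (X : GroupLieAlgebra 𝓘(ℝ, E) G)
    (hX : killingForm ℝ (GroupLieAlgebra 𝓘(ℝ, E) G) X X = 0) (Y : GroupLieAlgebra 𝓘(ℝ, E) G) :
    ⁅X, Y⁆ = 0 := by
  obtain ⟨Q, hs, hp, hi⟩ := exists_invariant_form E G
  obtain ⟨e, he⟩ := exists_isOrthonormalBasis hs hp
  rw [killingForm_self_eq Q hi he, neg_eq_zero,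
    Finset.sum_eq_zero_iff_of_nonneg fun i _ => nonneg_of_pos hp _] at hX
  have h1 : (LieAlgebra.ad ℝ (GroupLieAlgebra 𝓘(ℝ, E) G) X : E →ₗ[ℝ] E) = 0 := by
    refine e.ext fun i => ?_
    refine Eq.trans (bracket_eq_chartBracket X (e i)) ?_
    by_contra hne
    exact (hp _ hne).ne' (hX i (Finset.mem_univ i))
  exact congrArg (fun f : E →ₗ[ℝ] E => f Y) h1

/-- The Killing form is invariant under the adjoint action. -/
theorem killingForm_Ad (a : G) (X Y : GroupLieAlgebra 𝓘(ℝ, E) G) :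
    killingForm ℝ (GroupLieAlgebra 𝓘(ℝ, E) G) (Ad E a X) (Ad E a Y) =
      killingForm ℝ (GroupLieAlgebra 𝓘(ℝ, E) G) X Y := by
  let φ : GroupLieAlgebra 𝓘(ℝ, E) G ≃ₗ[ℝ] GroupLieAlgebra 𝓘(ℝ, E) G :=
    { (Ad E a).toLinearMap with
      invFun := Ad E a⁻¹
      left_inv := fun X => adj_inv_apply_adj (E := E) a X
      right_inv := fun X => adj_apply_adj_inv (E := E) a X }
  have hφ : ∀ X Y, φ ⁅X, Y⁆ = ⁅φ X, φ Y⁆ := fun X Y =>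
    ((congrArg (fun Z : E => adj E a Z) (bracket_eq_chartBracket X Y)).trans (adj_chartBracket (E := E) a X Y)).trans
      (bracket_eq_chartBracket (φ X) (φ Y)).symm
  have h : ∀ X, LieAlgebra.ad ℝ (GroupLieAlgebra 𝓘(ℝ, E) G) (Ad E a X) =
      φ.conj (LieAlgebra.ad ℝ (GroupLieAlgebra 𝓘(ℝ, E) G) X) := by
    intro X
    ext Z
    rw [LinearEquiv.conj_apply_apply, LieAlgebra.ad_apply, LieAlgebra.ad_apply, hφ,
      φ.apply_symm_apply]
    rfl
  rw [killingForm_apply_apply, killingForm_apply_apply, h, h, ← LinearEquiv.conj_comp,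
    LinearMap.trace_conj']

end Compact

/-! ### The reductive complement and the Ricci form -/

section Homogeneous
variable {E : Type*} [NormedAddCommGroup E] [NormedSpace ℝ E] [FiniteDimensional ℝ E]
  [CompleteSpace E]
  {F : Type*} [NormedAddCommGroup F] [InnerProductSpace ℝ F] [FiniteDimensional ℝ F]
  {G : Type*} [TopologicalSpace G] [T2Space G] [CompactSpace G] [Group G] [ChartedSpace E G]
  [LieGroup 𝓘(ℝ, E) ∞ G]
  (H : Subgroup G) [ChartedSpace F (G ⧸ H)] [IsManifold 𝓘(ℝ, F) ∞ (G ⧸ H)]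
  {𝔪 : Submodule ℝ (GroupLieAlgebra 𝓘(ℝ, E) G)}

/-- `lift` uses `ContinuousLinearMap.inverse`, whose value is `0` on maps that are not invertible.
Here the restriction of the projection to `𝔪` is bijective: its kernel is `𝔥 ∩ 𝔪 = 0`, and it is
onto because `𝔤 → T_{eH}(G/H)` is onto with kernel `𝔥`. -/
theorem lift_spec (hπ : Manifold.IsSubmersion 𝓘(ℝ, E) 𝓘(ℝ, F) ∞ (fun a : G => (a : G ⧸ H)))
    (h𝔪 : IsReductiveComplement F H 𝔪) (v : F) :
    projDeriv E F H (lift H 𝔪 v) = v ∧ lift H 𝔪 v ∈ 𝔪 := by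
  have := finiteDimensional_groupLieAlgebra (E := E) (G := G)
  have : T2Space (GroupLieAlgebra 𝓘(ℝ, E) G) := inferInstanceAs (T2Space E)
  set q : 𝔪 →L[ℝ] F := (projDeriv E F H) ∘L 𝔪.subtypeL with hq
  have hinj : Function.Injective q := by
    rw [injective_iff_map_eq_zero]
    intro X hX
    have h1 : (X : GroupLieAlgebra 𝓘(ℝ, E) G) ∈ isotropyAlgebra E F H := hX
    exact Subtype.ext (Submodule.disjoint_def.1 h𝔪.isCompl.disjoint _ h1 X.2)
  have hsurj : Function.Surjective q := by
    intro v
    obtain ⟨X, hX⟩ : ∃ X : GroupLieAlgebra 𝓘(ℝ, E) G, projDeriv E F H X = v :=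
      proj_surjective H hπ v
    have h1 : (X : GroupLieAlgebra 𝓘(ℝ, E) G) ∈ isotropyAlgebra E F H ⊔ 𝔪 := by
      rw [h𝔪.isCompl.sup_eq_top]; trivial
    obtain ⟨Y, hY, Z, hZ, hYZ⟩ := Submodule.mem_sup.1 h1
    refine ⟨⟨Z, hZ⟩, ?_⟩
    have h2 : projDeriv E F H Y = 0 := hY
    have h3 : projDeriv E F H (Y + Z) = v := (congrArg (projDeriv E F H) hYZ).trans hX
    rw [map_add, h2, zero_add] at h3
    exact h3
  have hinv : q.inverse = _ := ContinuousLinearMap.inverse_equiv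
    (LinearEquiv.ofBijective q.toLinearMap ⟨hinj, hsurj⟩).toContinuousLinearEquiv
  refine ⟨?_, (q.inverse v).2⟩
  change q (q.inverse v) = v
  rw [hinv]
  exact (LinearEquiv.ofBijective q.toLinearMap ⟨hinj, hsurj⟩).apply_symm_apply v

theorem lift_proj (hπ : Manifold.IsSubmersion 𝓘(ℝ, E) 𝓘(ℝ, F) ∞ (fun a : G => (a : G ⧸ H)))
    (h𝔪 : IsReductiveComplement F H 𝔪) {X : GroupLieAlgebra 𝓘(ℝ, E) G} (hX : X ∈ 𝔪) :
    lift H 𝔪 (projDeriv E F H X) = X := by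
  obtain ⟨h1, h2⟩ := lift_spec H hπ h𝔪 (projDeriv E F H X)
  have h3 : lift H 𝔪 (projDeriv E F H X) - X ∈ isotropyAlgebra E F H := by
    change projDeriv E F H _ = 0
    rw [map_sub, h1, sub_self]
  exact sub_eq_zero.1 (Submodule.disjoint_def.1 h𝔪.isCompl.disjoint _ h3 (𝔪.sub_mem h2 hX))

theorem isReductivePair (hπ : Manifold.IsSubmersion 𝓘(ℝ, E) 𝓘(ℝ, F) ∞ (fun a : G => (a : G ⧸ H)))
    (h𝔪 : IsReductiveComplement F H 𝔪) :
    IsReductivePair (projDeriv E F H).toLinearMap (lift H 𝔪).toLinearMap where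
  p_s v := (lift_spec H hπ h𝔪 v).1
  s_p_bracket X hX v := by
    refine lift_proj H hπ h𝔪 ?_
    have h1 := chartBracket_mem (E := E) H hπ 𝔪 h𝔪.invariant (X := X) hX
      (lift_spec H hπ h𝔪 v).2
    exact (bracket_eq_chartBracket X (lift H 𝔪 v)).symm ▸ h1
  trace_ad := trace_ad_eq_zero

variable [ContMDiffSMul 𝓘(ℝ, E) 𝓘(ℝ, F) ∞ G (G ⧸ H)] [SmoothTranslations F G (G ⧸ H)]

theorem isNomizuMap (hπ : Manifold.IsSubmersion 𝓘(ℝ, E) 𝓘(ℝ, F) ∞ (fun a : G => (a : G ⧸ H)))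
    {g : Form F} (hg : g ∈ invariantMetrics F H) :
    IsNomizuMap g (projDeriv E F H).toLinearMap
      (fun X : GroupLieAlgebra 𝓘(ℝ, E) G => (nomizu (E := E) H g X).toLinearMap) where
  add X Y v := congrArg (fun L : F →L[ℝ] F => L v) (nomizu_add (E := E) H g X Y)
  skew X v w := nomizu_skew (E := E) H hπ hg X v w
  torsion X Y := (nomizu_torsion (E := E) H hπ hg X Y).trans
    (congrArg (fun Z : E => proj E F H Z) (bracket_eq_chartBracket X Y).symm)

theorem ricciForm_eq (hπ : Manifold.IsSubmersion 𝓘(ℝ, E) 𝓘(ℝ, F) ∞ (fun a : G => (a : G ⧸ H)))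
    (h𝔪 : IsReductiveComplement F H 𝔪) {g : Form F} (hg : g ∈ invariantMetrics F H)
    {ι : Type*} [Fintype ι] [DecidableEq ι] {e : Module.Basis ι ℝ F}
    (he : IsOrthonormalBasis g e) (v w : F) :
    let c := structureForm g (projDeriv E F H).toLinearMap (lift H 𝔪).toLinearMap
    ricciForm (chartMetric H g (base H)) (baseCoord F H) v w =
      4⁻¹ * ∑ i, ∑ k, c (e i) (e k) v * c (e i) (e k) w
      - 2⁻¹ * ∑ i, ∑ k, c v (e i) (e k) * c w (e i) (e k)
      - 2⁻¹ * killingForm ℝ (GroupLieAlgebra 𝓘(ℝ, E) G) (lift H 𝔪 v) (lift H 𝔪 w) := by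
  have := finiteDimensional_groupLieAlgebra (E := E) (G := G)
  refine (isNomizuMap H hπ hg).ricci (isReductivePair H hπ h𝔪) he hg.1 v w fun u => ?_
  have h1 := curvature_nomizu (E := E) H hπ hg (lift H 𝔪 u) (lift H 𝔪 v) w
  have h2 : ∀ v, proj E F H (lift H 𝔪 v) = v := fun v => (lift_spec H hπ h𝔪 v).1
  have h3 : chartBracket (E := E) G (lift H 𝔪 u) (lift H 𝔪 v) =
    (⁅lift H 𝔪 u, lift H 𝔪 v⁆ : GroupLieAlgebra 𝓘(ℝ, E) G) :=
      (bracket_eq_chartBracket (lift H 𝔪 u) (lift H 𝔪 v)).symm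
  rw [h2, h2] at h1
  refine h1.trans ?_
  exact congrArg (fun Z : E => nomizu (E := E) H g (lift H 𝔪 u) (nomizu (E := E) H g
    (lift H 𝔪 v) w) - nomizu (E := E) H g (lift H 𝔪 v) (nomizu (E := E) H g (lift H 𝔪 u) w) -
    nomizu (E := E) H g Z w) h3

theorem projDeriv_Ad (hπ : Manifold.IsSubmersion 𝓘(ℝ, E) 𝓘(ℝ, F) ∞ (fun a : G => (a : G ⧸ H)))
    (h : H) (X : GroupLieAlgebra 𝓘(ℝ, E) G) :
    projDeriv E F H (Ad E (h : G) X) = isotropyRep F H h (projDeriv E F H X) :=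
  proj_adj (E := E) H hπ h X

theorem lift_isotropyRep
    (hπ : Manifold.IsSubmersion 𝓘(ℝ, E) 𝓘(ℝ, F) ∞ (fun a : G => (a : G ⧸ H)))
    (h𝔪 : IsReductiveComplement F H 𝔪) (h : H) (v : F) :
    lift H 𝔪 (isotropyRep F H h v) = Ad E (h : G) (lift H 𝔪 v) := by
  obtain ⟨h1, h2⟩ := lift_spec H hπ h𝔪 v
  conv_lhs => rw [← h1, ← projDeriv_Ad H hπ h]
  exact lift_proj H hπ h𝔪 (h𝔪.invariant h h.2 _ h2)

theorem Ad_lie (a : G) (X Y : GroupLieAlgebra 𝓘(ℝ, E) G) :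
    Ad E a ⁅X, Y⁆ = ⁅Ad E a X, Ad E a Y⁆ :=
  ((congrArg (fun Z : E => adj E a Z) (bracket_eq_chartBracket X Y)).trans (adj_chartBracket (E := E) a X Y)).trans
      (bracket_eq_chartBracket (Ad E a X) (Ad E a Y)).symm

end Homogeneous

/-! ### Functionals that vanish on brackets -/

section LocallyConstant
variable {E : Type*} [NormedAddCommGroup E] [NormedSpace ℝ E]
  {G : Type*} [TopologicalSpace G] [Group G] [ChartedSpace E G] [LieGroup 𝓘(ℝ, E) ∞ G]

theorem contDiffAt_mulRightChart (b : G) {s : E}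
    (hs : s ∈ (extChartAt 𝓘(ℝ, E) (1 : G)).target)
    (hb : (extChartAt 𝓘(ℝ, E) (1 : G)).symm s * b ∈ (extChartAt 𝓘(ℝ, E) (1 : G)).source) :
    ContDiffAt ℝ ∞ (fun t => extChartAt 𝓘(ℝ, E) (1 : G)
      ((extChartAt 𝓘(ℝ, E) (1 : G)).symm t * b)) s := by
  rw [← contMDiffAt_iff_contDiffAt]
  have h2 : ContMDiffAt 𝓘(ℝ, E) 𝓘(ℝ, E) ∞ (extChartAt 𝓘(ℝ, E) (1 : G)).symm s :=
    (contMDiffOn_extChartAt_symm 1).contMDiffAt ((isOpen_extChartAt_target 1).mem_nhds hs)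
  have h3 : ContMDiffAt 𝓘(ℝ, E) 𝓘(ℝ, E) ∞ (extChartAt 𝓘(ℝ, E) (1 : G))
      ((extChartAt 𝓘(ℝ, E) (1 : G)).symm s * b) := contMDiffAt_extChartAt' (by simpa using hb)
  exact ContMDiffAt.comp s h3 (h2.mul contMDiffAt_const)

variable (E) in
/-- A function whose derivatives along left translations vanish is locally constant. -/
theorem eventually_eq_of_hasFDerivAt_zero {u : G → ℝ}
    (h : ∀ᶠ b in 𝓝 (1 : G), HasFDerivAt (fun s => u ((extChartAt 𝓘(ℝ, E) (1 : G)).symm s * b))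
      (0 : E →L[ℝ] ℝ) (unitCoord E G)) :
    ∀ᶠ b in 𝓝 (1 : G), u b = u 1 := by
  have : IsTopologicalGroup G := topologicalGroup_of_lieGroup 𝓘(ℝ, E) ∞
  have hc : Tendsto (extChartAt 𝓘(ℝ, E) (1 : G)).symm (𝓝 (unitCoord E G)) (𝓝 1) := by
    have := continuousAt_extChartAt_symm (I := 𝓘(ℝ, E)) (1 : G)
    rw [ContinuousAt, symm_unitCoord] at this
    exact this
  have h1 := (hc.eventually h).and ((isOpen_extChartAt_target (1 : G)).mem_nhds (unitCoord_mem E G))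
  obtain ⟨r, hr, hball⟩ := Metric.eventually_nhds_iff_ball.1 h1
  have hder : ∀ s ∈ Metric.ball (unitCoord E G) r,
      HasFDerivAt (fun s => u ((extChartAt 𝓘(ℝ, E) (1 : G)).symm s)) (0 : E →L[ℝ] ℝ) s := by
    intro s hs
    obtain ⟨hd, hst⟩ := hball s hs
    -- The hypothesis concerns derivatives at the unit only; right translation by `b⁻¹` carries the
    -- point `s` to the unit.
    set b := (extChartAt 𝓘(ℝ, E) (1 : G)).symm s with hb
    have hsrc : (extChartAt 𝓘(ℝ, E) (1 : G)).symm s * b⁻¹ ∈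
        (extChartAt 𝓘(ℝ, E) (1 : G)).source := by
      rw [← hb, mul_inv_cancel]; exact mem_extChartAt_source _
    have hρ := ((contDiffAt_mulRightChart b⁻¹ hst hsrc).differentiableAt (by simp)).hasFDerivAt
    have hρ0 : extChartAt 𝓘(ℝ, E) (1 : G) ((extChartAt 𝓘(ℝ, E) (1 : G)).symm s * b⁻¹) =
        unitCoord E G := by rw [← hb, mul_inv_cancel]
    rw [← hρ0] at hd
    have h2 := HasFDerivAt.comp s hd hρ
    rw [ContinuousLinearMap.zero_comp] at h2
    refine h2.congr_of_eventuallyEq ?_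
    have hcs : ContinuousAt (fun t => (extChartAt 𝓘(ℝ, E) (1 : G)).symm t * b⁻¹) s :=
      (continuousAt_extChartAt_symm'' hst).mul continuousAt_const
    filter_upwards [hcs.eventually_mem ((isOpen_extChartAt_source (1 : G)).mem_nhds hsrc)] with t ht
    simp only [Function.comp]
    rw [(extChartAt 𝓘(ℝ, E) (1 : G)).left_inv ht, inv_mul_cancel_right]
  have hconst : ∀ s ∈ Metric.ball (unitCoord E G) r,
      u ((extChartAt 𝓘(ℝ, E) (1 : G)).symm s) = u 1 := by
    intro s hs
    have h3 := (convex_ball (unitCoord E G) r).is_const_of_fderivWithin_eq_zero (𝕜 := ℝ)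
      (fun s hs => (hder s hs).differentiableAt.differentiableWithinAt)
      (fun s hs => by
        rw [fderivWithin_of_isOpen Metric.isOpen_ball hs, (hder s hs).fderiv])
      hs (Metric.mem_ball_self hr)
    rwa [symm_unitCoord] at h3
  have h4 : ∀ᶠ b in 𝓝 (1 : G), extChartAt 𝓘(ℝ, E) (1 : G) b ∈ Metric.ball (unitCoord E G) r :=
    (continuousAt_extChartAt (1 : G)).eventually_mem (Metric.ball_mem_nhds _ hr)
  filter_upwards [h4, (isOpen_extChartAt_source (I := 𝓘(ℝ, E)) (1 : G)).mem_nhds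
    (mem_extChartAt_source 1)] with b hb hb'
  have := hconst _ hb
  rwa [(extChartAt 𝓘(ℝ, E) (1 : G)).left_inv hb'] at this

/-- At every group element `b` the derivative of `Ad(·) X` is a bracket with `Ad(b) X`, which `l`
annihilates. -/
theorem eventually_functional_adj [CompleteSpace E] (l : E →L[ℝ] ℝ)
    (hl : ∀ X Y, l (chartBracket G X Y) = 0) (X : E) :
    ∀ᶠ b in 𝓝 (1 : G), l (adj E b X) = l X := by
  have h := eventually_eq_of_hasFDerivAt_zero E (u := fun a : G => l (adj E a X))
    (Eventually.of_forall fun b => by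
      obtain ⟨L, hL, hd⟩ := hasFDerivAt_adj (G := G) (adj E b X)
      have h1 := l.hasFDerivAt.comp (unitCoord E G) hd
      have h2 : l ∘L L = 0 := by ext Z; simp [hL, hl]
      rw [h2] at h1
      refine h1.congr_of_eventuallyEq (Eventually.of_forall fun s => ?_)
      simp only [Function.comp, adj_mul, ContinuousLinearMap.comp_apply])
  have h0 : l (adj E (1 : G) X) = l X := by rw [adj_one]; rfl
  simpa only [h0] using h

variable (G) in
/-- The stabiliser of a linear functional. -/
def functionalStabilizer (l : E →L[ℝ] ℝ) : Subgroup G where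
  carrier := {a | ∀ X, l (adj E a X) = l X}
  mul_mem' {a b} ha hb X := by
    rw [adj_mul, ContinuousLinearMap.comp_apply, ha, hb]
  one_mem' X := by rw [adj_one]; rfl
  inv_mem' {a} ha X := by rw [← ha, adj_apply_adj_inv]

/-- It suffices to test `l` on a finite basis near the unit. Openness makes up for `G` being
possibly disconnected: the stabilizer need not be all of `G`, but it still acts transitively on the
connected space `G/H`. -/
theorem isOpen_functionalStabilizer [FiniteDimensional ℝ E] [CompleteSpace E] (l : E →L[ℝ] ℝ)
    (hl : ∀ X Y, l (chartBracket G X Y) = 0) :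
    IsOpen (functionalStabilizer G l : Set G) := by
  have : IsTopologicalGroup G := topologicalGroup_of_lieGroup 𝓘(ℝ, E) ∞
  refine Subgroup.isOpen_of_mem_nhds (g := 1) _ ?_
  have h := eventually_all.2 fun i : Fin (Module.finrank ℝ E) =>
    eventually_functional_adj (G := G) l hl (Module.finBasis ℝ E i)
  filter_upwards [h] with b hb
  intro X
  have : (l ∘L adj E b : E →L[ℝ] ℝ).toLinearMap = l.toLinearMap :=
    (Module.finBasis ℝ E).ext hb
  exact congrArg (fun f : E →ₗ[ℝ] ℝ => f X) this

end LocallyConstant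

/-! ### Transitivity of open subgroups -/

section Transitive
variable {G : Type*} [TopologicalSpace G] [Group G] [IsTopologicalGroup G] (H : Subgroup G)

theorem isOpenMap_smul_point (p : G ⧸ H) : IsOpenMap (fun a : G => a • p) := by
  obtain ⟨c, rfl⟩ := QuotientGroup.mk_surjective p
  exact (QuotientGroup.isOpenMap_coe (N := H)).comp (isOpenMap_mul_right c)

theorem map_nhds_one_smul_point (p : G ⧸ H) :
    𝓝 p ≤ map (fun a : G => a • p) (𝓝 1) := by
  have := (isOpenMap_smul_point H p).nhds_le 1
  rwa [one_smul] at this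

/-- Open subgroups act transitively on a connected homogeneous space. -/
theorem exists_smul_base_of_isOpen [ConnectedSpace (G ⧸ H)] {K : Subgroup G}
    (hK : IsOpen (K : Set G)) (p : G ⧸ H) : ∃ a ∈ K, a • base H = p := by
  have ho : ∀ q : G ⧸ H, IsOpen ((fun a : G => a • q) '' K) := fun q =>
    isOpenMap_smul_point H q _ hK
  set O := (fun a : G => a • base H) '' K with hO
  -- All orbits of `K` are open, and the complement of one orbit is a union of orbits.
  have hclopen : IsClopen O := by
    refine ⟨⟨?_⟩, ho _⟩
    rw [isOpen_iff_mem_nhds]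
    intro q hq
    refine mem_of_superset ((ho q).mem_nhds ⟨1, K.one_mem, one_smul _ _⟩) ?_
    rintro _ ⟨a, ha, rfl⟩ ⟨b, hb, hab⟩
    refine hq ⟨a⁻¹ * b, K.mul_mem (K.inv_mem ha) hb, ?_⟩
    simp only at hab ⊢
    rw [mul_smul, hab, inv_smul_smul]
  have h1 : O = univ := hclopen.eq_univ ⟨base H, 1, K.one_mem, one_smul _ _⟩
  have h2 : p ∈ O := h1 ▸ mem_univ p
  obtain ⟨a, ha, h3⟩ := h2
  exact ⟨a, ha, h3⟩

end Transitive

/-! ### Local primitives of the invariant one-form defined by a functional -/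

section Primitive
variable {E : Type*} [NormedAddCommGroup E] [NormedSpace ℝ E] [CompleteSpace E]
  [FiniteDimensional ℝ E]
  {F : Type*} [NormedAddCommGroup F] [InnerProductSpace ℝ F] [FiniteDimensional ℝ F]
  {G : Type*} [TopologicalSpace G] [Group G] [ChartedSpace E G] [LieGroup 𝓘(ℝ, E) ∞ G]
  (H : Subgroup G) [ChartedSpace F (G ⧸ H)] [IsManifold 𝓘(ℝ, F) ∞ (G ⧸ H)]
  [ContMDiffSMul 𝓘(ℝ, E) 𝓘(ℝ, F) ∞ G (G ⧸ H)] [SmoothTranslations F G (G ⧸ H)]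

/-- The fundamental fields at an arbitrary point. -/
theorem exists_fundamentalField_eq
    (hπ : Manifold.IsSubmersion 𝓘(ℝ, E) 𝓘(ℝ, F) ∞ (fun a : G => (a : G ⧸ H)))
    (c : G ⧸ H) {y : F} (hy : y ∈ (extChartAt 𝓘(ℝ, F) c).target) {a : G}
    (ha : a • base H = (extChartAt 𝓘(ℝ, F) c).symm y) :
    ∃ D : F →L[ℝ] F, Function.Bijective D ∧
      ∀ X : E, fundamentalField G c X y = D (proj E F H (adj E a⁻¹ X)) := by
  have hsrc : a • (extChartAt 𝓘(ℝ, F) (base H)).symm (baseCoord F H) ∈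
      (extChartAt 𝓘(ℝ, F) c).source := by
    rw [symm_baseCoord, ha]; exact (extChartAt 𝓘(ℝ, F) c).map_target hy
  have hap : a⁻¹ • (extChartAt 𝓘(ℝ, F) c).symm y = base H := by rw [← ha, inv_smul_smul]
  have hya : smulChart F a (base H) c (baseCoord F H) = y := by
    rw [smulChart, symm_baseCoord, ha, (extChartAt 𝓘(ℝ, F) c).right_inv hy]
  have hya' : smulChart F a⁻¹ c (base H) y = baseCoord F H := by
    rw [smulChart, hap]
  have k1 := fderiv_smulChart_mul (a := a⁻¹) (b := a) (c := base H) (c' := c)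
    (c'' := base H) (baseCoord_mem F H) hsrc
    (by rw [inv_smul_smul, symm_baseCoord]; exact mem_extChartAt_source _)
  have k2 := fderiv_smulChart_mul (a := a) (b := a⁻¹) (c := c) (c' := base H)
    (c'' := c) hy (by rw [hap]; exact mem_extChartAt_source _)
    (by rw [hap, ha]; exact (extChartAt 𝓘(ℝ, F) c).map_target hy)
  rw [inv_mul_cancel, fderiv_smulChart_one _ (baseCoord_mem F H), hya] at k1
  rw [mul_inv_cancel, fderiv_smulChart_one c hy, hya'] at k2
  -- `D` is the differential of the translation by `a`; the formula comes from `s • aH = a • (a⁻¹ s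
  -- a) • eH`.
  refine ⟨fderiv ℝ (smulChart F a (base H) c) (baseCoord F H), ⟨?_, ?_⟩, ?_⟩
  · exact Function.LeftInverse.injective (g := fderiv ℝ (smulChart F a⁻¹ c (base H)) y)
      fun v => (congrArg (fun L => L v) k1).symm
  · exact Function.RightInverse.surjective (g := fderiv ℝ (smulChart F a⁻¹ c (base H)) y)
      fun v => (congrArg (fun L => L v) k2).symm
  intro X
  have e1 : HasFDerivAt (fun s => actChart (1 : G) c c (s, y)) _
      (unitCoord E G) := HasFDerivAt.comp (f := fun s => (s, y)) (unitCoord E G)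
    ((contDiffAt_actChart_unit c hy).differentiableAt
      (by simp)).hasFDerivAt (hasFDerivAt_prodMk_left _ _)
  have d1 := hasFDerivAt_conjChart (E := E) a⁻¹
  have d2 := hasFDerivAt_projChart H hπ
  rw [← conjChart_unit (E := E) a⁻¹] at d2
  have d3 := d2.comp (unitCoord E G) d1
  have d4 := hasFDerivAt_smulChart (F := F) (baseCoord_mem F H) hsrc
  have hb : extChartAt 𝓘(ℝ, F) (base H)
      ((extChartAt 𝓘(ℝ, E) (1 : G)).symm (conjChart E a⁻¹ (unitCoord E G)) : G ⧸ H) =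
        baseCoord F H := by
    rw [conjChart_unit, symm_unitCoord]
  rw [← hb] at d4
  have d5 := HasFDerivAt.comp (unitCoord E G) d4 d3
  rw [hb] at d5
  have hcont : ContinuousAt (fun s => ((extChartAt 𝓘(ℝ, E) (1 : G)).symm
      (conjChart E a⁻¹ s) : G ⧸ H)) (unitCoord E G) := by
    refine ContinuousAt.comp (g := fun s => ((extChartAt 𝓘(ℝ, E) (1 : G)).symm s : G ⧸ H)) ?_
      d1.continuousAt
    rw [conjChart_unit]
    exact hπ.contMDiff.continuous.continuousAt.comp (continuousAt_extChartAt_symm 1)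
  have hsrc' : ∀ᶠ s in 𝓝 (unitCoord E G), ((extChartAt 𝓘(ℝ, E) (1 : G)).symm
      (conjChart E a⁻¹ s) : G ⧸ H) ∈ (extChartAt 𝓘(ℝ, F) (base H)).source := by
    refine hcont.eventually_mem ((isOpen_extChartAt_source _).mem_nhds ?_)
    rw [conjChart_unit, symm_unitCoord]; exact mem_extChartAt_source _
  have e2 := e1.unique (d5.congr_of_eventuallyEq (by
    filter_upwards [hsrc', conjChart_symm (E := E) a⁻¹] with s hs hs'
    simp only [Function.comp, smulChart, actChart, ← ha]
    rw [(extChartAt 𝓘(ℝ, F) (base H)).left_inv hs, hs']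
    congr 1
    change (((extChartAt 𝓘(ℝ, E) (1 : G)).symm s * (a * 1) : G) : G ⧸ H) =
      ((a * (a⁻¹ * (extChartAt 𝓘(ℝ, E) (1 : G)).symm s * a⁻¹⁻¹) : G) : G ⧸ H)
    congr 1
    group))
  exact congrArg (fun L => L X) e2

/-- `f` is differentiable along the orbits at `p`, with derivative `l`. -/
def IsPrimitiveAt (l : E →L[ℝ] ℝ) (f : G ⧸ H → ℝ) (p : G ⧸ H) : Prop :=
  HasFDerivAt (fun s => f ((extChartAt 𝓘(ℝ, E) (1 : G)).symm s • p)) l (unitCoord E G)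

/-- Functionals that vanish on brackets and on the isotropy algebra have local primitives. -/
theorem exists_local_primitive [ConnectedSpace (G ⧸ H)]
    (hπ : Manifold.IsSubmersion 𝓘(ℝ, E) 𝓘(ℝ, F) ∞ (fun a : G => (a : G ⧸ H)))
    (l : E →L[ℝ] ℝ) (hl : ∀ X Y, l (chartBracket G X Y) = 0)
    (hlH : ∀ X, proj E F H X = 0 → l X = 0) (c : G ⧸ H) :
    ∃ (U : Set (G ⧸ H)) (f : G ⧸ H → ℝ), IsOpen U ∧ c ∈ U ∧ ∀ p ∈ U, IsPrimitiveAt H l f p := by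
  have : IsTopologicalGroup G := topologicalGroup_of_lieGroup 𝓘(ℝ, E) ∞
  have hK := isOpen_functionalStabilizer (G := G) l hl
  set T : F → E →L[ℝ] F := fun y => fderiv ℝ (actChart (1 : G) c c) (unitCoord E G, y) ∘L
    ContinuousLinearMap.inl ℝ E F with hT
  have hTK : ∀ y X, T y X = fundamentalField G c X y := by
    intro y X
    simp [hT, fundamentalField]
  -- The point is reached from `eH` by an element that fixes `l`. Hence `l` vanishes on its isotropy
  -- algebra too, and `X* ↦ l(X)` is a well-defined one-form.
  have hker : ∀ y ∈ (extChartAt 𝓘(ℝ, F) c).target, ∀ X, T y X = 0 → l X = 0 := by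
    intro y hy X hX
    obtain ⟨a, haK, ha⟩ := exists_smul_base_of_isOpen H hK ((extChartAt 𝓘(ℝ, F) c).symm y)
    obtain ⟨D, hD, hDX⟩ := exists_fundamentalField_eq H hπ c hy ha
    rw [hTK, hDX, ← map_zero D] at hX
    rw [← (functionalStabilizer G l).inv_mem haK X]
    exact hlH _ (hD.1 hX)
  have hsurj : ∀ y ∈ (extChartAt 𝓘(ℝ, F) c).target, Function.Surjective (T y) := by
    intro y hy v
    obtain ⟨a, ha⟩ := exists_smul_base H ((extChartAt 𝓘(ℝ, F) c).symm y)
    obtain ⟨D, hD, hDX⟩ := exists_fundamentalField_eq H hπ c hy ha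
    obtain ⟨w, rfl⟩ := hD.2 v
    obtain ⟨X, rfl⟩ := proj_surjective H hπ w
    refine ⟨adj E a X, ?_⟩
    rw [hTK, hDX, adj_inv_apply_adj]
  have hTd : ∀ y ∈ (extChartAt 𝓘(ℝ, F) c).target, DifferentiableAt ℝ T y := by
    intro y hy
    have h1 : ContDiffAt ℝ ∞ (fderiv ℝ (actChart (1 : G) c c)) (unitCoord E G, y) :=
      (contDiffAt_actChart_unit c hy).fderiv_right (m := ∞) (by simp)
    have h2 : DifferentiableAt ℝ (fun z => fderiv ℝ (actChart (1 : G) c c) (unitCoord E G, z)) y :=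
      DifferentiableAt.comp (f := fun z : F => (unitCoord E G, z)) y
        (h1.differentiableAt (by simp)) (by fun_prop)
    exact h2.clm_comp (differentiableAt_const _)
  set y₀ := extChartAt 𝓘(ℝ, F) c c with hy₀
  have hy₀t : y₀ ∈ (extChartAt 𝓘(ℝ, F) c).target := mem_extChartAt_target _
  obtain ⟨s, hs⟩ := (T y₀).toLinearMap.exists_rightInverse_of_surjective
    (LinearMap.range_eq_top.2 (hsurj y₀ hy₀t))
  set σ : F →L[ℝ] E := LinearMap.toContinuousLinearMap s with hσ
  set N : F → F →L[ℝ] F := fun y => T y ∘L σ with hN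
  have hN0 : N y₀ = ContinuousLinearEquiv.refl ℝ F := by
    ext v
    exact congrArg (fun f : F →ₗ[ℝ] F => f v) hs
  have hNd : ∀ y ∈ (extChartAt 𝓘(ℝ, F) c).target, DifferentiableAt ℝ N y := fun y hy =>
    (hTd y hy).clm_comp (differentiableAt_const _)
  have hinv : ∀ᶠ y in 𝓝 y₀, N y ∈ range ((↑) : (F ≃L[ℝ] F) → F →L[ℝ] F) := by
    refine (hNd y₀ hy₀t).continuousAt.eventually_mem ?_
    rw [hN0]
    exact ContinuousLinearEquiv.nhds _
  obtain ⟨r, hr, hball⟩ := Metric.eventually_nhds_iff_ball.1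
    (hinv.and ((isOpen_extChartAt_target c).mem_nhds hy₀t))
  -- The one-form with `η(X*) = l(X)`. Lifting tangent vectors by `σ ∘ (N y)⁻¹`, where `σ` is a
  -- right inverse of `T` at the centre, shows that it is differentiable.
  set η : F → F →L[ℝ] ℝ := fun y => (l ∘L σ) ∘L (N y).inverse with hη
  have hηd : ∀ y ∈ Metric.ball y₀ r, DifferentiableAt ℝ η y := by
    intro y hy
    obtain ⟨⟨e, he⟩, hyt⟩ := hball y hy
    have h2 : DifferentiableAt ℝ ContinuousLinearMap.inverse (N y) := by
      rw [← he]
      exact (contDiffAt_map_inverse (𝕜 := ℝ) (n := 1) e).differentiableAt (by simp)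
    exact (differentiableAt_const _).clm_comp
      (DifferentiableAt.comp (g := ContinuousLinearMap.inverse) y h2 (hNd y hyt))
  have hηT : ∀ y ∈ Metric.ball y₀ r, ∀ X, η y (T y X) = l X := by
    intro y hy X
    obtain ⟨⟨e, he⟩, hyt⟩ := hball y hy
    have h1 : T y (σ ((N y).inverse (T y X))) = T y X := by
      change N y ((N y).inverse (T y X)) = T y X
      rw [← he, ContinuousLinearMap.inverse_equiv]
      simp
    have h2 := hker y hyt (X - σ ((N y).inverse (T y X))) (by rw [map_sub, h1, sub_self])
    rw [map_sub, sub_eq_zero] at h2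
    exact h2.symm
  -- The form is closed. Differentiating the constant `η(X*) = l(X)` along `Y*` and antisymmetrizing
  -- leaves `η([X, Y]*) = l([X, Y]) = 0`. The Poincaré lemma on a ball then gives the primitive.
  have hsymm : ∀ y ∈ Metric.ball y₀ r, ∀ v w, fderiv ℝ η y v w = fderiv ℝ η y w v := by
    intro y hy v w
    have hyt := (hball y hy).2
    obtain ⟨X, rfl⟩ := hsurj y hyt v
    obtain ⟨Y, rfl⟩ := hsurj y hyt w
    have hd : ∀ X : E, HasFDerivAt (fundamentalField G c X)
        (fderiv ℝ (fundamentalField G c X) y) y := fun X =>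
      ((contDiffAt_fundamentalField H c hyt X).differentiableAt (by simp)).hasFDerivAt
    have key : ∀ (X : E) Z, fderiv ℝ η y Z (T y X) + η y (fderiv ℝ (fundamentalField G c X) y Z) = 0 := by
      intro X Z
      have h1 := (hηd y hy).hasFDerivAt.clm_apply (hd X)
      have h2 := h1.unique ((hasFDerivAt_const (l X) y).congr_of_eventuallyEq (by
        filter_upwards [Metric.isOpen_ball.mem_nhds hy] with z hz
        rw [← hTK]; exact hηT z hz X))
      have h3 := congrArg (fun L => L Z) h2
      simp at h3
      rw [hTK]
      linarith
    have k1 := key X (T y Y)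
    have k2 := key Y (T y X)
    have k3 := fundamentalField_bracket (G := G) c hyt X Y
    have k4 : η y (fundamentalField G c (chartBracket G X Y) y) = 0 := by
      rw [← hTK, hηT y hy, hl]
    rw [k3, map_sub, ← hTK, ← hTK] at k4
    linarith
  obtain ⟨f, hf⟩ := (convex_ball y₀ r).exists_forall_hasFDerivAt_of_fderiv_symmetric
    Metric.isOpen_ball (fun y hy => (hηd y hy).differentiableWithinAt) hsymm
  refine ⟨(extChartAt 𝓘(ℝ, F) c).source ∩ extChartAt 𝓘(ℝ, F) c ⁻¹' Metric.ball y₀ r,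
    fun p => f (extChartAt 𝓘(ℝ, F) c p), ?_, ⟨mem_extChartAt_source _, Metric.mem_ball_self hr⟩, ?_⟩
  · exact (continuousOn_extChartAt c).isOpen_inter_preimage (isOpen_extChartAt_source c)
      Metric.isOpen_ball
  rintro p ⟨hp, hpb⟩
  set y := extChartAt 𝓘(ℝ, F) c p with hy
  have hyt : y ∈ (extChartAt 𝓘(ℝ, F) c).target := (extChartAt 𝓘(ℝ, F) c).map_source hp
  have e1 : HasFDerivAt (fun s => actChart (1 : G) c c (s, y)) (T y)
      (unitCoord E G) := HasFDerivAt.comp (f := fun s => (s, y)) (unitCoord E G)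
    ((contDiffAt_actChart_unit c hyt).differentiableAt
      (by simp)).hasFDerivAt (hasFDerivAt_prodMk_left _ _)
  have e2 : HasFDerivAt f (η y) (actChart (1 : G) c c (unitCoord E G, y)) := by
    rw [actChart_unit c hyt]; exact hf y hpb
  have e3 := HasFDerivAt.comp (unitCoord E G) e2 e1
  have e4 : η y ∘L T y = l := by ext X; exact hηT y hpb X
  rw [e4] at e3
  refine e3.congr_of_eventuallyEq (Eventually.of_forall fun s => ?_)
  simp only [Function.comp, actChart, hy, (extChartAt 𝓘(ℝ, F) c).left_inv hp]

theorem IsPrimitiveAt.sub {l l' : E →L[ℝ] ℝ} {f f' : G ⧸ H → ℝ} {p : G ⧸ H}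
    (h : IsPrimitiveAt H l f p) (h' : IsPrimitiveAt H l' f' p) :
    IsPrimitiveAt H (l - l') (fun q => f q - f' q) p := HasFDerivAt.sub h h'

/-- Orbit maps `a ↦ a • p` are open, so local constancy on `G` descends to `G/H`. -/
theorem eventually_eq_of_isPrimitiveAt_zero {f : G ⧸ H → ℝ} {U : Set (G ⧸ H)} (hU : IsOpen U)
    (hf : ∀ p ∈ U, IsPrimitiveAt H (0 : E →L[ℝ] ℝ) f p) {p : G ⧸ H} (hp : p ∈ U) :
    ∀ᶠ q in 𝓝 p, f q = f p := by
  have : IsTopologicalGroup G := topologicalGroup_of_lieGroup 𝓘(ℝ, E) ∞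
  have hc : ContinuousAt (fun a : G => a • p) 1 := by fun_prop
  have h1 := eventually_eq_of_hasFDerivAt_zero E (u := fun a : G => f (a • p)) (by
    filter_upwards [hc.eventually_mem (hU.mem_nhds (by rwa [one_smul]))] with b hb
    refine (hf _ hb).congr_of_eventuallyEq (Eventually.of_forall fun s => ?_)
    simp only [mul_smul])
  simp only [one_smul] at h1
  exact map_nhds_one_smul_point H p h1

theorem IsPrimitiveAt.continuousAt {l : E →L[ℝ] ℝ} {f : G ⧸ H → ℝ} {p : G ⧸ H}
    (h : IsPrimitiveAt H l f p) : ContinuousAt f p := by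
  have : IsTopologicalGroup G := topologicalGroup_of_lieGroup 𝓘(ℝ, E) ∞
  have h1 : ContinuousAt ((fun s => f ((extChartAt 𝓘(ℝ, E) (1 : G)).symm s • p)) ∘
      extChartAt 𝓘(ℝ, E) (1 : G)) (1 : G) :=
    ContinuousAt.comp (HasFDerivAt.continuousAt h) (continuousAt_extChartAt (1 : G))
  have h2 : ContinuousAt (fun a : G => f (a • p)) 1 := by
    refine h1.congr ?_
    filter_upwards [(isOpen_extChartAt_source (I := 𝓘(ℝ, E)) (1 : G)).mem_nhds
      (mem_extChartAt_source 1)] with a ha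
    simp only [Function.comp, (extChartAt 𝓘(ℝ, E) (1 : G)).left_inv ha]
  rw [ContinuousAt, one_smul] at h2
  exact (tendsto_map'_iff.2 h2).mono_left (map_nhds_one_smul_point H p)

end Primitive

/-! ### Gluing local primitives on a simply connected space -/

section Gluing

/-- The real numbers with the discrete topology. -/
def DiscreteReal : Type := ℝ

instance : AddCommGroup DiscreteReal := inferInstanceAs (AddCommGroup ℝ)

instance : TopologicalSpace DiscreteReal := ⊥

instance : DiscreteTopology DiscreteReal := ⟨rfl⟩

/-- A real number as a discrete real number. -/
def toDiscrete (x : ℝ) : DiscreteReal := x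

variable {M : Type*} [TopologicalSpace M]

/-- The covering space of germs of functions that differ locally from the given ones by
constants. -/
def germCore (U : M → Set M) (hU : ∀ x, IsOpen (U x)) (hx : ∀ x, x ∈ U x) (f : M → M → ℝ)
    (hf : ∀ i j, ∀ x ∈ U i ∩ U j, ∀ᶠ y in 𝓝 x, f i y - f j y = f i x - f j x) :
    FiberBundleCore M M DiscreteReal where
  baseSet := U
  isOpen_baseSet := hU
  indexAt := id
  mem_baseSet_at := hx
  coordChange i j x v := v + toDiscrete (f j x - f i x)
  coordChange_self i x _ v := by
    rw [sub_self]; exact add_zero v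
  continuousOn_coordChange i j := by
    rintro ⟨x, v⟩ ⟨⟨hi, hj⟩, -⟩
    refine ContinuousAt.continuousWithinAt ?_
    refine continuousAt_const.congr (f := fun _ => v + toDiscrete (f j x - f i x)) ?_
    have h2 : ∀ᶠ w in 𝓝 v, w = v := (isOpen_discrete {v}).mem_nhds rfl
    filter_upwards [(hf j i x ⟨hj, hi⟩).prod_inl_nhds v, h2.prod_inr_nhds x] with p hp hp'
    rw [hp, hp']
  coordChange_comp i j k x _ v := by
    rw [add_assoc]
    congr 1
    change (f j x - f i x) + (f k x - f j x) = f k x - f i x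
    ring

/-- On a simply connected space, functions that are given locally up to constants glue. -/
theorem exists_glued_function [SimplyConnectedSpace M] [LocallyPathConnectedSpace M]
    (U : M → Set M) (hU : ∀ x, IsOpen (U x)) (hx : ∀ x, x ∈ U x) (f : M → M → ℝ)
    (hf : ∀ i j, ∀ x ∈ U i ∩ U j, ∀ᶠ y in 𝓝 x, f i y - f j y = f i x - f j x) :
    ∃ φ : M → ℝ, ∀ i, ∀ x ∈ U i, ∀ᶠ y in 𝓝 x, φ y - f i y = φ x - f i x := by
  set Z := germCore U hU hx f hf with hZ
  have hcov : IsCoveringMap (Bundle.TotalSpace.proj : Z.TotalSpace → M) :=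
    FiberBundle.isCoveringMap (F := DiscreteReal)
  obtain ⟨x₀⟩ : Nonempty M := inferInstance
  -- Simple connectedness lifts the identity map to a global section of the covering. In each
  -- trivialization such a section is locally constant, because the fibre is discrete.
  obtain ⟨s, ⟨-, hs⟩, -⟩ := hcov.existsUnique_continuousMap_lifts (ContinuousMap.id M) x₀
    ⟨x₀, toDiscrete 0⟩ rfl
  have hsp : ∀ x, (s x).1 = x := fun x => congrFun hs x
  let v : M → ℝ := fun x => (s x).2
  have hv : ∀ i, ∀ x ∈ U i, ∀ᶠ y in 𝓝 x, v y + (f i y - f y y) = v x + (f i x - f x x) := by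
    intro i x hxi
    have h1 : s x ∈ (Z.localTriv i).source := by
      rw [FiberBundleCore.mem_localTriv_source, hsp]; exact hxi
    have h2 : ContinuousAt (fun y => (Z.localTriv i (s y)).2) x :=
      continuous_snd.continuousAt.comp
        (((Z.localTriv i).toOpenPartialHomeomorph.continuousAt h1).comp s.continuous.continuousAt)
    have h3 : ∀ y, (Z.localTriv i (s y)).2 = toDiscrete (v y + (f i y - f y y)) := by
      intro y
      change toDiscrete (v y + (f i (s y).1 - f (s y).1 (s y).1)) = _
      rw [hsp]
    have h4 := h2.eventually_mem ((isOpen_discrete {(Z.localTriv i (s x)).2}).mem_nhds rfl)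
    filter_upwards [h4] with y hy
    rw [mem_singleton_iff, h3, h3] at hy
    exact hy
  refine ⟨fun x => f x x - v x, fun i x hxi => ?_⟩
  filter_upwards [hv i x hxi] with y hy
  linarith

end Gluing

/-! ### The consequence of simple connectedness -/

section Simply
variable {E : Type*} [NormedAddCommGroup E] [NormedSpace ℝ E] [CompleteSpace E]
  [FiniteDimensional ℝ E]
  {F : Type*} [NormedAddCommGroup F] [InnerProductSpace ℝ F] [FiniteDimensional ℝ F]
  {G : Type*} [TopologicalSpace G] [CompactSpace G] [Group G] [ChartedSpace E G]
  [LieGroup 𝓘(ℝ, E) ∞ G]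
  (H : Subgroup G) [ChartedSpace F (G ⧸ H)] [IsManifold 𝓘(ℝ, F) ∞ (G ⧸ H)]
  [ContMDiffSMul 𝓘(ℝ, E) 𝓘(ℝ, F) ∞ G (G ⧸ H)] [SmoothTranslations F G (G ⧸ H)]

/-- If `G/H` is compact and simply connected, then `𝔤 = 𝔥 + [𝔤, 𝔤]`. -/
theorem functional_eq_zero [SimplyConnectedSpace (G ⧸ H)]
    (hπ : Manifold.IsSubmersion 𝓘(ℝ, E) 𝓘(ℝ, F) ∞ (fun a : G => (a : G ⧸ H)))
    (l : E →L[ℝ] ℝ) (hl : ∀ X Y, l (chartBracket G X Y) = 0)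
    (hlH : ∀ X, proj E F H X = 0 → l X = 0) : l = 0 := by
  have : LocallyPathConnectedSpace (G ⧸ H) := ChartedSpace.locallyPathConnectedSpace F (G ⧸ H)
  choose U f hU hx hf using exists_local_primitive H hπ l hl hlH
  obtain ⟨φ, hφ⟩ := exists_glued_function U hU hx f fun i j x hxij => by
    refine eventually_eq_of_isPrimitiveAt_zero (E := E) H ((hU i).inter (hU j)) (fun p hp => ?_) hxij
    have := IsPrimitiveAt.sub H (hf i p hp.1) (hf j p hp.2)
    rwa [sub_self] at this
  have hprim : ∀ p, IsPrimitiveAt H l φ p := by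
    intro p
    have hc : ContinuousAt (fun s => (extChartAt 𝓘(ℝ, E) (1 : G)).symm s • p) (unitCoord E G) := by
      have : ContinuousSMul G (G ⧸ H) := ContMDiffSMul.continuousSMul (I := 𝓘(ℝ, E))
        (I' := 𝓘(ℝ, F)) ∞
      exact (continuousAt_extChartAt_symm (1 : G)).smul continuousAt_const
    have h1 : HasFDerivAt (fun s => f p ((extChartAt 𝓘(ℝ, E) (1 : G)).symm s • p) +
      (φ p - f p p)) l (unitCoord E G) := HasFDerivAt.add_const (φ p - f p p) (hf p p (hx p))
    refine h1.congr_of_eventuallyEq ?_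
    have h2 := hφ p p (hx p)
    have h3 := hc.eventually (p := fun q => φ q - f p q = φ p - f p p) (by
      simp only [symm_unitCoord, one_smul]; exact h2)
    filter_upwards [h3] with s hs
    linarith
  have hcont : Continuous φ := continuous_iff_continuousAt.2 fun p => (hprim p).continuousAt
  -- The global primitive has derivative `l` along the orbit at every point, and this derivative
  -- vanishes at a maximum.
  obtain ⟨p, -, hp⟩ := isCompact_univ.exists_isMaxOn univ_nonempty hcont.continuousOn
  refine IsLocalMax.hasFDerivAt_eq_zero (Eventually.of_forall fun s => ?_) (hprim p)
  simp only [symm_unitCoord, one_smul]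
  exact hp (mem_univ _)

end Simply

/-! ### The toric moment map -/

section Toric
variable {ι κ : Type*} [Fintype ι] [Fintype κ] (c : κ → ℝ) (α : κ → ι → ℝ)

/-- The weight `α` at `t`. -/
def pairing (a t : ι → ℝ) : ℝ := ∑ i, a i * t i

theorem pairing_add (a t u : ι → ℝ) : pairing a (t + u) = pairing a t + pairing a u := by
  simp [pairing, mul_add, Finset.sum_add_distrib]

theorem pairing_smul (a t : ι → ℝ) (r : ℝ) : pairing a (r • t) = r * pairing a t := by
  simp only [pairing, Finset.mul_sum, Pi.smul_apply, smul_eq_mul]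
  exact Finset.sum_congr rfl fun i _ => by ring

theorem pairing_sub (a t u : ι → ℝ) : pairing a (t - u) = pairing a t - pairing a u := by
  simp [pairing, mul_sub, Finset.sum_sub_distrib]

theorem pairing_sum (q : κ → ℝ) (u : ι → ℝ) :
    pairing (∑ w, q w • α w) u = ∑ w, q w * pairing (α w) u := by
  simp only [pairing, Finset.sum_apply, Pi.smul_apply, smul_eq_mul, Finset.sum_mul, Finset.mul_sum]
  rw [Finset.sum_comm]
  exact Finset.sum_congr rfl fun i _ => Finset.sum_congr rfl fun i _ => by ring

theorem eq_zero_of_pairing_self {a : ι → ℝ} (h : pairing a a = 0) : a = 0 := by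
  rw [pairing, Finset.sum_eq_zero_iff_of_nonneg fun i _ => mul_self_nonneg _] at h
  ext i
  exact mul_self_eq_zero.1 (h i (Finset.mem_univ i))

/-- The toric moment map. -/
def toricMoment (t : ι → ℝ) : ι → ℝ := ∑ w, (c w * Real.exp (- pairing (α w) t)) • α w

theorem contDiff_pairing (a : ι → ℝ) : ContDiff ℝ ∞ (pairing a) := by
  unfold pairing; fun_prop

theorem contDiff_toricMoment : ContDiff ℝ ∞ (toricMoment c α) := by
  have := fun w => contDiff_pairing (α w)
  unfold toricMoment
  refine ContDiff.sum fun w _ => ?_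
  have h : ContDiff ℝ ∞ fun t => c w * Real.exp (- pairing (α w) t) :=
    contDiff_const.mul (Real.contDiff_exp.comp (this w).neg)
  exact h.smul (contDiff_const (c := α w))

variable {c α}

theorem hasFDerivAt_pairing (a t : ι → ℝ) :
    ∃ L : (ι → ℝ) →L[ℝ] ℝ, (∀ u, L u = pairing a u) ∧ HasFDerivAt (pairing a) L t := by
  have h := ((contDiff_pairing a).differentiable (by simp)).differentiableAt (x := t)
  refine ⟨fderiv ℝ (pairing a) t, fun u => ?_, h.hasFDerivAt⟩
  let L : (ι → ℝ) →ₗ[ℝ] ℝ :=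
    { toFun := pairing a
      map_add' := pairing_add a
      map_smul' := fun r t => pairing_smul a t r }
  have h1 : HasFDerivAt (pairing a) (LinearMap.toContinuousLinearMap L) t :=
    (LinearMap.toContinuousLinearMap L).hasFDerivAt
  rw [h1.fderiv]
  rfl

theorem fderiv_toricMoment_apply (t u : ι → ℝ) : fderiv ℝ (toricMoment c α) t u =
    ∑ w, (- (c w * Real.exp (- pairing (α w) t) * pairing (α w) u)) • α w := by
  have h : ∀ w, HasFDerivAt (fun t => (c w * Real.exp (- pairing (α w) t)) • α w)
      ((-(c w * Real.exp (- pairing (α w) t)) •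
        (hasFDerivAt_pairing (α w) t).choose).smulRight (α w)) t := by
    intro w
    have hd := (hasFDerivAt_pairing (α w) t).choose_spec.2
    have h1 : HasFDerivAt (fun t => c w * Real.exp (- pairing (α w) t))
        (-(c w * Real.exp (- pairing (α w) t)) • (hasFDerivAt_pairing (α w) t).choose) t := by
      refine (hd.neg.exp.const_mul (c w)).congr_fderiv ?_
      ext u
      simp [mul_assoc]
    exact h1.smul_const (α w)
  have h3 : HasFDerivAt (toricMoment c α) _ t :=
    HasFDerivAt.fun_sum (u := Finset.univ) fun w _ => h w
  rw [h3.fderiv, sum_apply]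
  refine Finset.sum_congr rfl fun w _ => ?_
  have hL := (hasFDerivAt_pairing (α w) t).choose_spec.1 u
  simp [hL]

/-- The map is minus the gradient of the convex function `∑ c_w exp(-⟨α_w, ·⟩)`. Pairing a
difference of values with `t - t'` gives a sum of terms of one sign, which can vanish only if every
weight annihilates `t - t'`. -/
theorem toricMoment_injective (hc : ∀ w, 0 < c w)
    (hα : ∀ t, (∀ w, pairing (α w) t = 0) → t = 0)
    : Function.Injective (toricMoment c α) := by
  intro t t' h
  have h1 : ∀ u, pairing (toricMoment c α u) (t - t') =
      ∑ w, c w * Real.exp (- pairing (α w) u) * pairing (α w) (t - t') := fun u =>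
    pairing_sum α _ _
  have h2 : ∑ w, c w * ((Real.exp (- pairing (α w) t') - Real.exp (- pairing (α w) t)) *
      (pairing (α w) t - pairing (α w) t')) = 0 := by
    have e : pairing (toricMoment c α t') (t - t') - pairing (toricMoment c α t) (t - t') = 0 := by
      rw [h, sub_self]
    rw [h1, h1, ← Finset.sum_sub_distrib] at e
    rw [← e]
    refine Finset.sum_congr rfl fun w _ => ?_
    rw [pairing_sub]; ring
  have h3 : ∀ a b : ℝ, 0 ≤ (Real.exp (-b) - Real.exp (-a)) * (a - b) := by
    intro a b
    rcases le_total a b with hab | hab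
    · exact mul_nonneg_of_nonpos_of_nonpos
        (sub_nonpos.2 (Real.exp_le_exp.2 (neg_le_neg hab))) (sub_nonpos.2 hab)
    · exact mul_nonneg (sub_nonneg.2 (Real.exp_le_exp.2 (neg_le_neg hab))) (sub_nonneg.2 hab)
  rw [Finset.sum_eq_zero_iff_of_nonneg fun w _ => mul_nonneg (hc w).le (h3 _ _)] at h2
  refine sub_eq_zero.1 (hα _ fun w => ?_)
  rw [pairing_sub]
  rcases mul_eq_zero.1 (h2 w (Finset.mem_univ w)) with h4 | h4
  · exact absurd h4 (hc w).ne'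
  · rcases mul_eq_zero.1 h4 with h5 | h5
    · have := Real.exp_injective (sub_eq_zero.1 h5)
      linarith
    · exact h5

/-- The derivative is minus the form `∑ c_w exp(-⟨α_w, t⟩) α_w ⊗ α_w`, which is definite because the
weights span. -/
theorem isInvertible_fderiv_toricMoment (hc : ∀ w, 0 < c w)
    (hα : ∀ t, (∀ w, pairing (α w) t = 0) → t = 0)
    (t : ι → ℝ) :
    ∃ e : (ι → ℝ) ≃L[ℝ] (ι → ℝ), (e : (ι → ℝ) →L[ℝ] (ι → ℝ)) = fderiv ℝ (toricMoment c α) t := by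
  have hinj : Function.Injective (fderiv ℝ (toricMoment c α) t) := by
    rw [injective_iff_map_eq_zero]
    intro u hu
    have h1 : pairing (fderiv ℝ (toricMoment c α) t u) u = 0 := by rw [hu]; simp [pairing]
    rw [fderiv_toricMoment_apply, pairing_sum] at h1
    have h2 : ∑ w, c w * Real.exp (- pairing (α w) t) * pairing (α w) u ^ 2 = 0 := by
      rw [← neg_eq_zero, ← h1, ← Finset.sum_neg_distrib]
      exact Finset.sum_congr rfl fun w _ => by ring
    rw [Finset.sum_eq_zero_iff_of_nonneg fun w _ => by have := hc w; positivity] at h2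
    refine hα u fun w => ?_
    have h3 := h2 w (Finset.mem_univ w)
    have h4 := hc w
    have h5 := Real.exp_pos (- pairing (α w) t)
    simpa [h4.ne', h5.ne'] using h3
  refine ⟨(LinearEquiv.ofInjectiveEndo (fderiv ℝ (toricMoment c α) t).toLinearMap
    hinj).toContinuousLinearEquiv, ?_⟩
  ext u
  rfl

/-- Growth in both directions: for `s ≥ 0` the linear term suffices, and for `s ≤ 0` the exponential
is at least `s² / 2`, where completing the square produces the constant `2 p² / c`. -/
theorem exp_neg_add_lower_bound {c p : ℝ} (hc : 0 < c) (hp : 0 < p) (s : ℝ) :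
    p * |s| - 2 * p ^ 2 / c ≤ c * Real.exp (-s) + p * s := by
  rcases le_total 0 s with h | h
  · rw [abs_of_nonneg h]
    have : 0 ≤ 2 * p ^ 2 / c := by positivity
    have := mul_pos hc (Real.exp_pos (-s))
    linarith
  · rw [abs_of_nonpos h]
    have h1 : (-s) ^ 2 / 2 ≤ Real.exp (-s) := by
      have := Real.quadratic_le_exp_of_nonneg (neg_nonneg.2 h)
      linarith
    have h2 : c * ((-s) ^ 2 / 2) ≤ c * Real.exp (-s) := mul_le_mul_of_nonneg_left h1 hc.le
    have h3 : 0 ≤ c / 2 * (s + 2 * p / c) ^ 2 := by positivity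
    have h4 : c / 2 * (s + 2 * p / c) ^ 2 = c * ((-s) ^ 2 / 2) + 2 * p * s + 2 * p ^ 2 / c := by
      field_simp
      ring
    linarith

/-- The function `φ(t) = ∑ (c_w exp(-⟨α_w, t⟩) + p_w ⟨α_w, t⟩)` has the gradient `∑ (p_w - c_w
exp(-⟨α_w, t⟩)) α_w`. It tends to infinity, since `p_w > 0` and the weights span, so it has a
minimum, and there the equation holds. -/
theorem exists_toricMoment_eq (hc : ∀ w, 0 < c w)
    (hα : ∀ t, (∀ w, pairing (α w) t = 0) → t = 0)
    {p : κ → ℝ} (hp : ∀ w, 0 < p w) :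
    ∃ t, toricMoment c α t = ∑ w, p w • α w := by
  set φ : (ι → ℝ) → ℝ := fun t =>
    ∑ w, (c w * Real.exp (- pairing (α w) t) + p w * pairing (α w) t) with hφ
  have hd : ∀ t, HasFDerivAt φ (∑ w, (- (c w * Real.exp (- pairing (α w) t)) + p w) •
      (hasFDerivAt_pairing (α w) t).choose) t := by
    intro t
    refine HasFDerivAt.fun_sum fun w _ => ?_
    have h := (hasFDerivAt_pairing (α w) t).choose_spec.2
    refine ((h.neg.exp.const_mul (c w)).add (h.const_mul (p w))).congr_fderiv ?_
    ext u
    simp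
    ring
  let Λ : (ι → ℝ) →ₗ[ℝ] (κ → ℝ) :=
    { toFun := fun t w => p w * pairing (α w) t
      map_add' := fun t u => by ext w; simp [pairing_add, mul_add]
      map_smul' := fun r t => by ext w; simp [pairing_smul]; ring }
  have hΛ : LinearMap.ker Λ = ⊥ := by
    rw [LinearMap.ker_eq_bot']
    intro t ht
    refine hα t fun w => ?_
    have := congrFun ht w
    simpa [Λ, (hp w).ne'] using this
  obtain ⟨K, hK, hanti⟩ := Λ.exists_antilipschitzWith hΛ
  have hbound : ∀ t, ‖Λ t‖ - ∑ w, 2 * p w ^ 2 / c w ≤ φ t := by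
    intro t
    have h1 : ‖Λ t‖ ≤ ∑ w, p w * |pairing (α w) t| := by
      refine (pi_norm_le_iff_of_nonneg (Finset.sum_nonneg fun w _ =>
        mul_nonneg (hp w).le (abs_nonneg _))).2 fun w => ?_
      have h2 : ‖Λ t w‖ = p w * |pairing (α w) t| := by
        simp [Λ, abs_of_pos (hp w)]
      rw [h2]
      exact Finset.single_le_sum (f := fun w => p w * |pairing (α w) t|)
        (fun w _ => mul_nonneg (hp w).le (abs_nonneg _)) (Finset.mem_univ w)
    have h3 : ∑ w, p w * |pairing (α w) t| - ∑ w, 2 * p w ^ 2 / c w ≤ φ t := by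
      rw [← Finset.sum_sub_distrib]
      exact Finset.sum_le_sum fun w _ => exp_neg_add_lower_bound (hc w) (hp w) _
    linarith
  have htend : Tendsto φ (cocompact (ι → ℝ)) atTop := by
    refine tendsto_atTop_mono hbound ?_
    refine tendsto_atTop_add_const_right _ _ ?_
    exact tendsto_norm_cocompact_atTop.comp
      (hanti.tendsto_cobounded.mono_left Metric.cobounded_eq_cocompact.ge |>.mono_right
        Metric.cobounded_eq_cocompact.le)
  have hcont : Continuous φ := continuous_iff_continuousAt.2 fun t => (hd t).continuousAt
  obtain ⟨t, ht⟩ := hcont.exists_forall_le htend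
  refine ⟨t, ?_⟩
  have h0 := IsLocalMin.hasFDerivAt_eq_zero (Eventually.of_forall ht) (hd t)
  refine (sub_eq_zero.1 (eq_zero_of_pairing_self ?_)).symm
  rw [toricMoment, ← Finset.sum_sub_distrib]
  simp_rw [← sub_smul]
  rw [pairing_sum]
  have h1 := fun u => congrArg (fun L : (ι → ℝ) →L[ℝ] ℝ => L u) h0
  simp only [sum_apply, smul_apply, zero_apply, smul_eq_mul] at h1
  have h2 := h1 (∑ w, (p w - c w * Real.exp (- pairing (α w) t)) • α w)
  rw [← h2]
  refine Finset.sum_congr rfl fun w _ => ?_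
  rw [(hasFDerivAt_pairing (α w) t).choose_spec.1]
  ring

/-- The inverse of the toric moment map. -/
def toricInverse (c : κ → ℝ) (α : κ → ι → ℝ) : (ι → ℝ) → ι → ℝ :=
  Function.invFun (toricMoment c α)

theorem toricInverse_toricMoment (hc : ∀ w, 0 < c w)
    (hα : ∀ t, (∀ w, pairing (α w) t = 0) → t = 0)
    (t : ι → ℝ) : toricInverse c α (toricMoment c α t) = t :=
  Function.leftInverse_invFun (toricMoment_injective hc hα) t

/-- The inverse function theorem; by injectivity the global inverse agrees with the local one near
the value. -/
theorem contDiffAt_toricInverse (hc : ∀ w, 0 < c w)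
    (hα : ∀ t, (∀ w, pairing (α w) t = 0) → t = 0)
    (t : ι → ℝ) :
    ContDiffAt ℝ ∞ (toricInverse c α) (toricMoment c α t) := by
  obtain ⟨e, he⟩ := isInvertible_fderiv_toricMoment hc hα t
  have h1 : ContDiffAt ℝ ∞ (toricMoment c α) t := (contDiff_toricMoment c α).contDiffAt
  have h2 : HasFDerivAt (toricMoment c α) (e : (ι → ℝ) →L[ℝ] (ι → ℝ)) t := by
    rw [he]; exact (h1.differentiableAt (by simp)).hasFDerivAt
  refine (h1.to_localInverse h2 (by simp)).congr_of_eventuallyEq ?_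
  have h3 := (h1.hasStrictFDerivAt' h2 (by simp)).eventually_right_inverse
  filter_upwards [h3] with q hq
  conv_lhs => rw [← hq]
  exact toricInverse_toricMoment hc hα _

theorem toricMoment_add_const (hsum : ∀ w, ∑ i, α w i = 1) (t : ι → ℝ) (r : ℝ) :
    toricMoment c α (t + fun _ => r) = Real.exp (-r) • toricMoment c α t := by
  rw [toricMoment, toricMoment, Finset.smul_sum]
  refine Finset.sum_congr rfl fun w _ => ?_
  have h : pairing (α w) (fun _ => r) = r := by
    rw [pairing, ← Finset.sum_mul, hsum, one_mul]
  rw [pairing_add, h, smul_smul, neg_add, Real.exp_add]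
  congr 1
  ring

theorem sum_toricMoment (hsum : ∀ w, ∑ i, α w i = 1) (t : ι → ℝ) :
    ∑ i, toricMoment c α t i = ∑ w, c w * Real.exp (- pairing (α w) t) := by
  simp only [toricMoment, Finset.sum_apply, Pi.smul_apply, smul_eq_mul]
  rw [Finset.sum_comm]
  simp_rw [← Finset.mul_sum, hsum, mul_one]

end Toric

/-! ### Relative interior and dimension of polytopes -/

section Polytope
variable {W : Type*} [NormedAddCommGroup W] [NormedSpace ℝ W]

theorem mem_intrinsicInterior_iff {S : Set W} {x : W} :
    x ∈ intrinsicInterior ℝ S ↔ x ∈ affineSpan ℝ S ∧ ∃ r > 0, ∀ y ∈ affineSpan ℝ S,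
      dist y x < r → y ∈ S := by
  rw [mem_intrinsicInterior]
  constructor
  · rintro ⟨z, hz, rfl⟩
    refine ⟨z.2, ?_⟩
    rw [mem_interior_iff_mem_nhds, Metric.mem_nhds_iff] at hz
    obtain ⟨r, hr, h⟩ := hz
    exact ⟨r, hr, fun y hy hyz => @h ⟨y, hy⟩ hyz⟩
  · rintro ⟨hx, r, hr, h⟩
    refine ⟨⟨x, hx⟩, ?_, rfl⟩
    rw [mem_interior_iff_mem_nhds, Metric.mem_nhds_iff]
    exact ⟨r, hr, fun y hy => h y y.2 hy⟩

variable {κ : Type*} [Fintype κ]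

theorem mem_convexHull_range_iff (w : κ → W) (x : W) :
    x ∈ convexHull ℝ (range w) ↔ ∃ p : κ → ℝ, (∀ k, 0 ≤ p k) ∧ ∑ k, p k = 1 ∧
      ∑ k, p k • w k = x := by
  rw [convexHull_range_eq_exists_affineCombination]
  constructor
  · rintro ⟨s, p, h0, h1, rfl⟩
    classical
    refine ⟨fun k => if k ∈ s then p k else 0, fun k => ?_, ?_, ?_⟩
    · simp only
      split_ifs with h
      · exact h0 k h
      · exact le_rfl
    · simpa using h1
    · rw [Finset.affineCombination_eq_linear_combination _ _ _ h1]
      simp [ite_smul]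
  · rintro ⟨p, h0, h1, rfl⟩
    exact ⟨Finset.univ, p, fun k _ => h0 k, h1,
      Finset.affineCombination_eq_linear_combination _ _ _ h1⟩

/-- The relative interior of a polytope. -/
theorem intrinsicInterior_convexHull_range [Nonempty κ] (w : κ → W) :
    intrinsicInterior ℝ (convexHull ℝ (range w)) =
      {x | ∃ p : κ → ℝ, (∀ k, 0 < p k) ∧ ∑ k, p k = 1 ∧ ∑ k, p k • w k = x} := by
  have hcard : (0 : ℝ) < Fintype.card κ := by exact_mod_cast Fintype.card_pos
  have hsub : ∀ p : κ → ℝ, ∑ k, p k = 1 → ∑ k, p k • w k ∈ affineSpan ℝ (range w) := by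
    intro p hp
    rw [← Finset.affineCombination_eq_linear_combination Finset.univ w p hp]
    exact affineCombination_mem_affineSpan hp w
  ext x
  rw [mem_intrinsicInterior_iff, affineSpan_convexHull]
  constructor
  · rintro ⟨hx, r, hr, h⟩
    set b : W := ∑ k : κ, (Fintype.card κ : ℝ)⁻¹ • w k with hb
    have hbs : ∑ _k : κ, (Fintype.card κ : ℝ)⁻¹ = 1 := by
      simp [hcard.ne']
    have hbm : b ∈ affineSpan ℝ (range w) := hsub _ hbs
    -- The point `x` is moved a little away from the barycentre `b`, staying in the polytope. Then
    -- `x` is a convex combination of the new point and `b`, and the share of `b` makes all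
    -- coefficients positive.
    obtain ⟨ε, hε, hεr⟩ : ∃ ε : ℝ, 0 < ε ∧ ε * ‖x - b‖ < r := by
      refine ⟨r / (2 * (‖x - b‖ + 1)), by positivity, ?_⟩
      rw [div_mul_eq_mul_div, div_lt_iff₀ (by positivity)]
      nlinarith [norm_nonneg (x - b)]
    have hy : AffineMap.lineMap b x (1 + ε) ∈ affineSpan ℝ (range w) :=
      AffineMap.lineMap_mem _ hbm hx
    have hyx : AffineMap.lineMap b x (1 + ε) = x + ε • (x - b) := by
      rw [AffineMap.lineMap_apply, vsub_eq_sub, vadd_eq_add, add_smul, one_smul]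
      abel
    rw [hyx] at hy
    have h1 := h _ hy (by
      rw [dist_eq_norm, add_sub_cancel_left, norm_smul, Real.norm_of_nonneg hε.le]
      exact hεr)
    obtain ⟨q, hq0, hq1, hq⟩ := (mem_convexHull_range_iff w _).1 h1
    refine ⟨fun k => (1 + ε)⁻¹ * (q k + ε * (Fintype.card κ : ℝ)⁻¹), fun k => ?_, ?_, ?_⟩
    · have := hq0 k
      positivity
    · rw [← Finset.mul_sum, Finset.sum_add_distrib, hq1, ← Finset.mul_sum, hbs, mul_one]
      exact inv_mul_cancel₀ (by positivity)
    · simp_rw [mul_smul, add_smul, mul_smul]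
      rw [← Finset.smul_sum, Finset.sum_add_distrib, ← Finset.smul_sum, hq, ← hb]
      have : x + ε • (x - b) + ε • b = (1 + ε) • x := by
        rw [smul_sub, add_smul, one_smul]; abel
      rw [this, smul_smul, inv_mul_cancel₀ (by positivity), one_smul]
  · rintro ⟨p, hp0, hp1, rfl⟩
    refine ⟨hsub p hp1, ?_⟩
    -- coordinates of nearby points depend linearly on the point
    let Q : Submodule ℝ (κ → ℝ) := LinearMap.ker (∑ k, LinearMap.proj (R := ℝ) (φ := fun _ => ℝ) k)
    have hQs : ∀ q : Q, ∑ k, (q : κ → ℝ) k = 0 := by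
      intro q
      have := LinearMap.mem_ker.1 q.2
      simpa only [LinearMap.sum_apply, LinearMap.proj_apply] using this
    let Θ₀ : (κ → ℝ) →ₗ[ℝ] W := Fintype.linearCombination ℝ w
    have hdir : ∀ v ∈ vectorSpan ℝ (range w), ∃ q : κ → ℝ, ∑ k, q k = 0 ∧
        ∑ k, q k • w k = v := by
      intro v hv
      obtain ⟨k₀⟩ := ‹Nonempty κ›
      rw [vectorSpan_range_eq_span_range_vsub_right ℝ w k₀] at hv
      obtain ⟨q, rfl⟩ := (Submodule.mem_span_range_iff_exists_fun ℝ).1 hv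
      classical
      -- The correction at `k₀` makes the coefficients sum to `0`; it does not change the vector,
      -- since the `k₀` difference is zero.
      refine ⟨q - Pi.single k₀ (∑ k, q k), ?_, ?_⟩
      · simp
      · simp [sub_smul, smul_sub, Finset.sum_sub_distrib, Finset.sum_smul, Pi.single_apply,
          ite_smul]
    let D := vectorSpan ℝ (range w)
    have : FiniteDimensional ℝ D :=
      finiteDimensional_vectorSpan_of_finite ℝ (finite_range w)
    have hQ : ∀ q : Q, Θ₀ q ∈ D := by
      intro q
      have hq := hQs q
      obtain ⟨k₀⟩ := ‹Nonempty κ›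
      have : Θ₀ q = ∑ k, (q : κ → ℝ) k • (w k - w k₀) := by
        simp [Θ₀, Fintype.linearCombination_apply, smul_sub, Finset.sum_sub_distrib,
          ← Finset.sum_smul, hq]
      rw [this]
      exact Submodule.sum_mem _ fun k _ => Submodule.smul_mem _ _
        (vsub_mem_vectorSpan ℝ (mem_range_self k) (mem_range_self k₀))
    let Θ : Q →L[ℝ] D := LinearMap.toContinuousLinearMap
      ((Θ₀ ∘ₗ Q.subtype).codRestrict D hQ)
    have hΘv : ∀ q : Q, ((Θ q : D) : W) = ∑ k, (q : κ → ℝ) k • w k := by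
      intro q
      change Θ₀ q = _
      rw [Fintype.linearCombination_apply]
    have hΘ : Function.Surjective Θ := by
      rintro ⟨v, hv⟩
      obtain ⟨q, hq, hqv⟩ := hdir v hv
      refine ⟨⟨q, by simpa [Q] using hq⟩, Subtype.ext ?_⟩
      rw [hΘv]
      exact hqv
    -- A displacement shorter than `δ / C` is realized by changing each coefficient by less than `δ
    -- ≤ p k`, so that the coefficients stay positive.
    obtain ⟨C, hC, hpre⟩ := Θ.exists_preimage_norm_le hΘ
    obtain ⟨δ, hδ, hδp⟩ : ∃ δ > 0, ∀ k, δ ≤ p k := by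
      obtain ⟨k₀, hk₀⟩ := Finite.exists_min p
      exact ⟨p k₀, hp0 k₀, hk₀⟩
    refine ⟨δ / C, by positivity, fun y hy hdist => ?_⟩
    have hyd : y - ∑ k, p k • w k ∈ D := by
      have := AffineSubspace.vsub_mem_direction hy (hsub p hp1)
      rwa [direction_affineSpan] at this
    obtain ⟨q, hq, hqn⟩ := hpre ⟨_, hyd⟩
    have hqs := hQs q
    have hqv : ∑ k, (q : κ → ℝ) k • w k = y - ∑ k, p k • w k :=
      (hΘv q).symm.trans (congrArg Subtype.val hq)
    rw [mem_convexHull_range_iff]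
    refine ⟨fun k => p k + (q : κ → ℝ) k, fun k => ?_, ?_, ?_⟩
    · have h1 : ‖(q : κ → ℝ) k‖ ≤ ‖q‖ := norm_le_pi_norm (q : κ → ℝ) k
      have h2 : ‖(⟨_, hyd⟩ : D)‖ = dist y (∑ k, p k • w k) := by
        rw [dist_eq_norm]; rfl
      rw [h2] at hqn
      have h3 : C * dist y (∑ k, p k • w k) < δ := by
        rw [lt_div_iff₀ hC] at hdist; linarith
      have h4 := neg_abs_le ((q : κ → ℝ) k)
      rw [Real.norm_eq_abs] at h1
      linarith [hδp k]
    · rw [Finset.sum_add_distrib, hp1, hqs, add_zero]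
    · simp_rw [add_smul]
      rw [Finset.sum_add_distrib, hqv]
      abel

/-- The dimension of a polytope whose vertices span and lie on an affine hyperplane. -/
theorem finrank_vectorSpan_convexHull {d : ℕ} [Nonempty κ] (α : κ → Fin d → ℝ)
    (hα : ∀ t, (∀ w, pairing (α w) t = 0) → t = 0) (hsum : ∀ w, ∑ i, α w i = 1)
    (J : (Fin d → ℝ) →ₗ[ℝ] W) (hJ : Function.Injective J) :
    Module.finrank ℝ (vectorSpan ℝ (convexHull ℝ (range fun w => J (α w)))) = d - 1 := by
  obtain ⟨k₀⟩ := ‹Nonempty κ›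
  have hd : 0 < d := by
    rcases Nat.eq_zero_or_pos d with h | h
    · subst h
      simpa using hsum k₀
    · exact h
  have hspan : Submodule.span ℝ (range α) = ⊤ := by
    by_contra hne
    obtain ⟨f, hf, hf0⟩ := Submodule.exists_le_ker_of_lt_top _ (lt_top_iff_ne_top.2 hne)
    refine hf ?_
    have hrep : ∀ a : Fin d → ℝ, f a = pairing a (fun i => f (Pi.single i 1)) := by
      intro a
      conv_lhs => rw [pi_eq_sum_univ' a]
      simp [pairing, map_sum]
    have h0 := hα (fun i => f (Pi.single i 1)) fun w => by
      rw [← hrep]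
      exact hf0 (Submodule.subset_span (mem_range_self w))
    ext i
    simpa using congrFun h0 i
  let s : (Fin d → ℝ) →ₗ[ℝ] ℝ := ∑ i, LinearMap.proj (R := ℝ) (φ := fun _ => ℝ) i
  have hs : ∀ a, s a = ∑ i, a i := fun a => by simp [s]
  -- Since the weights span and lie on the hyperplane of coordinate sum `1`, their differences span
  -- the hyperplane of sum `0`.
  have hker : vectorSpan ℝ (range α) = LinearMap.ker s := by
    apply le_antisymm
    · rw [vectorSpan_range_eq_span_range_vsub_right ℝ α k₀, Submodule.span_le]
      rintro _ ⟨k, rfl⟩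
      rw [SetLike.mem_coe, LinearMap.mem_ker]
      change s (α k - α k₀) = 0
      rw [map_sub, hs, hs, hsum, hsum, sub_self]
    · intro a ha
      have ha' : a ∈ Submodule.span ℝ (range α) := hspan ▸ Submodule.mem_top
      obtain ⟨q, rfl⟩ := (Submodule.mem_span_range_iff_exists_fun ℝ).1 ha'
      have hq : ∑ k, q k = 0 := by
        rw [LinearMap.mem_ker, map_sum] at ha
        simp only [map_smul] at ha
        simpa only [hs, hsum, smul_eq_mul, mul_one] using ha
      have : ∑ k, q k • α k = ∑ k, q k • (α k - α k₀) := by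
        simp [smul_sub, Finset.sum_sub_distrib, ← Finset.sum_smul, hq]
      rw [this]
      exact Submodule.sum_mem _ fun k _ => Submodule.smul_mem _ _
        (vsub_mem_vectorSpan ℝ (mem_range_self k) (mem_range_self k₀))
  have hrange : range (fun w => J (α w)) = J.toAffineMap '' range α := by
    rw [← range_comp]; rfl
  rw [← direction_affineSpan, affineSpan_convexHull, direction_affineSpan, hrange,
    ← AffineMap.map_vectorSpan, hker]
  have h1 : Module.finrank ℝ (Submodule.map J (LinearMap.ker s)) =
      Module.finrank ℝ (LinearMap.ker s) :=
    (Submodule.equivMapOfInjective J hJ (LinearMap.ker s)).finrank_eq.symm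
  have h2 := s.finrank_range_add_finrank_ker
  have h3 : LinearMap.range s = ⊤ := by
    rw [LinearMap.range_eq_top]
    intro r
    exact ⟨Pi.single ⟨0, hd⟩ r, by simp [hs]⟩
  rw [h3, finrank_top] at h2
  simp at h2
  refine h1.trans ?_
  omega

end Polytope

/-! ### Gram determinants and volume densities -/

section Gram
variable {F : Type*} [NormedAddCommGroup F] [InnerProductSpace ℝ F] [FiniteDimensional ℝ F]

/-- The Gram determinant of a bilinear form in the standard orthonormal basis. -/
def gramDet (g : Form F) : ℝ :=
  Matrix.det (Matrix.of fun i j : Fin (Module.finrank ℝ F) =>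
    g (stdOrthonormalBasis ℝ F i) (stdOrthonormalBasis ℝ F j))

theorem det_form_comp {n : ℕ} (b : Module.Basis (Fin n) ℝ F) (g : Form F) (L : F →ₗ[ℝ] F) :
    Matrix.det (Matrix.of fun i j => g (L (b i)) (L (b j))) =
      LinearMap.det L ^ 2 * Matrix.det (Matrix.of fun i j => g (b i) (b j)) := by
  let B : F →ₗ[ℝ] F →ₗ[ℝ] ℝ := (ContinuousLinearMap.coeLM ℝ) ∘ₗ g.toLinearMap
  have h1 := LinearMap.toMatrix₂_compl₁₂ b b b b B L L
  have h2 : (Matrix.of fun i j => g (L (b i)) (L (b j))) =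
      LinearMap.toMatrix₂ b b (B.compl₁₂ L L) := by
    ext i j
    rw [LinearMap.toMatrix₂_apply]; rfl
  have h3 : (Matrix.of fun i j => g (b i) (b j)) = LinearMap.toMatrix₂ b b B := by
    ext i j
    rw [LinearMap.toMatrix₂_apply]; rfl
  rw [h2, h1, h3, Matrix.det_mul, Matrix.det_mul, Matrix.det_transpose, LinearMap.det_toMatrix]
  ring

theorem gramDet_comp {g g' : Form F} {L : F →ₗ[ℝ] F} (h : ∀ v w, g' v w = g (L v) (L w)) :
    gramDet g' = LinearMap.det L ^ 2 * gramDet g := by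
  have := det_form_comp (stdOrthonormalBasis ℝ F).toBasis g L
  simp only [OrthonormalBasis.coe_toBasis] at this
  rw [gramDet, gramDet, ← this]
  simp only [h]

theorem gramDet_pos {g : Form F} (hs : ∀ u v, g u v = g v u) (hp : ∀ v, v ≠ 0 → 0 < g v v) :
    0 < gramDet g := by
  obtain ⟨e, he⟩ := exists_isOrthonormalBasis hs hp
  set b := (stdOrthonormalBasis ℝ F).toBasis with hb
  have h1 := det_form_comp b g (b.constr ℝ e)
  have h2 : (Matrix.of fun i j => g (b.constr ℝ e (b i)) (b.constr ℝ e (b j))) = 1 := by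
    ext i j
    rw [Matrix.of_apply, Module.Basis.constr_basis, Module.Basis.constr_basis, he,
      Matrix.one_apply]
  rw [h2, Matrix.det_one] at h1
  have h3 : gramDet g = Matrix.det (Matrix.of fun i j => g (b i) (b j)) := by
    rw [gramDet]; simp [hb]
  rw [← h3] at h1
  have h4 : 0 ≤ LinearMap.det (b.constr ℝ e) ^ 2 := sq_nonneg _
  by_contra hneg
  nlinarith [mul_nonneg h4 (neg_nonneg.2 (not_lt.1 hneg))]

theorem density_eq_sqrt_gramDet (g : F → Form F) (y : F) :
    density g y = Real.sqrt (gramDet (g y)) := rfl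

theorem density_comp {g g' : F → Form F} {y y' : F} {L : F →L[ℝ] F}
    (h : ∀ v w, g' y' v w = g y (L v) (L w)) : density g' y' = |L.det| * density g y := by
  rw [density_eq_sqrt_gramDet, density_eq_sqrt_gramDet, gramDet_comp (L := L.toLinearMap) h,
    Real.sqrt_mul (sq_nonneg _), Real.sqrt_sq_eq_abs]

theorem contDiff_gramDet : ContDiff ℝ ∞ (gramDet : Form F → ℝ) := by
  have h : (gramDet : Form F → ℝ) = fun g : Form F => ∑ σ : Equiv.Perm (Fin (Module.finrank ℝ F)),
      (Equiv.Perm.sign σ : ℤ) * ∏ i, g (stdOrthonormalBasis ℝ F (σ i))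
        (stdOrthonormalBasis ℝ F i) := by
    ext g
    rw [gramDet, Matrix.det_apply']
    rfl
  rw [h]
  refine ContDiff.sum fun σ _ => contDiff_const.mul (contDiff_prod fun i _ => ?_)
  exact (contDiff_id.clm_apply contDiff_const).clm_apply contDiff_const

theorem gramDet_smul (r : ℝ) (g : Form F) :
    gramDet (r • g) = r ^ Module.finrank ℝ F * gramDet g := by
  have : (Matrix.of fun i j : Fin (Module.finrank ℝ F) =>
    (r • g) (stdOrthonormalBasis ℝ F i) (stdOrthonormalBasis ℝ F j)) =
      r • Matrix.of fun i j : Fin (Module.finrank ℝ F) =>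
    g (stdOrthonormalBasis ℝ F i) (stdOrthonormalBasis ℝ F j) := by
    ext i j; rfl
  rw [gramDet, this, Matrix.det_smul, Fintype.card_fin]
  rfl

end Gram

/-! ### Measurability of images under charts -/

section ChartImage
variable {F : Type*} [NormedAddCommGroup F] [InnerProductSpace ℝ F] [FiniteDimensional ℝ F]
  [MeasurableSpace F] [BorelSpace F]
  {M : Type*} [TopologicalSpace M] [ChartedSpace F M] [MeasurableSpace M] [BorelSpace M]

theorem aemeasurable_extChartAt_symm (c : M) : AEMeasurable (extChartAt 𝓘(ℝ, F) c).symm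
    ((volume : Measure F).restrict (extChartAt 𝓘(ℝ, F) c).target) :=
  (continuousOn_extChartAt_symm c).aemeasurable (isOpen_extChartAt_target c).measurableSet

theorem extChartAt_image_eq (c : M) {A : Set M} (hA : A ⊆ (extChartAt 𝓘(ℝ, F) c).source) :
    extChartAt 𝓘(ℝ, F) c '' A =
      (extChartAt 𝓘(ℝ, F) c).target ∩ (extChartAt 𝓘(ℝ, F) c).symm ⁻¹' A := by
  ext y
  constructor
  · rintro ⟨p, hp, rfl⟩
    exact ⟨(extChartAt 𝓘(ℝ, F) c).map_source (hA hp), by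
      rw [mem_preimage, (extChartAt 𝓘(ℝ, F) c).left_inv (hA hp)]; exact hp⟩
  · rintro ⟨hy, hyA⟩
    exact ⟨_, hyA, (extChartAt 𝓘(ℝ, F) c).right_inv hy⟩

theorem measurableSet_extChartAt_image (c : M) {A : Set M} (hA : MeasurableSet A)
    (hAc : A ⊆ (extChartAt 𝓘(ℝ, F) c).source) :
    MeasurableSet (extChartAt 𝓘(ℝ, F) c '' A) := by
  rw [extChartAt_image_eq c hAc]
  have h1 : Measurable ((extChartAt 𝓘(ℝ, F) c).target.domRestrict (extChartAt 𝓘(ℝ, F) c).symm) :=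
    (continuousOn_iff_continuous_domRestrict.1 (continuousOn_extChartAt_symm c)).measurable
  have h2 := (isOpen_extChartAt_target (I := 𝓘(ℝ, F)) c).measurableSet.subtype_image (h1 hA)
  convert h2 using 1
  ext y
  constructor
  · rintro ⟨hy, hyA⟩
    exact ⟨⟨y, hy⟩, hyA, rfl⟩
  · rintro ⟨⟨z, hz⟩, hzA, rfl⟩
    exact ⟨hz, hzA⟩

end ChartImage

/-! ### The Riemannian volume of invariant metrics -/

section Volume
variable {F : Type*} [NormedAddCommGroup F] [InnerProductSpace ℝ F] [FiniteDimensional ℝ F]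
  [MeasurableSpace F] [BorelSpace F]
  {G : Type*} [TopologicalSpace G] [Group G]
  (H : Subgroup G) [ChartedSpace F (G ⧸ H)] [IsManifold 𝓘(ℝ, F) ∞ (G ⧸ H)]
  [SmoothTranslations F G (G ⧸ H)]
  [MeasurableSpace (G ⧸ H)] [BorelSpace (G ⧸ H)]

/-- Both metrics are pulled back from `eH` by the same linear map, whose determinant cancels. Hence
all invariant volumes are proportional, with a ratio independent of the point. -/
theorem density_chartMetric_eq {g g₁ : Form F} (hg : g ∈ invariantMetrics F H)
    (hg₁ : g₁ ∈ invariantMetrics F H) (c : G ⧸ H) {y : F}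
    (hy : y ∈ (extChartAt 𝓘(ℝ, F) c).target) :
    density (chartMetric H g c) y =
      Real.sqrt (gramDet g / gramDet g₁) * density (chartMetric H g₁ c) y := by
  have h := fun g : Form F => chartMetric_apply_out H g c hy
  rw [density_comp (g := fun _ => g) (y := 0) (h g), density_comp (g := fun _ => g₁) (y := 0) (h g₁),
    density_eq_sqrt_gramDet, density_eq_sqrt_gramDet]
  have h1 := gramDet_pos hg₁.1 hg₁.2.1
  have h2 := gramDet_pos hg.1 hg.2.1
  rw [Real.sqrt_div h2.le]
  have h3 := (Real.sqrt_pos.2 h1).ne'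
  field_simp

theorem density_chartMetric_pos {g : Form F} (hg : g ∈ invariantMetrics F H) (c : G ⧸ H) {y : F}
    (hy : y ∈ (extChartAt 𝓘(ℝ, F) c).target) : 0 < density (chartMetric H g c) y :=
  Real.sqrt_pos.2 (gramDet_pos (chartMetric_symm H hg c hy) fun _ hv => chartMetric_pos H hg c hy hv)

/-- The volume density under a change of charts. -/
theorem density_chartMetric_change {g : Form F} (hg : g ∈ invariantMetrics F H) (c c' : G ⧸ H)
    {y : F} (hy : y ∈ (extChartAt 𝓘(ℝ, F) c).target)
    (hy' : (extChartAt 𝓘(ℝ, F) c).symm y ∈ (extChartAt 𝓘(ℝ, F) c').source) :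
    density (chartMetric H g c) y = |(fderiv ℝ (smulChart F (1 : G) c c') y).det| *
      density (chartMetric H g c') (smulChart F (1 : G) c c' y) := by
  refine density_comp fun v w => ?_
  obtain ⟨a, ha⟩ := exists_smul_base H ((extChartAt 𝓘(ℝ, F) c).symm y)
  have e1 : smulChart F (1 : G) c c' y = extChartAt 𝓘(ℝ, F) c' ((extChartAt 𝓘(ℝ, F) c).symm y) := by
    rw [smulChart, one_smul]
  have e2 : (extChartAt 𝓘(ℝ, F) c').symm (smulChart F (1 : G) c c' y) =
      (extChartAt 𝓘(ℝ, F) c).symm y := by rw [e1, (extChartAt 𝓘(ℝ, F) c').left_inv hy']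
  have e3 : smulChart F (1 : G) c c' y ∈ (extChartAt 𝓘(ℝ, F) c').target := by
    rw [e1]; exact (extChartAt 𝓘(ℝ, F) c').map_source hy'
  have h5 := fderiv_smulChart_mul (a := a⁻¹) (b := 1) (c := c) (c' := c')
      (c'' := base H) hy (by rwa [one_smul]) (by
        rw [one_smul, ← ha, inv_smul_smul]
        exact mem_extChartAt_source _)
  rw [mul_one] at h5
  rw [chartMetric_apply H hg c hy ha, chartMetric_apply H hg c' e3 (ha.trans e2.symm), h5]
  rfl

/-- The change-of-variables formula for the transition map, written as the translation by `1` in two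
charts. -/
theorem lintegral_density_change {g : Form F} (hg : g ∈ invariantMetrics F H) (c c' : G ⧸ H)
    {A : Set (G ⧸ H)} (hA : MeasurableSet A) (hAc : A ⊆ (extChartAt 𝓘(ℝ, F) c).source)
    (hAc' : A ⊆ (extChartAt 𝓘(ℝ, F) c').source) :
    ∫⁻ y in extChartAt 𝓘(ℝ, F) c '' A, ENNReal.ofReal (density (chartMetric H g c) y) =
      ∫⁻ y in extChartAt 𝓘(ℝ, F) c' '' A, ENNReal.ofReal (density (chartMetric H g c') y) := by
  have hmem : ∀ y ∈ extChartAt 𝓘(ℝ, F) c '' A, y ∈ (extChartAt 𝓘(ℝ, F) c).target ∧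
      (extChartAt 𝓘(ℝ, F) c).symm y ∈ A := by
    intro y hy
    rw [extChartAt_image_eq c hAc] at hy
    exact hy
  have himage : extChartAt 𝓘(ℝ, F) c' '' A =
      smulChart F (1 : G) c c' '' (extChartAt 𝓘(ℝ, F) c '' A) := by
    rw [image_image]
    refine image_congr fun p hp => ?_
    rw [smulChart, (extChartAt 𝓘(ℝ, F) c).left_inv (hAc hp), one_smul]
  have hm := measurableSet_extChartAt_image (F := F) c hA hAc
  rw [himage, lintegral_image_eq_lintegral_abs_det_fderiv_mul volume hm
    (f' := fun y => fderiv ℝ (smulChart F (1 : G) c c') y)]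
  · refine setLIntegral_congr_fun hm fun y hy => ?_
    obtain ⟨h1, h2⟩ := hmem y hy
    rw [density_chartMetric_change H hg c c' h1 (hAc' h2), ENNReal.ofReal_mul (abs_nonneg _)]
  · intro y hy
    obtain ⟨h1, h2⟩ := hmem y hy
    exact (hasFDerivAt_smulChart h1 (by rw [one_smul]; exact hAc' h2)).hasFDerivWithinAt
  · intro y hy z hz hyz
    obtain ⟨h1, h2⟩ := hmem y hy
    obtain ⟨h3, h4⟩ := hmem z hz
    simp only [smulChart, one_smul] at hyz
    have h5 := (extChartAt 𝓘(ℝ, F) c').injOn (hAc' h2) (hAc' h4) hyz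
    rw [← (extChartAt 𝓘(ℝ, F) c).right_inv h1, h5, (extChartAt 𝓘(ℝ, F) c).right_inv h3]

theorem IsRiemannianVolume.smul {g g₁ : Form F} (hg : g ∈ invariantMetrics F H)
    (hg₁ : g₁ ∈ invariantMetrics F H) {ν : Measure (G ⧸ H)} (hν : IsRiemannianVolume H g₁ ν) :
    IsRiemannianVolume H g (ENNReal.ofReal (Real.sqrt (gramDet g / gramDet g₁)) • ν) := by
  intro c A hA hAc
  have hm := measurableSet_extChartAt_image (F := F) c hA hAc
  rw [Measure.smul_apply, hν c A hA hAc, smul_eq_mul,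
    ← lintegral_const_mul' _ _ ENNReal.ofReal_ne_top]
  refine setLIntegral_congr_fun hm fun y hy => ?_
  rw [extChartAt_image_eq c hAc] at hy
  rw [density_chartMetric_eq H hg hg₁ c hy.1, ENNReal.ofReal_mul (Real.sqrt_nonneg _)]

variable [CompactSpace (G ⧸ H)]

/-- A compact homogeneous space is a finite disjoint union of measurable pieces that lie in
prescribed neighbourhoods of points. -/
theorem exists_finite_partition (U : G ⧸ H → Set (G ⧸ H)) (hU : ∀ p, IsOpen (U p))
    (hp : ∀ p, p ∈ U p) : ∃ (n : ℕ) (c : Fin n → G ⧸ H) (A : Fin n → Set (G ⧸ H)),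
      (∀ k, MeasurableSet (A k)) ∧ (∀ k, A k ⊆ U (c k)) ∧ Pairwise (Function.onFun Disjoint A) ∧
        ⋃ k, A k = univ := by
  obtain ⟨t, ht⟩ := isCompact_univ.elim_finite_subcover U hU fun p _ => mem_iUnion.2 ⟨p, hp p⟩
  let c : Fin t.card → G ⧸ H := fun k => (t.equivFin.symm k : G ⧸ H)
  refine ⟨t.card, c, disjointed fun k => U (c k), fun k => ?_, fun k => disjointed_subset _ k,
    disjoint_disjointed _, ?_⟩
  · rw [disjointed_eq_inter_compl]
    exact (hU _).measurableSet.inter (MeasurableSet.iInter fun j => MeasurableSet.iInter fun _ =>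
      (hU _).measurableSet.compl)
  · rw [iUnion_disjointed]
    refine eq_univ_of_forall fun p => ?_
    obtain ⟨q, hq, hpq⟩ := mem_iUnion₂.1 (ht (mem_univ p))
    refine mem_iUnion.2 ⟨t.equivFin ⟨q, hq⟩, ?_⟩
    simpa [c] using hpq

/-- The defining formula only measures sets inside a chart domain, so the whole space is cut into
finitely many such sets. -/
theorem IsRiemannianVolume.univ_eq {g : Form F} {ν ν' : Measure (G ⧸ H)}
    (hν : IsRiemannianVolume H g ν) (hν' : IsRiemannianVolume H g ν') : ν univ = ν' univ := by
  obtain ⟨n, c, A, hA, hAc, hd, hu⟩ := exists_finite_partition H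
    (fun p => (extChartAt 𝓘(ℝ, F) p).source) (fun p => isOpen_extChartAt_source p)
    (fun p => mem_extChartAt_source p)
  rw [← hu, measure_iUnion hd hA, measure_iUnion hd hA]
  exact tsum_congr fun k => by rw [hν (c k) _ (hA k) (hAc k), hν' (c k) _ (hA k) (hAc k)]

/-- The measures given by the densities in finitely many charts are restricted to the pieces of a
partition and added. The formula in any further chart follows from `lintegral_density_change`. -/
theorem exists_isRiemannianVolume {g : Form F} (hg : g ∈ invariantMetrics F H) :
    ∃ ν : Measure (G ⧸ H), IsRiemannianVolume H g ν := by
  obtain ⟨n, c, A, hA, hAc, hd, hu⟩ := exists_finite_partition H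
    (fun p => (extChartAt 𝓘(ℝ, F) p).source) (fun p => isOpen_extChartAt_source p)
    (fun p => mem_extChartAt_source p)
  let ν : Fin n → Measure (G ⧸ H) := fun k =>
    (((volume : Measure F).restrict (extChartAt 𝓘(ℝ, F) (c k)).target).withDensity
      fun y => ENNReal.ofReal (density (chartMetric H g (c k)) y)).map
        (extChartAt 𝓘(ℝ, F) (c k)).symm
  have hνk : ∀ k (B : Set (G ⧸ H)), MeasurableSet B → B ⊆ (extChartAt 𝓘(ℝ, F) (c k)).source →
      ν k B = ∫⁻ y in extChartAt 𝓘(ℝ, F) (c k) '' B,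
        ENNReal.ofReal (density (chartMetric H g (c k)) y) := by
    intro k B hB hBc
    have ha : AEMeasurable (extChartAt 𝓘(ℝ, F) (c k)).symm
        (((volume : Measure F).restrict (extChartAt 𝓘(ℝ, F) (c k)).target).withDensity
          fun y => ENNReal.ofReal (density (chartMetric H g (c k)) y)) :=
      (aemeasurable_extChartAt_symm (c k)).mono_ac (withDensity_absolutelyContinuous _ _)
    have hm := measurableSet_extChartAt_image (F := F) (c k) hB hBc
    have ht := (isOpen_extChartAt_target (I := 𝓘(ℝ, F)) (c k)).measurableSet
    have hmt : extChartAt 𝓘(ℝ, F) (c k) '' B ⊆ (extChartAt 𝓘(ℝ, F) (c k)).target := by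
      rw [extChartAt_image_eq _ hBc]; exact inter_subset_left
    rw [Measure.map_apply_of_aemeasurable ha hB]
    set μ := ((volume : Measure F).restrict (extChartAt 𝓘(ℝ, F) (c k)).target).withDensity
          fun y => ENNReal.ofReal (density (chartMetric H g (c k)) y) with hμ
    have hnull : μ (extChartAt 𝓘(ℝ, F) (c k)).targetᶜ = 0 := by
      refine (withDensity_absolutelyContinuous _ _) ?_
      rw [Measure.restrict_apply ht.compl, compl_inter_self, measure_empty]
    have h1 : μ ((extChartAt 𝓘(ℝ, F) (c k)).symm ⁻¹' B) =
        μ (extChartAt 𝓘(ℝ, F) (c k) '' B) := by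
      rw [extChartAt_image_eq _ hBc]
      exact (measure_inter_conull hnull).symm.trans (by rw [inter_comm])
    rw [h1, hμ, withDensity_apply _ hm, Measure.restrict_restrict hm,
      inter_eq_left.2 hmt]
  refine ⟨∑ k, (ν k).restrict (A k), fun c' B hB hBc => ?_⟩
  have hdis : Pairwise (Function.onFun Disjoint fun k => extChartAt 𝓘(ℝ, F) c' '' (B ∩ A k)) := by
    intro i j hij
    refine disjoint_left.2 ?_
    rintro _ ⟨p, hp, rfl⟩ ⟨q, hq, hqp⟩
    have h := (extChartAt 𝓘(ℝ, F) c').injOn (hBc hq.1) (hBc hp.1) hqp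
    subst h
    exact disjoint_left.1 (hd hij) hp.2 hq.2
  have hBu : extChartAt 𝓘(ℝ, F) c' '' B = ⋃ k, extChartAt 𝓘(ℝ, F) c' '' (B ∩ A k) := by
    rw [← image_iUnion, ← inter_iUnion, hu, inter_univ]
  rw [hBu, lintegral_iUnion (fun k => measurableSet_extChartAt_image (F := F) c'
    (hB.inter (hA k)) (inter_subset_left.trans hBc)) hdis, tsum_fintype,
    Measure.finsetSum_apply]
  refine Finset.sum_congr rfl fun k _ => ?_
  rw [Measure.restrict_apply hB, hνk k _ (hB.inter (hA k)) (inter_subset_right.trans (hAc k))]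
  exact lintegral_density_change H hg (c k) c' (hB.inter (hA k))
    (inter_subset_right.trans (hAc k)) (inter_subset_left.trans hBc)

variable {E : Type*} [NormedAddCommGroup E] [NormedSpace ℝ E]
  [ChartedSpace E G] [LieGroup 𝓘(ℝ, E) ∞ G] [ContMDiffSMul 𝓘(ℝ, E) 𝓘(ℝ, F) ∞ G (G ⧸ H)]

/-- The density is continuous and positive at the centre, hence bounded above and away from zero on
a small ball. This makes the total volume finite and positive. -/
theorem exists_nhds_lintegral_density
    (hπ : Manifold.IsSubmersion 𝓘(ℝ, E) 𝓘(ℝ, F) ∞ (fun a : G => (a : G ⧸ H)))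
    {g : Form F} (hg : g ∈ invariantMetrics F H) (c : G ⧸ H) :
    ∃ U : Set (G ⧸ H), IsOpen U ∧ c ∈ U ∧ U ⊆ (extChartAt 𝓘(ℝ, F) c).source ∧
      (∫⁻ y in extChartAt 𝓘(ℝ, F) c '' U, ENNReal.ofReal (density (chartMetric H g c) y)) < ⊤ ∧
      0 < ∫⁻ y in extChartAt 𝓘(ℝ, F) c '' U, ENNReal.ofReal (density (chartMetric H g c) y) := by
  set y₀ := extChartAt 𝓘(ℝ, F) c c with hy₀
  have hy₀t : y₀ ∈ (extChartAt 𝓘(ℝ, F) c).target := mem_extChartAt_target _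
  have hcont : ContinuousAt (density (chartMetric H g c)) y₀ := by
    have h1 := (contDiffAt_chartMetric H E hπ hg c hy₀t).continuousAt
    exact Real.continuous_sqrt.continuousAt.comp
      ((contDiff_gramDet (F := F)).continuous.continuousAt.comp h1)
  set D := density (chartMetric H g c) y₀ with hD
  have hpos : 0 < D := density_chartMetric_pos H hg c hy₀t
  have hev : ∀ᶠ y in 𝓝 y₀, density (chartMetric H g c) y ∈ Ioo (D / 2) (D + 1) :=
    hcont.eventually_mem (Ioo_mem_nhds (by linarith) (by linarith))
  obtain ⟨r, hr, hball⟩ := Metric.eventually_nhds_iff_ball.1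
    (hev.and ((isOpen_extChartAt_target c).mem_nhds hy₀t))
  set U := (extChartAt 𝓘(ℝ, F) c).source ∩ extChartAt 𝓘(ℝ, F) c ⁻¹' Metric.ball y₀ r with hU
  have himage : extChartAt 𝓘(ℝ, F) c '' U = Metric.ball y₀ r := by
    ext y
    constructor
    · rintro ⟨p, hp, rfl⟩; exact hp.2
    · intro hy
      have hyt := (hball y hy).2
      exact ⟨(extChartAt 𝓘(ℝ, F) c).symm y, ⟨(extChartAt 𝓘(ℝ, F) c).map_target hyt, by
        rw [mem_preimage, (extChartAt 𝓘(ℝ, F) c).right_inv hyt]; exact hy⟩,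
        (extChartAt 𝓘(ℝ, F) c).right_inv hyt⟩
  refine ⟨U, (continuousOn_extChartAt c).isOpen_inter_preimage (isOpen_extChartAt_source c)
    Metric.isOpen_ball, ⟨mem_extChartAt_source _, Metric.mem_ball_self hr⟩, inter_subset_left, ?_, ?_⟩
  · rw [himage]
    refine lt_of_le_of_lt (setLIntegral_mono' (g := fun _ => ENNReal.ofReal (D + 1))
      measurableSet_ball fun y hy => ENNReal.ofReal_le_ofReal (hball y hy).1.2.le) ?_
    rw [setLIntegral_const]
    exact ENNReal.mul_lt_top ENNReal.ofReal_lt_top measure_ball_lt_top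
  · rw [himage]
    refine lt_of_lt_of_le ?_ (setLIntegral_mono' (f := fun _ => ENNReal.ofReal (D / 2))
      measurableSet_ball fun y hy => ENNReal.ofReal_le_ofReal (hball y hy).1.1.le)
    rw [setLIntegral_const]
    exact ENNReal.mul_pos (ENNReal.ofReal_pos.2 (by linarith)).ne'
      (Metric.measure_ball_pos volume y₀ hr).ne'

/-- The invariant metrics of volume one. -/
theorem exists_mem_unitVolumeMetrics_iff
    (hπ : Manifold.IsSubmersion 𝓘(ℝ, E) 𝓘(ℝ, F) ∞ (fun a : G => (a : G ⧸ H)))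
    {g₁ : Form F} (hg₁ : g₁ ∈ invariantMetrics F H) :
    ∃ v : ℝ, 0 < v ∧ ∀ g, g ∈ unitVolumeMetrics F H ↔
      g ∈ invariantMetrics F H ∧ v * gramDet g = 1 := by
  obtain ⟨ν, hν⟩ := exists_isRiemannianVolume H hg₁
  choose U hUo hUc hUs hUf hUp using exists_nhds_lintegral_density H hπ hg₁
  have hνU : ∀ p, ν (U p) = ∫⁻ y in extChartAt 𝓘(ℝ, F) p '' U p,
    ENNReal.ofReal (density (chartMetric H g₁ p) y) := fun p =>
      hν p _ (hUo p).measurableSet (hUs p)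
  have hpos : 0 < ν univ := by
    have h1 := hUp (base H)
    rw [← hνU] at h1
    exact h1.trans_le (measure_mono (subset_univ _))
  have hfin : ν univ < ⊤ := by
    obtain ⟨t, ht⟩ := isCompact_univ.elim_finite_subcover U hUo
      fun p _ => mem_iUnion.2 ⟨p, hUc p⟩
    refine (measure_mono ht).trans_lt ((measure_biUnion_finset_le t U).trans_lt ?_)
    exact ENNReal.sum_lt_top.2 fun p _ => by rw [hνU]; exact hUf p
  set V := (ν univ).toReal with hV
  have hV0 : 0 < V := ENNReal.toReal_pos hpos.ne' hfin.ne
  have hD1 := gramDet_pos hg₁.1 hg₁.2.1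
  have key : ∀ g ∈ invariantMetrics F H,
      (ENNReal.ofReal (Real.sqrt (gramDet g / gramDet g₁)) • ν) univ = 1 ↔
        V ^ 2 / gramDet g₁ * gramDet g = 1 := by
    intro g hg
    have hD := gramDet_pos hg.1 hg.2.1
    rw [Measure.smul_apply, smul_eq_mul, ← ENNReal.ofReal_toReal hfin.ne, ← hV,
      ← ENNReal.ofReal_mul (Real.sqrt_nonneg _), ENNReal.ofReal_eq_one]
    have h1 : 0 ≤ Real.sqrt (gramDet g / gramDet g₁) * V := by positivity
    rw [← pow_eq_one_iff_of_nonneg h1 two_ne_zero, mul_pow, Real.sq_sqrt (by positivity)]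
    rw [div_mul_eq_mul_div, div_mul_eq_mul_div, mul_comm]
  -- The volume of `g` is `√(gramDet g / gramDet g₁) V`; the constant comes from squaring the
  -- equation that sets it to `1`.
  refine ⟨V ^ 2 / gramDet g₁, by positivity, fun g => ⟨?_, ?_⟩⟩
  · rintro ⟨hg, ν', hν', h1⟩
    refine ⟨hg, (key g hg).1 ?_⟩
    rw [← h1]
    exact (hν.smul H hg hg₁).univ_eq H hν'
  · rintro ⟨hg, h1⟩
    exact ⟨hg, _, hν.smul H hg hg₁, (key g hg).2 h1⟩

end Volume

/-! ### Projections onto the summands -/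

section Summands
variable {F : Type*} [NormedAddCommGroup F] [InnerProductSpace ℝ F]
  {d : ℕ} {V : Fin d → Submodule ℝ F} (hV : DirectSum.IsInternal V)

theorem summandProj_mem (i : Fin d) (v : F) : summandProj V hV i v ∈ V i := Submodule.coe_mem _

theorem sum_summandProj (v : F) : ∑ i, summandProj V hV i v = v := by
  classical
  have h : DirectSum.coeLinearMap V
      ((LinearEquiv.ofBijective (DirectSum.coeLinearMap V) hV).symm v) = v :=
    (LinearEquiv.ofBijective (DirectSum.coeLinearMap V) hV).apply_symm_apply v
  rw [DirectSum.coeLinearMap_eq_dfinsuppSum] at h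
  exact ((DFinsupp.sum_eq_sum_fintype _ (fun _ => rfl)).symm.trans h)

theorem summandProj_of_mem {i : Fin d} {v : F} (hv : v ∈ V i) (j : Fin d) :
    summandProj V hV j v = if j = i then v else 0 := by
  split_ifs with hij
  · subst hij
    exact congrArg Subtype.val (hV.ofBijective_coeLinearMap_of_mem hv)
  · exact congrArg Subtype.val (hV.ofBijective_coeLinearMap_of_mem_ne (Ne.symm hij) hv)

theorem eq_of_forall_summand {W : Type*} [AddCommGroup W] [Module ℝ W] (hV : DirectSum.IsInternal V)
    {f g : F →ₗ[ℝ] W}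
    (h : ∀ i, ∀ v ∈ V i, f v = g v) : f = g := by
  ext v
  rw [← sum_summandProj hV v, map_sum, map_sum]
  exact Finset.sum_congr rfl fun i _ => h i _ (summandProj_mem hV i v)

end Summands

/-! ### Schur's lemma and the parametrization of the invariant metrics -/

section Schur
variable {F : Type*} [NormedAddCommGroup F] [InnerProductSpace ℝ F] [FiniteDimensional ℝ F]
  {G : Type*} [TopologicalSpace G] [Group G]
  (H : Subgroup G) [ChartedSpace F (G ⧸ H)] [IsManifold 𝓘(ℝ, F) ∞ (G ⧸ H)]
  [SmoothTranslations F G (G ⧸ H)]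
  {d : ℕ} {V : Fin d → Submodule ℝ F}

theorem isotropyRep_inv_apply (h : H) (v : F) :
    isotropyRep F H h⁻¹ (isotropyRep F H h v) = v := by
  have := isotropyRep_apply_inv (F := F) H h⁻¹ v
  rwa [inv_inv] at this

theorem summandProj_isotropyRep (hV : IsMultiplicityFreeDecomposition H V) (h : H) (i : Fin d)
    (v : F) : summandProj V hV.internal i (isotropyRep F H h v) =
      isotropyRep F H h (summandProj V hV.internal i v) := by
  have : summandProj V hV.internal i ∘ₗ (isotropyRep F H h).toLinearMap =
      (isotropyRep F H h).toLinearMap ∘ₗ summandProj V hV.internal i := by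
    refine eq_of_forall_summand hV.internal fun j v hv => ?_
    have h1 := (hV.irreducible j).invariant h v hv
    simp only [LinearMap.comp_apply, ContinuousLinearMap.coe_coe]
    rw [summandProj_of_mem hV.internal hv, summandProj_of_mem hV.internal h1]
    split_ifs <;> simp
  exact congrArg (fun f : F →ₗ[ℝ] F => f v) this

/-- Equivariant endomorphisms preserve the summands of a multiplicity-free representation. -/
theorem equivariant_mem (hV : IsMultiplicityFreeDecomposition H V) {T : F →ₗ[ℝ] F}
    (hT : ∀ (h : H) v, T (isotropyRep F H h v) = isotropyRep F H h (T v)) {i : Fin d} {v : F}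
    (hv : v ∈ V i) : T v ∈ V i := by
  have hzero : ∀ j, j ≠ i → ∀ v ∈ V i, summandProj V hV.internal j (T v) = 0 := by
    intro j hj
    -- The component `V i → V j` of `T` is equivariant. If its kernel on `V i` were zero, it would
    -- be an isomorphism onto `V j` and contradict inequivalence; so the kernel is all of `V i`.
    set S := summandProj V hV.internal j ∘ₗ T with hS
    have hSe : ∀ (h : H) v, S (isotropyRep F H h v) = isotropyRep F H h (S v) := by
      intro h v
      simp only [hS, LinearMap.comp_apply]
      rw [hT, summandProj_isotropyRep H hV]
    have hker : IsInvariant H (LinearMap.ker S ⊓ V i) := by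
      rintro h v ⟨h1, h2⟩
      refine ⟨?_, (hV.irreducible i).invariant h v h2⟩
      change S _ = 0
      have h3 : S v = 0 := h1
      rw [hSe, h3, map_zero]
    rcases (hV.irreducible i).eq_bot_or_eq _ hker inf_le_right with h0 | h0
    · exfalso
      have hinj : Function.Injective (S ∘ₗ (V i).subtype) := by
        rw [← LinearMap.ker_eq_bot, LinearMap.ker_eq_bot']
        intro v hv
        have : (v : F) ∈ LinearMap.ker S ⊓ V i := ⟨hv, v.2⟩
        rw [h0, Submodule.mem_bot] at this
        exact Subtype.ext this
      have hrange : Submodule.map S (V i) = V j := by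
        have hinv : IsInvariant H (Submodule.map S (V i)) := by
          rintro h _ ⟨v, hv, rfl⟩
          exact ⟨isotropyRep F H h v, (hV.irreducible i).invariant h v hv, hSe h v⟩
        have hle : Submodule.map S (V i) ≤ V j := by
          rintro _ ⟨v, -, rfl⟩
          exact summandProj_mem hV.internal j _
        rcases (hV.irreducible j).eq_bot_or_eq _ hinv hle with h1 | h1
        · exfalso
          refine (hV.irreducible i).ne_bot ?_
          rw [eq_bot_iff]
          intro v hv
          have h2 : S v ∈ Submodule.map S (V i) := ⟨v, hv, rfl⟩
          rw [h1, Submodule.mem_bot] at h2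
          have h3 := hinj (a₁ := ⟨v, hv⟩) (a₂ := 0) (by simpa using h2)
          simpa using congrArg Subtype.val h3
        · exact h1
      let φ : V i →ₗ[ℝ] V j := (S ∘ₗ (V i).subtype).codRestrict (V j) fun v =>
        summandProj_mem hV.internal j _
      have hφ : Function.Bijective φ := by
        refine ⟨fun v w hvw => hinj (congrArg Subtype.val hvw), fun w => ?_⟩
        have h1 : (w : F) ∈ Submodule.map S (V i) := by rw [hrange]; exact w.2
        obtain ⟨v, hv, hvw⟩ := h1
        exact ⟨⟨v, hv⟩, Subtype.ext hvw⟩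
      refine hV.inequivalent i j (Ne.symm hj) ⟨LinearEquiv.ofBijective φ hφ, fun h v v' hvv' => ?_⟩
      change S v' = isotropyRep F H h (S v)
      rw [hvv', hSe]
    · intro v hv
      have : v ∈ LinearMap.ker S ⊓ V i := by rw [h0]; exact hv
      exact this.1
  rw [← sum_summandProj hV.internal (T v), Finset.sum_eq_single i
    (fun j _ hj => hzero j hj v hv) (by simp)]
  exact summandProj_mem hV.internal i _

theorem formOperator_spec {g : Form F} (hg : ∀ v, v ≠ 0 → 0 < g v v) (b : F →ₗ[ℝ] F →ₗ[ℝ] ℝ)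
    (v w : F) : g (formOperator g b v) w = b v w := by
  have := apply_inverse_of_pos hg (b.toContinuousBilinearMap v)
  exact congrArg (fun l : F →L[ℝ] ℝ => l w) this

theorem formOperator_equivariant {g : Form F} (hg : g ∈ invariantMetrics F H)
    {b : F →ₗ[ℝ] F →ₗ[ℝ] ℝ}
    (hb : ∀ (h : H) v w, b (isotropyRep F H h v) (isotropyRep F H h w) = b v w) (h : H) (v : F) :
    formOperator g b (isotropyRep F H h v) = isotropyRep F H h (formOperator g b v) := by
  refine eq_of_pos hg.2.1 fun w => ?_
  rw [← isotropyRep_apply_inv H h w, formOperator_spec hg.2.1, hb, hg.2.2,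
    formOperator_spec hg.2.1]

/-- The summands are orthogonal for every invariant metric. -/
theorem invariantMetric_orthogonal (hV : IsMultiplicityFreeDecomposition H V) {g : Form F}
    (hg : g ∈ invariantMetrics F H) {i j : Fin d} (hij : i ≠ j) {v w : F} (hv : v ∈ V i)
    (hw : w ∈ V j) : g v w = 0 := by
  -- For `b(v, w) = g(v, w_j)` the operator `g⁻¹ b` preserves `V i`. Its value on `v ∈ V i`
  -- therefore has no component in `V j`, so it has length zero.
  let b : F →ₗ[ℝ] F →ₗ[ℝ] ℝ :=
    ((ContinuousLinearMap.coeLM ℝ) ∘ₗ g.toLinearMap).compl₂ (summandProj V hV.internal j)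
  have hbv : ∀ v w, b v w = g v (summandProj V hV.internal j w) := fun v w => rfl
  have hb : ∀ (h : H) v w, b (isotropyRep F H h v) (isotropyRep F H h w) = b v w := by
    intro h v w
    rw [hbv, hbv, summandProj_isotropyRep H hV, hg.2.2]
  have h1 : formOperator g b v ∈ V i :=
    equivariant_mem H hV (T := (formOperator g b).toLinearMap)
      (fun h v => formOperator_equivariant H hg hb h v) hv
  have h2 : g (formOperator g b v) (formOperator g b v) = 0 := by
    rw [formOperator_spec hg.2.1, hbv, summandProj_of_mem hV.internal h1, if_neg hij.symm, map_zero]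
  have h3 : formOperator g b v = 0 := by
    by_contra hne
    exact (hg.2.1 _ hne).ne' h2
  have h4 := formOperator_spec hg.2.1 b v w
  rw [h3, map_zero, hbv, summandProj_of_mem hV.internal hw, if_pos rfl] at h4
  exact h4.symm

/-- Schur's lemma for symmetric bilinear forms. -/
theorem exists_eq_smul_of_invariant (hV : IsMultiplicityFreeDecomposition H V) {g : Form F}
    (hg : g ∈ invariantMetrics F H) {b : F →ₗ[ℝ] F →ₗ[ℝ] ℝ} (hs : ∀ v w, b v w = b w v)
    (hb : ∀ (h : H) v w, b (isotropyRep F H h v) (isotropyRep F H h w) = b v w) :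
    ∃ x : Fin d → ℝ, ∀ i, ∀ v ∈ V i, ∀ w, b v w = x i * g v w := by
  have hT : ∀ i, ∀ v ∈ V i, formOperator g b v ∈ V i := fun i v hv =>
    equivariant_mem H hV (T := (formOperator g b).toLinearMap)
      (fun h v => formOperator_equivariant H hg hb h v) hv
  have key : ∀ i, ∃ x : ℝ, ∀ v ∈ V i, ∀ w ∈ V i, b v w = x * g v w := by
    intro i
    let gi : V i →ₗ[ℝ] V i →ₗ[ℝ] ℝ := ((ContinuousLinearMap.coeLM ℝ) ∘ₗ g.toLinearMap).compl₁₂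
      (V i).subtype (V i).subtype
    have hgi : ∀ v w : V i, gi v w = g v w := fun _ _ => rfl
    obtain ⟨e, he⟩ := exists_orthonormal_basis gi (fun u v => hg.1 u v)
      (fun v hv => hg.2.1 v fun h => hv (Subtype.ext h))
    let B : Matrix (Fin (Module.finrank ℝ (V i))) (Fin (Module.finrank ℝ (V i))) ℝ :=
      Matrix.of fun k l => b (e k) (e l)
    have hB : B.IsHermitian := by
      ext k l
      exact hs _ _
    have : Nontrivial (V i) := (Submodule.nontrivial_iff_ne_bot).2 (hV.irreducible i).ne_bot
    have hpos : 0 < Module.finrank ℝ (V i) := Module.finrank_pos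
    set k₀ : Fin (Module.finrank ℝ (V i)) := ⟨0, hpos⟩
    -- A symmetric real form has a real eigenvalue relative to `g`. Its eigenspace `K` is invariant
    -- and nonzero, hence all of `V i`; whether the commutant of `V i` is `ℝ`, `ℂ` or `ℍ` does not
    -- matter.
    set x := hB.eigenvalues k₀
    set u : Fin (Module.finrank ℝ (V i)) → ℝ := fun k => hB.eigenvectorBasis k₀ k with hu
    have hBu : B.mulVec u = x • u := hB.mulVec_eigenvectorBasis k₀
    have hu0 : u ≠ 0 := by
      intro h
      have := hB.eigenvectorBasis.orthonormal.ne_zero k₀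
      exact this (by ext k; exact congrFun h k)
    set v₀ : V i := ∑ k, u k • e k with hv₀
    have hv₀0 : v₀ ≠ 0 := by
      intro h
      refine hu0 ?_
      ext k
      exact Fintype.linearIndependent_iff.1 e.linearIndependent u h k
    have hv₀e : ∀ l, b v₀ (e l) = x * g v₀ (e l) := by
      intro l
      have h1 := congrFun hBu l
      have h2 : b v₀ (e l) = ∑ k, u k * b (e k) (e l) := by
        simp [hv₀, map_sum, LinearMap.sum_apply]
      have h3 : g v₀ (e l) = u l := by
        have h4 : gi v₀ (e l) = u l := by
          simp [hv₀, map_sum, LinearMap.sum_apply, he]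
        exact h4
      rw [h2, h3]
      rw [Matrix.mulVec_eq_sum] at h1
      simp only [Pi.smul_apply, smul_eq_mul] at h1
      rw [← h1]
      simp [B, Finset.sum_apply, hs (e l)]
    let K : Submodule ℝ F :=
      { carrier := {v | v ∈ V i ∧ ∀ w ∈ V i, b v w = x * g v w}
        add_mem' := fun {v v'} hv hv' => ⟨(V i).add_mem hv.1 hv'.1, fun w hw => by
          rw [map_add, map_add, LinearMap.add_apply, add_apply, hv.2 w hw, hv'.2 w hw]; ring⟩
        zero_mem' := ⟨(V i).zero_mem, fun w _ => by simp⟩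
        smul_mem' := fun r v hv => ⟨(V i).smul_mem r hv.1, fun w hw => by
          rw [map_smul, map_smul, LinearMap.smul_apply, smul_apply, hv.2 w hw, smul_eq_mul,
            smul_eq_mul]; ring⟩ }
    have hK : IsInvariant H K := by
      rintro h v ⟨h1, h2⟩
      refine ⟨(hV.irreducible i).invariant h v h1, fun w hw => ?_⟩
      rw [← isotropyRep_apply_inv H h w, hb, hg.2.2]
      exact h2 _ ((hV.irreducible i).invariant h⁻¹ w hw)
    have hv₀K : (v₀ : F) ∈ K := by
      refine ⟨v₀.2, fun w hw => ?_⟩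
      have h1 : (b v₀ - x • (g v₀ : F →ₗ[ℝ] ℝ)) ∘ₗ (V i).subtype = 0 :=
        e.ext fun l => by
          have := hv₀e l
          simp [this]
      have h2 := congrArg (fun f : V i →ₗ[ℝ] ℝ => f ⟨w, hw⟩) h1
      simp at h2
      linarith
    rcases (hV.irreducible i).eq_bot_or_eq K hK (fun v hv => hv.1) with h0 | h0
    · rw [h0, Submodule.mem_bot] at hv₀K
      exact absurd (Subtype.ext hv₀K) hv₀0
    · refine ⟨x, fun v hv w hw => ?_⟩
      have : v ∈ K := by rw [h0]; exact hv
      exact this.2 w hw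
  choose x hx using key
  refine ⟨x, fun i v hv w => ?_⟩
  rw [← sum_summandProj hV.internal w, map_sum, map_sum, Finset.mul_sum]
  refine Finset.sum_congr rfl fun j _ => ?_
  have hwj := summandProj_mem hV.internal j w
  by_cases hij : j = i
  · subst hij
    exact hx j v hv _ hwj
  · rw [← formOperator_spec hg.2.1, invariantMetric_orthogonal H hV hg (Ne.symm hij) (hT i v hv) hwj,
      invariantMetric_orthogonal H hV hg (Ne.symm hij) hv hwj, mul_zero]

/-- The metric `∑ x_i g|V_i`. -/
def diagonalMetric (hV : DirectSum.IsInternal V) (g : Form F) (x : Fin d → ℝ) : Form F :=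
  ∑ i, x i • (g ∘L LinearMap.toContinuousLinearMap (summandProj V hV i))

theorem diagonalMetric_apply (hV : DirectSum.IsInternal V) (g : Form F) (x : Fin d → ℝ) (v w : F) :
    diagonalMetric hV g x v w = ∑ i, x i * g (summandProj V hV i v) w := by
  simp [diagonalMetric, sum_apply]

theorem diagonalMetric_of_mem (hV : DirectSum.IsInternal V) (g : Form F) (x : Fin d → ℝ)
    {i : Fin d} {v : F} (hv : v ∈ V i) (w : F) : diagonalMetric hV g x v w = x i * g v w := by
  rw [diagonalMetric_apply, Finset.sum_eq_single i]
  · rw [summandProj_of_mem hV hv, if_pos rfl]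
  · intro j _ hj
    rw [summandProj_of_mem hV hv, if_neg hj]; simp
  · simp

theorem diagonalMetric_apply_sum (hV : IsMultiplicityFreeDecomposition H V) {g : Form F}
    (hg : g ∈ invariantMetrics F H) (x : Fin d → ℝ) (v w : F) :
    diagonalMetric hV.internal g x v w = ∑ i, x i * g (summandProj V hV.internal i v)
      (summandProj V hV.internal i w) := by
  rw [diagonalMetric_apply]
  refine Finset.sum_congr rfl fun i _ => ?_
  conv_lhs => rw [← sum_summandProj hV.internal w, map_sum, Finset.sum_eq_single i
    (fun j _ hj => invariantMetric_orthogonal H hV hg (Ne.symm hj) (summandProj_mem hV.internal i v)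
      (summandProj_mem hV.internal j w)) (by simp)]

theorem diagonalMetric_mem (hV : IsMultiplicityFreeDecomposition H V) {g : Form F}
    (hg : g ∈ invariantMetrics F H) {x : Fin d → ℝ} (hx : ∀ i, 0 < x i) :
    diagonalMetric hV.internal g x ∈ invariantMetrics F H := by
  have h := diagonalMetric_apply_sum H hV hg x
  refine ⟨fun u v => ?_, fun v hv => ?_, fun k u v => ?_⟩
  · rw [h, h]
    exact Finset.sum_congr rfl fun i _ => by rw [hg.1]
  · rw [h]
    have h0 : ∀ i, 0 ≤ x i * g (summandProj V hV.internal i v) (summandProj V hV.internal i v) :=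
      fun i => mul_nonneg (hx i).le (nonneg_of_pos hg.2.1 _)
    refine (Finset.sum_nonneg fun i _ => h0 i).lt_of_ne' fun hne => hv ?_
    rw [Finset.sum_eq_zero_iff_of_nonneg fun i _ => h0 i] at hne
    rw [← sum_summandProj hV.internal v]
    refine Finset.sum_eq_zero fun i hi => ?_
    by_contra h1
    exact (mul_pos (hx i) (hg.2.1 _ h1)).ne' (hne i hi)
  · rw [h, h]
    exact Finset.sum_congr rfl fun i _ => by
      rw [summandProj_isotropyRep H hV, summandProj_isotropyRep H hV, hg.2.2]

/-- Schur's lemma applied to `g` relative to `g₁`: the positive orthant parametrizes the whole cone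
`𝓜`. -/
theorem exists_eq_diagonalMetric (hV : IsMultiplicityFreeDecomposition H V) {g g₁ : Form F}
    (hg : g ∈ invariantMetrics F H) (hg₁ : g₁ ∈ invariantMetrics F H) :
    ∃ x : Fin d → ℝ, (∀ i, 0 < x i) ∧ g = diagonalMetric hV.internal g₁ x := by
  obtain ⟨x, hx⟩ := exists_eq_smul_of_invariant H hV hg₁
    (b := (ContinuousLinearMap.coeLM ℝ) ∘ₗ g.toLinearMap) hg.1 (fun h v w => hg.2.2 h v w)
  refine ⟨x, fun i => ?_, ?_⟩
  · obtain ⟨v, hv, hv0⟩ := Submodule.exists_mem_ne_zero_of_ne_bot (hV.irreducible i).ne_bot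
    have h1 := hg.2.1 v hv0
    have h2 := hg₁.2.1 v hv0
    have h3 : g v v = x i * g₁ v v := hx i v hv v
    rw [h3] at h1
    exact pos_of_mul_pos_left h1 h2.le
  · have : g.toLinearMap = (diagonalMetric hV.internal g₁ x).toLinearMap := by
      refine eq_of_forall_summand hV.internal fun i v hv => ?_
      ext w
      exact (hx i v hv w).trans (diagonalMetric_of_mem hV.internal g₁ x hv w).symm
    exact ContinuousLinearMap.coe_injective this

theorem contDiff_diagonalMetric (hV : DirectSum.IsInternal V) (g : Form F) :
    ContDiff ℝ ∞ (diagonalMetric hV g) := by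
  unfold diagonalMetric
  refine ContDiff.sum fun i _ => ?_
  have h : ContDiff ℝ ∞ fun x : Fin d → ℝ => x i := contDiff_apply ℝ ℝ i
  exact h.smul (contDiff_const (c := g ∘L LinearMap.toContinuousLinearMap (summandProj V hV i)))

theorem diagonalMetric_smul (hV : DirectSum.IsInternal V) (g : Form F) (r : ℝ) (x : Fin d → ℝ) :
    diagonalMetric hV g (r • x) = r • diagonalMetric hV g x := by
  simp [diagonalMetric, Finset.smul_sum, mul_smul]

/-- An orthonormal basis adapted to the decomposition. -/
theorem exists_adapted_basis (hV : IsMultiplicityFreeDecomposition H V) {g : Form F}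
    (hg : g ∈ invariantMetrics F H) :
    ∃ b : Module.Basis (Σ i, Fin (Module.finrank ℝ (V i))) ℝ F, IsOrthonormalBasis g b ∧
      ∀ p, b p ∈ V p.1 := by
  have h : ∀ i, ∃ e : Module.Basis (Fin (Module.finrank ℝ (V i))) ℝ (V i), ∀ k l,
      g (e k) (e l) = if k = l then 1 else 0 := fun i =>
    exists_orthonormal_basis (((ContinuousLinearMap.coeLM ℝ) ∘ₗ g.toLinearMap).compl₁₂
      (V i).subtype (V i).subtype) (fun u v => hg.1 u v)
      (fun v hv => hg.2.1 v fun h => hv (Subtype.ext h))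
  choose e he using h
  refine ⟨hV.internal.collectedBasis e, ?_, hV.internal.collectedBasis_mem e⟩
  rintro ⟨i, k⟩ ⟨j, l⟩
  rw [DirectSum.IsInternal.collectedBasis_coe]
  simp only
  by_cases hij : i = j
  · subst hij
    rw [he]
    simp
  · rw [invariantMetric_orthogonal H hV hg hij (e i k).2 (e j l).2, if_neg]
    exact fun h => hij (congrArg Sigma.fst h)

end Schur

/-! ### Diagonal matrices as combinations of the weights -/

section WeightSum
variable {F : Type*} [NormedAddCommGroup F] [InnerProductSpace ℝ F] [FiniteDimensional ℝ F]
  {d : ℕ} {V : Fin d → Submodule ℝ F} (hV : DirectSum.IsInternal V)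

/-- The diagonal matrix `∑ a_i ε_i`. -/
def weightSum : (Fin d → ℝ) →ₗ[ℝ] F →L[ℝ] F := Fintype.linearCombination ℝ (weight V hV)

theorem weightSum_apply (a : Fin d → ℝ) : weightSum hV a = ∑ i, a i • weight V hV i :=
  Fintype.linearCombination_apply ℝ (weight V hV) a

theorem weightSum_single (i : Fin d) : weightSum hV (Pi.single i 1) = weight V hV i := by
  rw [weightSum, Fintype.linearCombination_apply_single, one_smul]

theorem weightSum_apply_of_mem (a : Fin d → ℝ) {i : Fin d} {v : F} (hv : v ∈ V i) :
    weightSum hV a v = (a i * (Module.finrank ℝ (V i) : ℝ)⁻¹) • v := by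
  rw [weightSum_apply, sum_apply, Finset.sum_eq_single i]
  · simp [weight, summandProj_of_mem hV hv, mul_smul]
  · intro j _ hj
    simp [weight, summandProj_of_mem hV hv, hj]
  · simp

theorem weightSum_injective (h : ∀ i, V i ≠ ⊥) : Function.Injective (weightSum hV) := by
  rw [← LinearMap.ker_eq_bot, LinearMap.ker_eq_bot']
  intro a ha
  ext i
  obtain ⟨v, hv, hv0⟩ := Submodule.exists_mem_ne_zero_of_ne_bot (h i)
  have : Nontrivial (V i) := (Submodule.nontrivial_iff_ne_bot).2 (h i)
  have hpos : 0 < Module.finrank ℝ (V i) := Module.finrank_pos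
  have h1 := weightSum_apply_of_mem hV a hv
  rw [ha, zero_apply, eq_comm, smul_eq_zero] at h1
  have h2 := h1.resolve_right hv0
  have h3 : ((Module.finrank ℝ (V i) : ℝ)⁻¹) ≠ 0 := by positivity
  exact (mul_eq_zero.1 h2).resolve_right h3

theorem trace_weightSum (h : ∀ i, V i ≠ ⊥) {g : Form F}
    {b : Module.Basis (Σ i, Fin (Module.finrank ℝ (V i))) ℝ F} (hb : IsOrthonormalBasis g b)
    (hbV : ∀ p, b p ∈ V p.1) (a : Fin d → ℝ) :
    LinearMap.trace ℝ F (weightSum hV a).toLinearMap = ∑ i, a i := by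
  have hb' : ∀ i, g (b i) (b i) = 1 := fun i => by rw [hb i i, if_pos rfl]
  rw [hb.trace, Fintype.sum_sigma]
  refine Finset.sum_congr rfl fun i _ => ?_
  have : Nontrivial (V i) := (Submodule.nontrivial_iff_ne_bot).2 (h i)
  have hpos : 0 < Module.finrank ℝ (V i) := Module.finrank_pos
  have h1 : ∀ k, g ((weightSum hV a).toLinearMap (b ⟨i, k⟩)) (b ⟨i, k⟩) =
      a i * (Module.finrank ℝ (V i) : ℝ)⁻¹ := fun k => by
    rw [ContinuousLinearMap.coe_coe, weightSum_apply_of_mem hV a (hbV ⟨i, k⟩), map_smul, smul_apply,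
      hb', smul_eq_mul, mul_one]
  simp_rw [h1]
  rw [Finset.sum_const, Finset.card_univ, Fintype.card_fin, nsmul_eq_mul]
  field_simp

end WeightSum

/-! ### The curvature polynomial as a toric moment map -/

section StructureConstants
variable {d : ℕ} {κ : Type*} [Fintype κ] (f : κ → Fin d)

/-- The weights `ε_i + ε_j - ε_k` and `ε_r` in coordinates. -/
def latticeWeight : (κ × κ × κ) ⊕ κ → Fin d → ℝ
  | Sum.inl ⟨q, r, s⟩ => Pi.single (f q) 1 + Pi.single (f r) 1 - Pi.single (f s) 1
  | Sum.inr p => Pi.single (f p) 1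

/-- The coefficients of the scalar curvature polynomial in terms of the structure constants `c` and
the diagonal entries `β` of the Killing form. -/
def curvatureCoeff (θ : ℝ) (c : κ → κ → κ → ℝ) (β : κ → ℝ) : (κ × κ × κ) ⊕ κ → ℝ
  | Sum.inl ⟨q, r, s⟩ => (1 + θ) / 4 * c q r s ^ 2
  | Sum.inr p => -((1 - θ) / 2 * β p)

theorem sum_latticeWeight (w : (κ × κ × κ) ⊕ κ) : ∑ i, latticeWeight f w i = 1 := by
  rcases w with ⟨q, r, s⟩ | p <;> simp [latticeWeight, Finset.sum_add_distrib]

theorem pairing_single (i : Fin d) (t : Fin d → ℝ) : pairing (Pi.single i 1) t = t i := by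
  simp [pairing, Pi.single_apply]

theorem pairing_latticeWeight_inl (q r s : κ) (t : Fin d → ℝ) :
    pairing (latticeWeight f (Sum.inl ⟨q, r, s⟩)) t = t (f q) + t (f r) - t (f s) := by
  rw [← pairing_single (f q) t, ← pairing_single (f r) t, ← pairing_single (f s) t]
  simp only [pairing, latticeWeight, Pi.add_apply, Pi.sub_apply, add_mul, sub_mul,
    Finset.sum_add_distrib, Finset.sum_sub_distrib]

theorem pairing_latticeWeight_inr (p : κ) (t : Fin d → ℝ) :
    pairing (latticeWeight f (Sum.inr p)) t = t (f p) := pairing_single _ _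

/-- Terms with zero coefficient are dropped, so that the remaining coefficients are positive and the
remaining weights are those that define `Δ`. -/
theorem toricMoment_subtype {ι κ : Type*} [Fintype ι] [Fintype κ] (c : κ → ℝ) (α : κ → ι → ℝ)
    (t : ι → ℝ) [Fintype {w // c w ≠ 0}] :
    toricMoment (fun w : {w // c w ≠ 0} => c w) (fun w => α w) t = toricMoment c α t := by
  classical
  rw [toricMoment, toricMoment]
  rw [← Finset.sum_subtype (Finset.univ.filter fun w => c w ≠ 0) (by simp)
    (fun w => (c w * Real.exp (-pairing (α w) t)) • α w)]
  refine Finset.sum_filter_of_ne fun w _ h h0 => h ?_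
  rw [h0, zero_mul, zero_smul]

/-- The sum is sorted by the basis vector that contributes to coordinate `i`. By antisymmetry of `c`
the two positive positions in `ε_q + ε_r - ε_s` contribute equally, which turns `(1 + θ) / 4` into
`(1 + θ) / 2`. -/
theorem toricMoment_latticeWeight {θ : ℝ} {c : κ → κ → κ → ℝ} {β : κ → ℝ}
    (hc : ∀ q r s, c q r s = - c r q s) (t : Fin d → ℝ) (i : Fin d) :
    toricMoment (curvatureCoeff θ c β) (latticeWeight f) t i =
      ∑ p, (Pi.single (f p) (1 : ℝ) : Fin d → ℝ) i * (
        -((1 + θ) / 4 * ∑ q, ∑ r, Real.exp (t (f p)) / (Real.exp (t (f q)) * Real.exp (t (f r))) *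
          c q r p ^ 2)
        + (1 + θ) / 2 * ∑ q, ∑ r, Real.exp (t (f r)) / (Real.exp (t (f p)) * Real.exp (t (f q))) *
          c p q r ^ 2
        - (1 - θ) / 2 * (β p / Real.exp (t (f p)))) := by
  set x : κ → ℝ := fun p => Real.exp (t (f p)) with hx
  set δ : κ → ℝ := fun p => (Pi.single (f p) (1 : ℝ) : Fin d → ℝ) i with hδ
  set S : κ → κ → κ → ℝ := fun q r s => x s / (x q * x r) * c q r s ^ 2 with hS
  have hSs : ∀ q r s, S q r s = S r q s := fun q r s => by
    simp only [hS]; rw [hc q r s, neg_sq, mul_comm (x q)]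
  have h1 : ∀ q r s, Real.exp (-(t (f q) + t (f r) - t (f s))) = x s / (x q * x r) := by
    intro q r s
    rw [hx, ← Real.exp_add, ← Real.exp_sub]; congr 1; ring
  have h2 : toricMoment (curvatureCoeff θ c β) (latticeWeight f) t i =
      (∑ q, ∑ r, ∑ s, (1 + θ) / 4 * (S q r s * (δ q + δ r - δ s))) +
        ∑ p, δ p * -((1 - θ) / 2 * (β p / x p)) := by
    simp only [toricMoment, Fintype.sum_sum_type, Fintype.sum_prod_type, pairing_latticeWeight_inl,
      pairing_latticeWeight_inr, Finset.sum_apply, Pi.smul_apply, smul_eq_mul, h1]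
    congr 1
    · refine Finset.sum_congr rfl fun q _ => Finset.sum_congr rfl fun r _ =>
        Finset.sum_congr rfl fun s _ => ?_
      simp only [curvatureCoeff, latticeWeight, hS, hδ, Pi.add_apply, Pi.sub_apply]
      ring
    · refine Finset.sum_congr rfl fun p _ => ?_
      simp only [curvatureCoeff, latticeWeight, hδ, Real.exp_neg, hx]
      ring
  have h3 : (∑ q, ∑ r, ∑ s, S q r s * δ r) = ∑ p, ∑ q, ∑ r, S p q r * δ p := by
    rw [Finset.sum_comm]
    exact Finset.sum_congr rfl fun q _ => Finset.sum_congr rfl fun r _ =>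
        Finset.sum_congr rfl fun s _ => by rw [hSs]
  have h4 : (∑ q, ∑ r, ∑ s, S q r s * δ s) = ∑ p, ∑ q, ∑ r, S q r p * δ p := by
    simp_rw [Finset.sum_comm (s := Finset.univ) (t := Finset.univ) (f := fun r s => S _ r s * δ s)]
    rw [Finset.sum_comm]
  have h5 : (∑ q, ∑ r, ∑ s, (1 + θ) / 4 * (S q r s * (δ q + δ r - δ s))) =
      (1 + θ) / 2 * (∑ p, ∑ q, ∑ r, S p q r * δ p) -
        (1 + θ) / 4 * ∑ p, ∑ q, ∑ r, S q r p * δ p := by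
    rw [← h4]
    have : (1 + θ) / 2 * (∑ p, ∑ q, ∑ r, S p q r * δ p) =
      (1 + θ) / 4 * (∑ p, ∑ q, ∑ r, S p q r * δ p) +
      (1 + θ) / 4 * (∑ q, ∑ r, ∑ s, S q r s * δ r) := by rw [h3]; ring
    rw [this]
    simp only [Finset.mul_sum, ← Finset.sum_add_distrib, ← Finset.sum_sub_distrib]
    exact Finset.sum_congr rfl fun q _ => Finset.sum_congr rfl fun r _ =>
        Finset.sum_congr rfl fun s _ => by ring
  rw [h2, h5, Finset.mul_sum, Finset.mul_sum, ← Finset.sum_sub_distrib, ← Finset.sum_add_distrib]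
  refine Finset.sum_congr rfl fun p _ => ?_
  simp only [← Finset.sum_mul]
  change _ = δ p * (-((1 + θ) / 4 * ∑ q, ∑ r, S q r p) + (1 + θ) / 2 * (∑ q, ∑ r, x r / (x p * x q) * c p q r ^ 2) -
    (1 - θ) / 2 * (β p / x p))
  ring

end StructureConstants

/-! ### The modified Ricci operator on diagonal metrics -/

section MomentMap
variable {E : Type*} [NormedAddCommGroup E] [NormedSpace ℝ E] [FiniteDimensional ℝ E]
  [CompleteSpace E]
  {F : Type*} [NormedAddCommGroup F] [InnerProductSpace ℝ F] [FiniteDimensional ℝ F]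
  {G : Type*} [TopologicalSpace G] [T2Space G] [CompactSpace G] [Group G] [ChartedSpace E G]
  [LieGroup 𝓘(ℝ, E) ∞ G]
  (H : Subgroup G) [ChartedSpace F (G ⧸ H)] [IsManifold 𝓘(ℝ, F) ∞ (G ⧸ H)]
  (𝔪 : Submodule ℝ (GroupLieAlgebra 𝓘(ℝ, E) G))

/-- The trilinear form `g([x, y], z)` on `𝔪 ≅ T_{eH}(G/H)`. -/
abbrev bracketForm (g : Form F) : F → F → F → ℝ :=
  structureForm g (projDeriv E F H).toLinearMap (lift H 𝔪).toLinearMap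

/-- The Killing form on `𝔪 ≅ T_{eH}(G/H)`. -/
def liftKilling : F →ₗ[ℝ] F →ₗ[ℝ] ℝ :=
  (killingForm ℝ (GroupLieAlgebra 𝓘(ℝ, E) G)).compl₁₂ (lift H 𝔪).toLinearMap
    (lift H 𝔪).toLinearMap

theorem liftKilling_apply (v w : F) : liftKilling H 𝔪 v w =
    killingForm ℝ (GroupLieAlgebra 𝓘(ℝ, E) G) (lift H 𝔪 v) (lift H 𝔪 w) := rfl

/-- The bilinear form of the operator `-(1 + θ) Ric - B`. -/
def modifiedRicciForm (θ : ℝ) (g : Form F) : F →ₗ[ℝ] F →ₗ[ℝ] ℝ :=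
  -((1 + θ) • ricciForm (chartMetric H g (base H)) (baseCoord F H)) - liftKilling H 𝔪

theorem modifiedRicci_spec (θ : ℝ) {g : Form F} (hg : ∀ v, v ≠ 0 → 0 < g v v) (v w : F) :
    g (modifiedRicci H θ 𝔪 g v) w = modifiedRicciForm H 𝔪 θ g v w := by
  have h1 : g (ricciOperator H g v) w =
    ricciForm (chartMetric H g (base H)) (baseCoord F H) v w := formOperator_spec hg _ v w
  have h2 : g (killingOperator H 𝔪 g v) w = liftKilling H 𝔪 v w := formOperator_spec hg _ v w
  have h3 : modifiedRicci H θ 𝔪 g v =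
    -((1 + θ) • ricciOperator H g v) - killingOperator H 𝔪 g v := rfl
  have h4 : modifiedRicciForm H 𝔪 θ g v w =
    -((1 + θ) * ricciForm (chartMetric H g (base H)) (baseCoord F H) v w) -
      liftKilling H 𝔪 v w := rfl
  rw [h3, h4, map_sub, map_neg, map_smul, sub_apply, neg_apply, smul_apply, h1, h2, smul_eq_mul]

variable {𝔪} [ContMDiffSMul 𝓘(ℝ, E) 𝓘(ℝ, F) ∞ G (G ⧸ H)] [SmoothTranslations F G (G ⧸ H)]

theorem liftKilling_isotropyRep
    (hπ : Manifold.IsSubmersion 𝓘(ℝ, E) 𝓘(ℝ, F) ∞ (fun a : G => (a : G ⧸ H)))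
    (h𝔪 : IsReductiveComplement F H 𝔪) (h : H) (v w : F) :
    liftKilling H 𝔪 (isotropyRep F H h v) (isotropyRep F H h w) = liftKilling H 𝔪 v w := by
  rw [liftKilling_apply, lift_isotropyRep H hπ h𝔪, lift_isotropyRep H hπ h𝔪, killingForm_Ad,
    liftKilling_apply]

theorem liftKilling_comm (v w : F) : liftKilling H 𝔪 v w = liftKilling H 𝔪 w v :=
  LieModule.traceForm_comm _ _ _ _ _

theorem bracketForm_isotropyRep
    (hπ : Manifold.IsSubmersion 𝓘(ℝ, E) 𝓘(ℝ, F) ∞ (fun a : G => (a : G ⧸ H)))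
    (h𝔪 : IsReductiveComplement F H 𝔪) {g : Form F} (hg : g ∈ invariantMetrics F H) (h : H)
    (u v w : F) : bracketForm H 𝔪 g (isotropyRep F H h u) (isotropyRep F H h v)
      (isotropyRep F H h w) = bracketForm H 𝔪 g u v w := by
  change g (projDeriv E F H ⁅lift H 𝔪 (isotropyRep F H h u), lift H 𝔪 (isotropyRep F H h v)⁆) _ =
    g (projDeriv E F H ⁅lift H 𝔪 u, lift H 𝔪 v⁆) w
  rw [lift_isotropyRep H hπ h𝔪, lift_isotropyRep H hπ h𝔪, ← Ad_lie, projDeriv_Ad H hπ, hg.2.2]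

theorem ricciForm_comm (hπ : Manifold.IsSubmersion 𝓘(ℝ, E) 𝓘(ℝ, F) ∞ (fun a : G => (a : G ⧸ H)))
    (h𝔪 : IsReductiveComplement F H 𝔪) {g : Form F} (hg : g ∈ invariantMetrics F H) (v w : F) :
    ricciForm (chartMetric H g (base H)) (baseCoord F H) v w =
      ricciForm (chartMetric H g (base H)) (baseCoord F H) w v := by
  obtain ⟨e, he⟩ := exists_isOrthonormalBasis hg.1 hg.2.1
  rw [ricciForm_eq H hπ h𝔪 hg he, ricciForm_eq H hπ h𝔪 hg he]
  have h1 := liftKilling_comm H (𝔪 := 𝔪) v w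
  rw [liftKilling_apply, liftKilling_apply] at h1
  rw [h1]
  simp only [mul_comm (structureForm _ _ _ v _ _), mul_comm (structureForm _ _ _ _ _ v)]

/-- The Ricci formula holds in every orthonormal basis, in particular in the one moved by `h`, and
its ingredients are invariant. -/
theorem ricciForm_isotropyRep
    (hπ : Manifold.IsSubmersion 𝓘(ℝ, E) 𝓘(ℝ, F) ∞ (fun a : G => (a : G ⧸ H)))
    (h𝔪 : IsReductiveComplement F H 𝔪) {g : Form F} (hg : g ∈ invariantMetrics F H) (h : H)
    (v w : F) :
    ricciForm (chartMetric H g (base H)) (baseCoord F H) (isotropyRep F H h v)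
      (isotropyRep F H h w) = ricciForm (chartMetric H g (base H)) (baseCoord F H) v w := by
  obtain ⟨e, he⟩ := exists_isOrthonormalBasis hg.1 hg.2.1
  let ρ : F ≃ₗ[ℝ] F := LinearEquiv.ofLinearMap (isotropyRep F H h).toLinearMap
    (isotropyRep F H h⁻¹).toLinearMap (LinearMap.ext (isotropyRep_apply_inv H h))
    (LinearMap.ext (isotropyRep_inv_apply H h))
  have hρ : ∀ i, (e.map ρ) i = isotropyRep F H h (e i) := fun i => Module.Basis.map_apply e ρ i
  have he' : IsOrthonormalBasis g (e.map ρ) := fun i j => by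
    rw [hρ, hρ, hg.2.2]; exact he i j
  have hc := bracketForm_isotropyRep H hπ h𝔪 hg h
  have hk := liftKilling_isotropyRep H hπ h𝔪 h v w
  rw [liftKilling_apply, liftKilling_apply] at hk
  rw [ricciForm_eq H hπ h𝔪 hg he', ricciForm_eq H hπ h𝔪 hg he, hk]
  simp only [hρ, hc]

/-- The curvature operator is a diagonal matrix. -/
theorem exists_modifiedRicci_eq_smul
    (hπ : Manifold.IsSubmersion 𝓘(ℝ, E) 𝓘(ℝ, F) ∞ (fun a : G => (a : G ⧸ H)))
    (h𝔪 : IsReductiveComplement F H 𝔪) {d : ℕ} {V : Fin d → Submodule ℝ F}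
    (hV : IsMultiplicityFreeDecomposition H V) (θ : ℝ) {g : Form F}
    (hg : g ∈ invariantMetrics F H) :
    ∃ z : Fin d → ℝ, ∀ i, ∀ v ∈ V i, modifiedRicci H θ 𝔪 g v = z i • v := by
  obtain ⟨z, hz⟩ := exists_eq_smul_of_invariant H hV hg (b := modifiedRicciForm H 𝔪 θ g)
    (fun v w => by
      change -((1 + θ) * _) - _ = -((1 + θ) * _) - _
      rw [ricciForm_comm H hπ h𝔪 hg, liftKilling_comm])
    (fun h v w => by
      change -((1 + θ) * _) - _ = -((1 + θ) * _) - _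
      rw [ricciForm_isotropyRep H hπ h𝔪 hg, liftKilling_isotropyRep H hπ h𝔪])
  refine ⟨z, fun i v hv => eq_of_pos hg.2.1 fun w => ?_⟩
  rw [modifiedRicci_spec H 𝔪 θ hg.2.1, hz i v hv, map_smul, smul_apply, smul_eq_mul]

/-- The coefficients of the Laurent polynomial `ℓ_θ` with respect to a basis of `𝔪`. -/
def basisCoeff (𝔪 : Submodule ℝ (GroupLieAlgebra 𝓘(ℝ, E) G)) (θ : ℝ) (g : Form F) {κ : Type*}
    (b : κ → F) : (κ × κ × κ) ⊕ κ → ℝ :=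
  curvatureCoeff θ (fun q r s => bracketForm H 𝔪 g (b q) (b r) (b s))
    (fun p => liftKilling H 𝔪 (b p) (b p))

/-- The Ricci formula in the orthonormal basis `b_q / √x_q` of the rescaled metric. The Killing form
receives `(1 + θ) / 2` from the Ricci part and `-1` directly, in total `-(1 - θ) / 2`. -/
theorem modifiedRicciForm_diagonalMetric
    (hπ : Manifold.IsSubmersion 𝓘(ℝ, E) 𝓘(ℝ, F) ∞ (fun a : G => (a : G ⧸ H)))
    (h𝔪 : IsReductiveComplement F H 𝔪) {d : ℕ} {V : Fin d → Submodule ℝ F}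
    (hV : IsMultiplicityFreeDecomposition H V) (θ : ℝ) {g : Form F}
    (hg : g ∈ invariantMetrics F H) {κ : Type*} [Fintype κ] [DecidableEq κ] {f : κ → Fin d}
    {b : Module.Basis κ ℝ F}
    (hb : IsOrthonormalBasis g b) (hbV : ∀ p, b p ∈ V (f p)) {x : Fin d → ℝ} (hx : ∀ i, 0 < x i)
    (p : κ) :
    (x (f p))⁻¹ * modifiedRicciForm H 𝔪 θ (diagonalMetric hV.internal g x) (b p) (b p) =
      -((1 + θ) / 4 * ∑ q, ∑ r, x (f p) / (x (f q) * x (f r)) *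
          bracketForm H 𝔪 g (b q) (b r) (b p) ^ 2)
        + (1 + θ) / 2 * ∑ q, ∑ r, x (f r) / (x (f p) * x (f q)) *
          bracketForm H 𝔪 g (b p) (b q) (b r) ^ 2
        - (1 - θ) / 2 * (liftKilling H 𝔪 (b p) (b p) / x (f p)) := by
  have hb' : ∀ i j, g (b i) (b j) = if i = j then 1 else 0 := hb
  have hgx := diagonalMetric_mem H hV hg hx
  set gx := diagonalMetric hV.internal g x with hgxdef
  set y : κ → ℝ := fun q => (Real.sqrt (x (f q)))⁻¹ with hy
  have hy2 : ∀ q, y q * y q = (x (f q))⁻¹ := fun q => by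
    rw [hy, ← mul_inv, Real.mul_self_sqrt (hx _).le]
  have hyu : ∀ q, IsUnit (y q) := fun q => (inv_ne_zero (Real.sqrt_ne_zero'.2 (hx _))).isUnit
  set e := b.isUnitSMul hyu with he
  have hei : ∀ q, e q = y q • b q := fun q => Module.Basis.isUnitSMul_apply hyu q
  have hgb : ∀ v q, gx v (b q) = x (f q) * g v (b q) := fun v q => by
    rw [hgx.1, hgxdef, diagonalMetric_of_mem hV.internal g x (hbV q), hg.1]
  have heo : IsOrthonormalBasis gx e := fun i j => by
    rw [hei, hei, map_smul, map_smul, smul_apply, hgb, hb']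
    split_ifs with hij
    · subst hij
      simp only [smul_eq_mul, mul_one]
      rw [← mul_assoc, hy2, inv_mul_cancel₀ (hx _).ne']
    · simp
  have hc : ∀ u v q, bracketForm H 𝔪 gx u v (b q) = x (f q) * bracketForm H 𝔪 g u v (b q) :=
    fun u v q => hgb _ q
  have hs1 : ∀ (k : Form F) (r : ℝ) u v w, bracketForm H 𝔪 k (r • u) v w =
      r * bracketForm H 𝔪 k u v w := fun k r u v w => by
    simp only [bracketForm, structureForm, map_smul, smul_lie, smul_apply, smul_eq_mul]
  have hs2 : ∀ (k : Form F) (r : ℝ) u v w, bracketForm H 𝔪 k u (r • v) w =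
      r * bracketForm H 𝔪 k u v w := fun k r u v w => by
    simp only [bracketForm, structureForm, map_smul, lie_smul, smul_apply, smul_eq_mul]
  have hs3 : ∀ (k : Form F) (r : ℝ) u v w, bracketForm H 𝔪 k u v (r • w) =
      r * bracketForm H 𝔪 k u v w := fun k r u v w => by
    simp only [bracketForm, structureForm, map_smul, smul_eq_mul]
  have h4 : modifiedRicciForm H 𝔪 θ gx (b p) (b p) =
    -((1 + θ) * ricciForm (chartMetric H gx (base H)) (baseCoord F H) (b p) (b p)) -
      liftKilling H 𝔪 (b p) (b p) := rfl
  have h5 := ricciForm_eq H hπ h𝔪 hgx heo (b p) (b p)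
  have h6 : ∀ q r, bracketForm H 𝔪 gx (e q) (e r) (b p) * bracketForm H 𝔪 gx (e q) (e r) (b p) =
      x (f p) * (x (f p) / (x (f q) * x (f r)) * bracketForm H 𝔪 g (b q) (b r) (b p) ^ 2) := by
    intro q r
    rw [hei, hei, hs1, hs2, hc]
    have : ∀ c : ℝ, y q * (y r * (x (f p) * c)) * (y q * (y r * (x (f p) * c))) =
      (y q * y q) * (y r * y r) * (x (f p) * x (f p) * c ^ 2) := fun c => by ring
    rw [this, hy2, hy2]
    ring
  have h7 : ∀ q r, bracketForm H 𝔪 gx (b p) (e q) (e r) * bracketForm H 𝔪 gx (b p) (e q) (e r) =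
      x (f p) * (x (f r) / (x (f p) * x (f q)) * bracketForm H 𝔪 g (b p) (b q) (b r) ^ 2) := by
    intro q r
    rw [hei, hei, hs2, hs3, hc]
    have : ∀ c : ℝ, y q * (y r * (x (f r) * c)) * (y q * (y r * (x (f r) * c))) =
      (y q * y q) * (y r * y r) * (x (f r) * x (f r) * c ^ 2) := fun c => by ring
    rw [this, hy2, hy2]
    have := (hx (f r)).ne'
    have := (hx (f p)).ne'
    have := (hx (f q)).ne'
    field_simp
  simp only [h6, h7] at h5
  simp only [← Finset.mul_sum] at h5
  rw [← liftKilling_apply] at h5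
  rw [h4, h5]
  have := (hx (f p)).ne'
  field_simp
  ring

end MomentMap

/-! ### Positivity, spanning and the polytope -/

section MomentMap
variable {E : Type*} [NormedAddCommGroup E] [NormedSpace ℝ E] [FiniteDimensional ℝ E]
  [CompleteSpace E]
  {F : Type*} [NormedAddCommGroup F] [InnerProductSpace ℝ F] [FiniteDimensional ℝ F]
  {G : Type*} [TopologicalSpace G] [T2Space G] [CompactSpace G] [Group G] [ChartedSpace E G]
  [LieGroup 𝓘(ℝ, E) ∞ G]
  (H : Subgroup G) [ChartedSpace F (G ⧸ H)] [IsManifold 𝓘(ℝ, F) ∞ (G ⧸ H)]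
  {𝔪 : Submodule ℝ (GroupLieAlgebra 𝓘(ℝ, E) G)}
  [ContMDiffSMul 𝓘(ℝ, E) 𝓘(ℝ, F) ∞ G (G ⧸ H)] [SmoothTranslations F G (G ⧸ H)]
  {d : ℕ} {V : Fin d → Submodule ℝ F}

/-- By Schur's lemma the operator is a scalar on each `V i`, which can be read off from any basis
vector. The toric sum adds this scalar once for each basis vector of `V i`, and the factor `1 / dim
V i` in the weight `ε_i` compensates. -/
theorem modifiedRicci_diagonalMetric
    (hπ : Manifold.IsSubmersion 𝓘(ℝ, E) 𝓘(ℝ, F) ∞ (fun a : G => (a : G ⧸ H)))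
    (h𝔪 : IsReductiveComplement F H 𝔪)
    (hV : IsMultiplicityFreeDecomposition H V) (θ : ℝ) {g : Form F}
    (hg : g ∈ invariantMetrics F H)
    {b : Module.Basis (Σ i, Fin (Module.finrank ℝ (V i))) ℝ F}
    (hb : IsOrthonormalBasis g b) (hbV : ∀ p, b p ∈ V p.1) (t : Fin d → ℝ) :
    modifiedRicci H θ 𝔪 (diagonalMetric hV.internal g fun i => Real.exp (t i)) =
      weightSum hV.internal (toricMoment (basisCoeff H 𝔪 θ g b) (latticeWeight Sigma.fst) t) := by
  have hx : ∀ i, 0 < Real.exp (t i) := fun i => Real.exp_pos _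
  have hgx := diagonalMetric_mem H hV hg hx
  obtain ⟨z, hz⟩ := exists_modifiedRicci_eq_smul H hπ h𝔪 hV θ hgx
  have hentry : ∀ p, (Real.exp (t p.1))⁻¹ * modifiedRicciForm H 𝔪 θ
      (diagonalMetric hV.internal g fun i => Real.exp (t i)) (b p) (b p) = z p.1 := by
    intro p
    rw [← modifiedRicci_spec H 𝔪 θ hgx.2.1, hz p.1 _ (hbV p), map_smul, smul_apply,
      diagonalMetric_of_mem hV.internal g _ (hbV p), hb p p, if_pos rfl, smul_eq_mul]
    have := (hx p.1).ne'
    field_simp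
  have hm : ∀ i, toricMoment (basisCoeff H 𝔪 θ g b) (latticeWeight Sigma.fst) t i =
      z i * Module.finrank ℝ (V i) := by
    intro i
    rw [basisCoeff, toricMoment_latticeWeight Sigma.fst
      (c := fun q r s => bracketForm H 𝔪 g (b q) (b r) (b s)) (fun q r s => have := finiteDimensional_groupLieAlgebra (E := E) (G := G); structureForm_swap _ _ _)]
    simp_rw [← modifiedRicciForm_diagonalMetric H hπ h𝔪 hV θ hg hb hbV hx, hentry]
    rw [Fintype.sum_sigma, Finset.sum_eq_single i]
    · simp [mul_comm]
    · intro j _ hj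
      simp [Ne.symm hj]
    · simp
  have h := eq_of_forall_summand hV.internal
    (f := (modifiedRicci H θ 𝔪 (diagonalMetric hV.internal g fun i => Real.exp (t i))).toLinearMap)
    (g := (weightSum hV.internal (toricMoment (basisCoeff H 𝔪 θ g b)
      (latticeWeight Sigma.fst) t)).toLinearMap) fun i v hv => by
    rw [ContinuousLinearMap.coe_coe, ContinuousLinearMap.coe_coe, hz i v hv,
      weightSum_apply_of_mem hV.internal _ hv, hm]
    have : Nontrivial (V i) := (Submodule.nontrivial_iff_ne_bot).2 (hV.irreducible i).ne_bot
    have hpos : (Module.finrank ℝ (V i) : ℝ) ≠ 0 := Nat.cast_ne_zero.2 Module.finrank_pos.ne'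
    rw [mul_assoc, mul_inv_cancel₀ hpos, mul_one]
  exact ContinuousLinearMap.coe_injective h

/-- Here `|θ| < 1` enters: `1 + θ` and `1 - θ` are positive, while the Killing form is nonpositive
on the diagonal. -/
theorem basisCoeff_nonneg {θ : ℝ} (hθ : |θ| < 1) (g : Form F) {κ : Type*} (b : κ → F)
    (w : (κ × κ × κ) ⊕ κ) : 0 ≤ basisCoeff H 𝔪 θ g b w := by
  obtain ⟨h1, h2⟩ := abs_lt.1 hθ
  rcases w with ⟨q, r, s⟩ | p
  · exact mul_nonneg (by linarith) (sq_nonneg _)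
  · have := killingForm_self_nonpos (lift H 𝔪 (b p))
    rw [← liftKilling_apply] at this
    change 0 ≤ -((1 - θ) / 2 * liftKilling H 𝔪 (b p) (b p))
    nlinarith

theorem basisCoeff_inl_ne_zero {θ : ℝ} (hθ : |θ| < 1) (g : Form F) {κ : Type*} (b : κ → F)
    (q r s : κ) : basisCoeff H 𝔪 θ g b (Sum.inl ⟨q, r, s⟩) ≠ 0 ↔
      bracketForm H 𝔪 g (b q) (b r) (b s) ≠ 0 := by
  obtain ⟨h1, h2⟩ := abs_lt.1 hθ
  have h3 : (1 + θ) / 4 ≠ 0 := by linarith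
  change (1 + θ) / 4 * bracketForm H 𝔪 g (b q) (b r) (b s) ^ 2 ≠ 0 ↔ _
  simp [h3]

theorem basisCoeff_inr_ne_zero {θ : ℝ} (hθ : |θ| < 1) (g : Form F) {κ : Type*} (b : κ → F)
    (p : κ) : basisCoeff H 𝔪 θ g b (Sum.inr p) ≠ 0 ↔ liftKilling H 𝔪 (b p) (b p) ≠ 0 := by
  obtain ⟨h1, h2⟩ := abs_lt.1 hθ
  have h3 : (1 - θ) / 2 ≠ 0 := by linarith
  change -((1 - θ) / 2 * liftKilling H 𝔪 (b p) (b p)) ≠ 0 ↔ _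
  rw [neg_ne_zero, mul_ne_zero_iff]
  exact and_iff_right h3

theorem bracketForm_eq_sum {g : Form F} {κ : Type*} [Fintype κ] [DecidableEq κ]
    {b : Module.Basis κ ℝ F} (hb : IsOrthonormalBasis g b) (u v w : F) :
    bracketForm H 𝔪 g u v w = ∑ q, ∑ r, ∑ s, g u (b q) * g v (b r) * g w (b s) *
      bracketForm H 𝔪 g (b q) (b r) (b s) := by
  have h1 : ∀ u v w, bracketForm H 𝔪 g u v w = ∑ q, g u (b q) * bracketForm H 𝔪 g (b q) v w := by
    intro u v w
    conv_lhs => rw [← hb.sum_apply u]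
    simp only [bracketForm, structureForm, map_sum, map_smul, sum_lie, smul_lie, sum_apply,
      smul_apply, smul_eq_mul]
  have h2 : ∀ u v w, bracketForm H 𝔪 g u v w = ∑ r, g v (b r) * bracketForm H 𝔪 g u (b r) w := by
    intro u v w
    conv_lhs => rw [← hb.sum_apply v]
    simp only [bracketForm, structureForm, map_sum, map_smul, lie_sum, lie_smul, sum_apply,
      smul_apply, smul_eq_mul]
  have h3 : ∀ u v w, bracketForm H 𝔪 g u v w = ∑ s, g w (b s) * bracketForm H 𝔪 g u v (b s) := by
    intro u v w
    conv_lhs => rw [← hb.sum_apply w]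
    simp only [bracketForm, structureForm, map_sum, map_smul, smul_eq_mul]
  rw [h1]
  refine Finset.sum_congr rfl fun q _ => ?_
  rw [h2, Finset.mul_sum]
  refine Finset.sum_congr rfl fun r _ => ?_
  rw [h3, Finset.mul_sum, Finset.mul_sum]
  exact Finset.sum_congr rfl fun s _ => by ring

/-- The weights of `ℓ_θ` span, since `G/H` is simply connected. -/
theorem eq_zero_of_pairing_eq_zero [SimplyConnectedSpace (G ⧸ H)]
    (hπ : Manifold.IsSubmersion 𝓘(ℝ, E) 𝓘(ℝ, F) ∞ (fun a : G => (a : G ⧸ H)))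
    (h𝔪 : IsReductiveComplement F H 𝔪)
    (hV : IsMultiplicityFreeDecomposition H V) {θ : ℝ} (hθ : |θ| < 1) {g : Form F}
    (hg : g ∈ invariantMetrics F H)
    {b : Module.Basis (Σ i, Fin (Module.finrank ℝ (V i))) ℝ F}
    (hb : IsOrthonormalBasis g b) {t : Fin d → ℝ}
    (ht : ∀ w, basisCoeff H 𝔪 θ g b w ≠ 0 → pairing (latticeWeight Sigma.fst w) t = 0) : t = 0 := by
  by_contra hne
  obtain ⟨i, hi⟩ := Function.ne_iff.1 hne
  have : Nontrivial (V i) := (Submodule.nontrivial_iff_ne_bot).2 (hV.irreducible i).ne_bot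
  have hpos : 0 < Module.finrank ℝ (V i) := Module.finrank_pos
  set p : Σ i, Fin (Module.finrank ℝ (V i)) := ⟨i, ⟨0, hpos⟩⟩ with hp
  -- A vector that is not central has nonzero Killing square, so `ε_q` is among the weights. In
  -- particular `b p` is central, since `t_i ≠ 0`.
  have hcentral : ∀ q, (∃ Y : GroupLieAlgebra 𝓘(ℝ, E) G, ⁅lift H 𝔪 (b q), Y⁆ ≠ 0) → t q.1 = 0 := by
    rintro q ⟨Y, hY⟩
    have h1 : liftKilling H 𝔪 (b q) (b q) ≠ 0 := fun h0 =>
      hY (lie_eq_zero_of_killingForm_self _ h0 Y)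
    have h2 := ht _ ((basisCoeff_inr_ne_zero H hθ g b q).2 h1)
    rwa [pairing_latticeWeight_inr] at h2
  have hpc : ∀ Y : GroupLieAlgebra 𝓘(ℝ, E) G, ⁅lift H 𝔪 (b p), Y⁆ = 0 := fun Y => by
    by_contra h
    exact hi (hcentral p ⟨Y, h⟩)
  -- If this were nonzero, neither `b q` nor `b s` would be central, so `t` would vanish at both;
  -- the weight `ε_q + ε_s - ε_p` would then give `t_p = 0`.
  have hC : ∀ q s, bracketForm H 𝔪 g (b q) (b s) (b p) = 0 := by
    intro q s
    by_contra h
    have h1 := ht _ ((basisCoeff_inl_ne_zero H hθ g b q s p).2 h)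
    rw [pairing_latticeWeight_inl] at h1
    have h2 : ⁅lift H 𝔪 (b q), lift H 𝔪 (b s)⁆ ≠ 0 := by
      intro h0
      refine h ?_
      change g (projDeriv E F H ⁅lift H 𝔪 (b q), lift H 𝔪 (b s)⁆) (b p) = 0
      rw [h0]; simp
    have h3 : ⁅lift H 𝔪 (b s), lift H 𝔪 (b q)⁆ ≠ 0 := by
      rw [← lie_skew]; exact neg_ne_zero.2 h2
    rw [hcentral q ⟨_, h2⟩, hcentral s ⟨_, h3⟩] at h1
    refine hi ?_
    change t p.1 = 0
    linarith
  -- The isotropy algebra acts by skew operators, and it annihilates the central vector `b p`.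
  have h𝔥 : ∀ X Y : GroupLieAlgebra 𝓘(ℝ, E) G, projDeriv E F H X = 0 → g (projDeriv E F H ⁅X, Y⁆) (b p) = 0 := by
    intro X Y hX
    have hA := isNomizuMap (E := E) H hπ hg
    have h1 := hA.torsion X Y
    have h2 := hA.torsion X (lift H 𝔪 (b p))
    have h3 := hA.skew X (projDeriv E F H Y) (b p)
    have h4 : ⁅X, lift H 𝔪 (b p)⁆ = 0 := by rw [← lie_skew, hpc, neg_zero]
    simp only [ContinuousLinearMap.coe_coe, hX, map_zero, sub_zero, h4,
      (lift_spec H hπ h𝔪 _).1] at h1 h2 h3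
    rw [h2, map_zero, add_zero] at h3
    rw [← h1, h3]
  have hbr : ∀ X Y : GroupLieAlgebra 𝓘(ℝ, E) G, g (projDeriv E F H ⁅X, Y⁆) (b p) = 0 := by
    intro X Y
    have hdecomp : ∀ X : GroupLieAlgebra 𝓘(ℝ, E) G, ∃ X' v, projDeriv E F H X' = 0 ∧ X = X' + lift H 𝔪 v := fun X =>
      ⟨X - lift H 𝔪 (projDeriv E F H X), projDeriv E F H X, by
        rw [map_sub, (lift_spec H hπ h𝔪 _).1, sub_self], (sub_add_cancel _ _).symm⟩
    obtain ⟨X', v, hX', rfl⟩ := hdecomp X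
    obtain ⟨Y', w, hY', rfl⟩ := hdecomp Y
    have h1 : g (projDeriv E F H ⁅lift H 𝔪 v, lift H 𝔪 w⁆) (b p) = 0 := by
      have hb' : ∀ i j, g (b i) (b j) = if i = j then 1 else 0 := hb
      refine (bracketForm_eq_sum H hb v w (b p)).trans ?_
      refine Finset.sum_eq_zero fun q _ => Finset.sum_eq_zero fun r _ =>
        Finset.sum_eq_zero fun s _ => ?_
      by_cases hs : p = s
      · rw [← hs, hC, mul_zero]
      · rw [hb', if_neg hs]; ring
    have h2 : g (projDeriv E F H ⁅lift H 𝔪 v, Y'⁆) (b p) = 0 := by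
      rw [← lie_skew, map_neg, map_neg, neg_apply, h𝔥 _ _ hY', neg_zero]
    rw [add_lie, lie_add (lift H 𝔪 v), map_add, map_add, map_add, map_add, add_apply, add_apply,
      h𝔥 _ _ hX', h1, h2]
    simp
  -- The functional `X ↦ g(proj X, b p)` vanishes on `𝔥` and on brackets, hence identically,
  -- although its value on the lift of `b p` is `1`.
  have hl := functional_eq_zero (E := E) H hπ ((g.flip (b p)) ∘L proj E F H)
    (fun X Y => (congrArg (fun Z : E => g (proj E F H Z) (b p))
      (bracket_eq_chartBracket (E := E) (G := G) X Y)).symm.trans (hbr X Y))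
    (fun X hX => by
      change g (proj E F H X) (b p) = 0
      rw [hX]; simp)
  have h1 := congrArg (fun l : E →L[ℝ] ℝ => l (lift H 𝔪 (b p))) hl
  have h2 : g (projDeriv E F H (lift H 𝔪 (b p))) (b p) = 0 := h1
  rw [(lift_spec H hπ h𝔪 _).1, hb p p, if_pos rfl] at h2
  exact one_ne_zero h2

/-- By multilinearity a bracket component is nonzero on a triple of blocks exactly when it is
nonzero on some triple of adapted basis vectors. By Schur's lemma `B` is a multiple of `g` on each
`V r`, so a single basis vector detects whether it vanishes there. -/
theorem momentPolytope_eq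
    (hπ : Manifold.IsSubmersion 𝓘(ℝ, E) 𝓘(ℝ, F) ∞ (fun a : G => (a : G ⧸ H)))
    (h𝔪 : IsReductiveComplement F H 𝔪)
    (hV : IsMultiplicityFreeDecomposition H V) {θ : ℝ} (hθ : |θ| < 1) {g : Form F}
    (hg : g ∈ invariantMetrics F H)
    {b : Module.Basis (Σ i, Fin (Module.finrank ℝ (V i))) ℝ F}
    (hb : IsOrthonormalBasis g b) (hbV : ∀ p, b p ∈ V p.1) :
    momentPolytope H V hV.internal 𝔪 g = convexHull ℝ (range
      fun w : {w // basisCoeff H 𝔪 θ g b w ≠ 0} =>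
        weightSum hV.internal (latticeWeight Sigma.fst w.1)) := by
  have hblock : ∀ p, lift H 𝔪 (b p) ∈ block H V 𝔪 p.1 := fun p => by
    obtain ⟨h1, h2⟩ := lift_spec H hπ h𝔪 (b p)
    refine ⟨h2, ?_⟩
    change projDeriv E F H (lift H 𝔪 (b p)) ∈ V p.1
    rw [h1]
    exact hbV p
  have hzero : ∀ {i v p}, v ∈ V i → g v (b p) ≠ 0 → p.1 = i := fun {i v p} hv h => by
    by_contra hne
    exact h (invariantMetric_orthogonal H hV hg (Ne.symm hne) hv (hbV p))
  unfold momentPolytope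
  congr 1
  ext A
  constructor
  · rintro (⟨i, j, k, ⟨X, hX, Y, hY, Z, hZ, hne⟩, rfl⟩ | ⟨r, ⟨X, hX, Y, hY, hne⟩, rfl⟩)
    · rw [← lift_proj H hπ h𝔪 hX.1, ← lift_proj H hπ h𝔪 hY.1] at hne
      change bracketForm H 𝔪 g (projDeriv E F H X) (projDeriv E F H Y) (projDeriv E F H Z) ≠ 0
        at hne
      rw [bracketForm_eq_sum H hb] at hne
      obtain ⟨q, -, hne⟩ := Finset.exists_ne_zero_of_sum_ne_zero hne
      obtain ⟨r, -, hne⟩ := Finset.exists_ne_zero_of_sum_ne_zero hne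
      obtain ⟨s, -, hne⟩ := Finset.exists_ne_zero_of_sum_ne_zero hne
      obtain ⟨h1, h2⟩ := mul_ne_zero_iff.1 hne
      obtain ⟨h1, h3⟩ := mul_ne_zero_iff.1 h1
      obtain ⟨h1, h4⟩ := mul_ne_zero_iff.1 h1
      refine ⟨⟨Sum.inl ⟨q, r, s⟩, (basisCoeff_inl_ne_zero H hθ g b q r s).2 h2⟩, ?_⟩
      simp only [latticeWeight, map_add, map_sub, weightSum_single]
      rw [hzero hX.2 h1, hzero hY.2 h4, hzero hZ.2 h3]
    · rw [← lift_proj H hπ h𝔪 hX.1, ← lift_proj H hπ h𝔪 hY.1, ← liftKilling_apply] at hne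
      obtain ⟨x, hx⟩ := exists_eq_smul_of_invariant H hV hg (b := liftKilling H 𝔪)
        (liftKilling_comm H) (liftKilling_isotropyRep H hπ h𝔪)
      have hne' : x r * g (projDeriv E F H X) (projDeriv E F H Y) ≠ 0 := fun h0 =>
        hne ((hx r _ hX.2 _).trans h0)
      have : Nontrivial (V r) := (Submodule.nontrivial_iff_ne_bot).2 (hV.irreducible r).ne_bot
      have hpos : 0 < Module.finrank ℝ (V r) := Module.finrank_pos
      have h1 := hx r _ (hbV ⟨r, ⟨0, hpos⟩⟩) (b ⟨r, ⟨0, hpos⟩⟩)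
      rw [hb, if_pos rfl, mul_one] at h1
      refine ⟨⟨Sum.inr ⟨r, ⟨0, hpos⟩⟩, (basisCoeff_inr_ne_zero H hθ g b _).2 ?_⟩, ?_⟩
      · rw [h1]; exact left_ne_zero_of_mul hne'
      · exact weightSum_single hV.internal r
  · rintro ⟨⟨⟨q, r, s⟩ | p, hw⟩, rfl⟩
    · refine Or.inl ⟨q.1, r.1, s.1, ⟨_, hblock q, _, hblock r, _, hblock s, ?_⟩, ?_⟩
      · rw [(lift_spec H hπ h𝔪 (b s)).1]
        exact (basisCoeff_inl_ne_zero H hθ g b q r s).1 hw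
      · simp only [latticeWeight, map_add, map_sub, weightSum_single]
    · exact Or.inr ⟨p.1, ⟨_, hblock p, _, hblock p, (basisCoeff_inr_ne_zero H hθ g b p).1 hw⟩,
        weightSum_single hV.internal p.1⟩

end MomentMap

/-! ### From the toric moment map to the normalized moment map -/

section Normalization
variable {κ : Type*} [Fintype κ] [Nonempty κ] {d : ℕ} {c : κ → ℝ} {α : κ → Fin d → ℝ}
  {W : Type*} [NormedAddCommGroup W] [NormedSpace ℝ W] [FiniteDimensional ℝ W]
  {X : Type*} [NormedAddCommGroup X] [NormedSpace ℝ X]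

/-- The moment map of a Laurent polynomial with positive coefficients, normalized to have trace `1`,
maps a level set of a homogeneous function diffeomorphically onto the interior of the Newton
polytope. -/
theorem isDiffeomorphismOnto_of_toricMoment (hc : ∀ w, 0 < c w)
    (hα : ∀ t, (∀ w, pairing (α w) t = 0) → t = 0) (hsum : ∀ w, ∑ i, α w i = 1)
    {J : (Fin d → ℝ) →ₗ[ℝ] W} (hJ : Function.Injective J)
    {γ : (Fin d → ℝ) → X} (hγ : ContDiff ℝ ∞ γ) {τ : X → Fin d → ℝ} (hτγ : ∀ t, τ (γ t) = t)
    (hτ : ∀ t, ContDiffAt ℝ ∞ τ (γ t)) {D : (Fin d → ℝ) → ℝ} (hD : ContDiff ℝ ∞ D)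
    (hDpos : ∀ t, 0 < D t) {n : ℝ} (hn : n ≠ 0)
    (hDn : ∀ t r, D (t + fun _ => r) = Real.exp (n * r) * D t) {f : X → W}
    (hf : ∀ t, f (γ t) = (∑ i, toricMoment c α t i)⁻¹ • J (toricMoment c α t)) :
    IsDiffeomorphismOnto f (γ '' {t | D t = 1})
      (intrinsicInterior ℝ (convexHull ℝ (range fun w => J (α w)))) := by
  rw [intrinsicInterior_convexHull_range]
  set T : Set W := {x | ∃ p : κ → ℝ, (∀ k, 0 < p k) ∧ ∑ k, p k = 1 ∧ ∑ k, p k • J (α k) = x} with hT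
  set N := toricMoment c α with hN
  have hNadd : ∀ t r, N (t + fun _ => r) = Real.exp (-r) • N t := toricMoment_add_const hsum
  have hσ : ∀ t, ∑ i, N t i = ∑ w, c w * Real.exp (-pairing (α w) t) := sum_toricMoment hsum
  have hσpos : ∀ t, 0 < ∑ i, N t i := fun t => by
    rw [hσ]
    exact Finset.sum_pos (fun w _ => mul_pos (hc w) (Real.exp_pos _)) Finset.univ_nonempty
  obtain ⟨L, hL⟩ := J.exists_leftInverse_of_injective (LinearMap.ker_eq_bot.2 hJ)
  have hLJ : ∀ a, L (J a) = a := fun a => congrArg (fun l : (Fin d → ℝ) →ₗ[ℝ] Fin d → ℝ => l a) hL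
  -- `S` moves `t` in the direction of constants to the slice `D = 1`; the amount is forced by the
  -- homogeneity of degree `n`.
  set S : (Fin d → ℝ) → Fin d → ℝ := fun t => t + fun _ => -(n⁻¹ * Real.log (D t)) with hS
  have hSsmooth : ContDiff ℝ ∞ S := by
    refine contDiff_id.add (contDiff_pi.2 fun _ => ?_)
    exact (contDiff_const.mul (hD.log fun t => (hDpos t).ne')).neg
  set Ψ : W → X := fun A => γ (S (toricInverse c α (L A))) with hΨ
  have hmaps : MapsTo f (γ '' {t | D t = 1}) T := by
    rintro _ ⟨t, -, rfl⟩
    refine ⟨fun w => (∑ i, N t i)⁻¹ * (c w * Real.exp (-pairing (α w) t)), fun w =>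
      mul_pos (inv_pos.2 (hσpos t)) (mul_pos (hc w) (Real.exp_pos _)), ?_, ?_⟩
    · rw [← Finset.mul_sum, ← hσ, inv_mul_cancel₀ (hσpos t).ne']
    · rw [hf, show N t = ∑ w, (c w * Real.exp (-pairing (α w) t)) • α w from rfl, map_sum,
        Finset.smul_sum]
      simp_rw [map_smul, smul_smul]
  have hleft : LeftInvOn Ψ f (γ '' {t | D t = 1}) := by
    rintro _ ⟨t, ht, rfl⟩
    -- Dividing by the trace is itself a shift of `t` by a constant, so the inverse of the toric
    -- moment map followed by `S` recovers `t`.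
    have h1 : L (f (γ t)) = N (t + fun _ => Real.log (∑ i, N t i)) := by
      rw [hf, map_smul, hLJ, hNadd, Real.exp_neg, Real.exp_log (hσpos t)]
    have h2 : S (t + fun _ => Real.log (∑ i, N t i)) = t := by
      have h3 : Real.log (D (t + fun _ => Real.log (∑ i, N t i))) =
          n * Real.log (∑ i, N t i) := by
        rw [hDn, show D t = 1 from ht, mul_one, Real.log_exp]
      ext i
      simp only [hS, h3, Pi.add_apply]
      rw [inv_mul_cancel_left₀ hn]
      ring
    simp only [hΨ, h1]
    rw [hN, toricInverse_toricMoment hc hα, h2]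
  -- Coefficients of sum `1` give a point of trace `1`, because each weight has coordinate sum `1`.
  have hpre : ∀ A ∈ T, ∃ t, J (N t) = A ∧ ∑ i, N t i = 1 := by
    rintro A ⟨p, hp, hp1, rfl⟩
    obtain ⟨t, ht⟩ := exists_toricMoment_eq hc hα hp
    refine ⟨t, ?_, ?_⟩
    · rw [hN, ht, map_sum]; simp_rw [map_smul]
    · rw [hN, ht]
      simp only [Finset.sum_apply, Pi.smul_apply, smul_eq_mul]
      rw [Finset.sum_comm]
      simp_rw [← Finset.mul_sum, hsum, mul_one]
      exact hp1
  have hmem : MapsTo Ψ T (γ '' {t | D t = 1}) := by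
    intro A hA
    refine ⟨_, ?_, rfl⟩
    change D (_ + _) = 1
    rw [hDn, mul_neg, mul_inv_cancel_left₀ hn, Real.exp_neg, Real.exp_log (hDpos _),
      inv_mul_cancel₀ (hDpos _).ne']
  have hright : RightInvOn Ψ f T := by
    intro A hA
    obtain ⟨t, rfl, ht⟩ := hpre A hA
    simp only [hΨ, hLJ]
    rw [hN, toricInverse_toricMoment hc hα, hf, hS]
    simp only [hNadd, Pi.smul_apply, map_smul, smul_eq_mul, ← Finset.mul_sum]
    rw [ht, mul_one, smul_smul,
      inv_mul_cancel₀ (Real.exp_pos _).ne', one_smul]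
  have hbij : BijOn f (γ '' {t | D t = 1}) T := InvOn.bijOn ⟨hleft, hright⟩ hmaps hmem
  refine ⟨hbij, ?_, ?_⟩
  · have hNs : ContDiff ℝ ∞ N := contDiff_toricMoment c α
    have h1 : ContDiff ℝ ∞ fun t => (∑ i, N t i)⁻¹ • J (N t) := by
      refine ContDiff.smul (ContDiff.inv (ContDiff.sum fun i _ => ?_) fun t => (hσpos t).ne') ?_
      · exact (contDiff_pi.1 hNs) i
      · exact (LinearMap.toContinuousLinearMap J).contDiff.comp hNs
    refine ContDiffOn.congr (f := fun g => (∑ i, N (τ g) i)⁻¹ • J (N (τ g))) ?_ ?_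
    · rintro _ ⟨t, -, rfl⟩
      exact (h1.contDiffAt.comp (γ t) (hτ t)).contDiffWithinAt
    · rintro _ ⟨t, -, rfl⟩
      rw [hf, hτγ]
  · refine ContDiffOn.congr (f := Ψ) ?_ ?_
    · intro A hA
      obtain ⟨t, rfl, -⟩ := hpre A hA
      have h1 : ContDiffAt ℝ ∞ (toricInverse c α) (L (J (N t))) := by
        rw [hLJ]
        exact contDiffAt_toricInverse hc hα t
      exact ((hγ.comp hSsmooth).contDiffAt.comp (J (N t)) (h1.comp (J (N t))
        (LinearMap.toContinuousLinearMap L).contDiff.contDiffAt)).contDiffWithinAt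
    · intro A hA
      conv_lhs => rw [← hright hA]
      exact hbij.injOn.leftInvOn_invFunOn (hmem hA)

end Normalization

end HomogeneousSpace

end

/-! ### The main theorem -/

theorem mainTheorem4
    {E : Type*} [NormedAddCommGroup E] [NormedSpace ℝ E] [FiniteDimensional ℝ E]
    [CompleteSpace E]
    {F : Type*} [NormedAddCommGroup F] [InnerProductSpace ℝ F] [FiniteDimensional ℝ F]
    [MeasurableSpace F] [BorelSpace F]
    {G : Type*} [TopologicalSpace G] [T2Space G] [CompactSpace G] [Group G]
    [ChartedSpace E G] [LieGroup 𝓘(ℝ, E) ∞ G]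
    (H : Subgroup G) (hH : IsClosed (H : Set G))
    [ChartedSpace F (G ⧸ H)] [IsManifold 𝓘(ℝ, F) ∞ (G ⧸ H)]
    [MeasurableSpace (G ⧸ H)] [BorelSpace (G ⧸ H)]
    (hπ : Manifold.IsSubmersion 𝓘(ℝ, E) 𝓘(ℝ, F) ∞ (fun a : G => (a : G ⧸ H)))
    [ConnectedSpace (G ⧸ H)] [SimplyConnectedSpace (G ⧸ H)]
    {d : ℕ} (hd : 1 ≤ d) (V : Fin d → Submodule ℝ F)
    (hV : HomogeneousSpace.IsMultiplicityFreeDecomposition H V)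
    (𝔪 : Submodule ℝ (GroupLieAlgebra 𝓘(ℝ, E) G))
    (h𝔪 : HomogeneousSpace.IsReductiveComplement F H 𝔪)
    (g₁ : HomogeneousSpace.Form F) (hg₁ : g₁ ∈ HomogeneousSpace.invariantMetrics F H)
    (θ : ℝ) (hθ : |θ| < 1) :
    HomogeneousSpace.IsDiffeomorphismOnto (HomogeneousSpace.momentMap H θ 𝔪)
        (HomogeneousSpace.unitVolumeMetrics F H)
        (intrinsicInterior ℝ (HomogeneousSpace.momentPolytope H V hV.internal 𝔪 g₁)) ∧
      Module.finrank ℝ (vectorSpan ℝ (HomogeneousSpace.momentPolytope H V hV.internal 𝔪 g₁))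
        = d - 1 := by
  classical
  have hsmul := HomogeneousSpace.contMDiffSMul_quotient H hπ
  have htrans := HomogeneousSpace.smoothTranslations_of_contMDiffSMul hsmul
  have hcompact : CompactSpace (G ⧸ H) := Quotient.compactSpace
  obtain ⟨b, hb, hbV⟩ := HomogeneousSpace.exists_adapted_basis H hV hg₁
  set c := HomogeneousSpace.basisCoeff H 𝔪 θ g₁ b with hc_def
  have hc : ∀ w : {w // c w ≠ 0}, 0 < c w := fun w =>
    (HomogeneousSpace.basisCoeff_nonneg H hθ g₁ b w.1).lt_of_ne' w.2
  have hα : ∀ t : Fin d → ℝ, (∀ w : {w // c w ≠ 0},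
      HomogeneousSpace.pairing (HomogeneousSpace.latticeWeight Sigma.fst w.1) t = 0) → t = 0 :=
    fun t ht => HomogeneousSpace.eq_zero_of_pairing_eq_zero H hπ h𝔪 hV hθ hg₁ hb
      fun w hw => ht ⟨w, hw⟩
  -- An empty family of weights would annihilate the vector `(1, …, 1)`, which is nonzero because `d
  -- ≥ 1`.
  have hne : Nonempty {w // c w ≠ 0} := by
    by_contra h
    have h0 := hα (fun _ => 1) fun w => (h ⟨w⟩).elim
    exact one_ne_zero (congrFun h0 ⟨0, hd⟩)
  have hsum : ∀ w : {w // c w ≠ 0}, ∑ i, HomogeneousSpace.latticeWeight Sigma.fst w.1 i = 1 :=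
    fun w => HomogeneousSpace.sum_latticeWeight _ _
  have hbot : ∀ i, V i ≠ ⊥ := fun i => (hV.irreducible i).ne_bot
  have hJ := HomogeneousSpace.weightSum_injective hV.internal hbot
  rw [HomogeneousSpace.momentPolytope_eq H hπ h𝔪 hV hθ hg₁ hb hbV]
  refine ⟨?_, HomogeneousSpace.finrank_vectorSpan_convexHull
    (fun w : {w // c w ≠ 0} => HomogeneousSpace.latticeWeight Sigma.fst w.1) hα hsum _ hJ⟩
  obtain ⟨v, hv, hvol⟩ := HomogeneousSpace.exists_mem_unitVolumeMetrics_iff H hπ hg₁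
  set γ : (Fin d → ℝ) → HomogeneousSpace.Form F := fun t =>
    HomogeneousSpace.diagonalMetric hV.internal g₁ fun i => Real.exp (t i) with hγ_def
  have hγmem : ∀ t, γ t ∈ HomogeneousSpace.invariantMetrics F H := fun t =>
    HomogeneousSpace.diagonalMetric_mem H hV hg₁ fun i => Real.exp_pos _
  have hγ : ContDiff ℝ ∞ γ :=
    (HomogeneousSpace.contDiff_diagonalMetric hV.internal g₁).comp
      (contDiff_pi.2 fun i => Real.contDiff_exp.comp (contDiff_apply ℝ ℝ i))
  have hpos : ∀ i, 0 < Module.finrank ℝ (V i) := fun i =>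
    have : Nontrivial (V i) := (Submodule.nontrivial_iff_ne_bot).2 (hbot i)
    Module.finrank_pos
  -- One unit vector for each summand: `log g(e_i, e_i)` recovers the coordinate `t_i`, and it is
  -- smooth near the metrics `γ t`.
  set e : Fin d → F := fun i => b ⟨i, ⟨0, hpos i⟩⟩ with he
  have hγe : ∀ t i, γ t (e i) (e i) = Real.exp (t i) := fun t i => by
    rw [hγ_def, HomogeneousSpace.diagonalMetric_of_mem hV.internal g₁ _ (hbV ⟨i, ⟨0, hpos i⟩⟩),
      hb, if_pos rfl, mul_one]
  have hF : 0 < Module.finrank ℝ F := by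
    have : Nontrivial F := ⟨e ⟨0, hd⟩, 0, b.ne_zero _⟩
    exact Module.finrank_pos
  have hunit : HomogeneousSpace.unitVolumeMetrics F H =
      γ '' {t | v * HomogeneousSpace.gramDet (γ t) = 1} := by
    ext g
    rw [hvol]
    constructor
    · rintro ⟨hg, hg1⟩
      obtain ⟨x, hx, rfl⟩ := HomogeneousSpace.exists_eq_diagonalMetric H hV hg hg₁
      have h : γ (fun i => Real.log (x i)) =
          HomogeneousSpace.diagonalMetric hV.internal g₁ x := by
        simp only [hγ_def, Real.exp_log (hx _)]
      exact ⟨_, by change v * HomogeneousSpace.gramDet (γ _) = 1; rw [h]; exact hg1, h⟩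
    · rintro ⟨t, ht, rfl⟩
      exact ⟨hγmem t, ht⟩
  rw [hunit]
  -- The volume condition is `D = 1` for `D = v · gramDet`. A shift of `t` by `r` multiplies the
  -- metric by `exp r` and hence `D` by `exp (r dim F)`, which explains the choice of `n`.
  refine HomogeneousSpace.isDiffeomorphismOnto_of_toricMoment
    (c := fun w : {w // c w ≠ 0} => c w)
    (α := fun w => HomogeneousSpace.latticeWeight Sigma.fst w.1)
    (D := fun t => v * HomogeneousSpace.gramDet (γ t)) (n := Module.finrank ℝ F)
    (τ := fun g i => Real.log (g (e i) (e i))) hc hα hsum hJ hγ ?_ ?_ ?_ ?_ ?_ ?_ ?_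
  · intro t
    ext i
    rw [hγe, Real.log_exp]
  · intro t
    refine contDiffAt_pi.2 fun i => ContDiffAt.log ?_ ?_
    · have h : ContDiff ℝ ∞ fun g : HomogeneousSpace.Form F => g (e i) (e i) :=
        (contDiff_id.clm_apply contDiff_const).clm_apply contDiff_const
      exact h.contDiffAt
    · rw [hγe]
      exact (Real.exp_pos _).ne'
  · exact contDiff_const.mul (HomogeneousSpace.contDiff_gramDet.comp hγ)
  · exact fun t => mul_pos hv (HomogeneousSpace.gramDet_pos (hγmem t).1 (hγmem t).2.1)
  · exact Nat.cast_ne_zero.2 hF.ne'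
  · intro t r
    have h : γ (t + fun _ => r) = Real.exp r • γ t := by
      simp only [hγ_def]
      rw [← HomogeneousSpace.diagonalMetric_smul]
      congr 1
      ext i
      rw [Pi.add_apply, Real.exp_add, mul_comm]
      rfl
    simp only [h, HomogeneousSpace.gramDet_smul, ← Real.exp_nat_mul]
    ring
  · intro t
    have h := HomogeneousSpace.modifiedRicci_diagonalMetric H hπ h𝔪 hV θ hg₁ hb hbV t
    rw [HomogeneousSpace.toricMoment_subtype c (HomogeneousSpace.latticeWeight Sigma.fst) t]
    change (LinearMap.trace ℝ F (HomogeneousSpace.modifiedRicci H θ 𝔪 (γ t)).toLinearMap)⁻¹ •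
      HomogeneousSpace.modifiedRicci H θ 𝔪 (γ t) = _
    rw [h, HomogeneousSpace.trace_weightSum hV.internal hbot hb hbV]
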